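/- Let $0<\beta<1/2$, $0\le\theta\le1$, and let $K$ be measurable on $(0,1)$ with $0<K_m\le K(x)\le K_M<\infty$ for almost every $x\in(0,1)$. For $\sigma>0$ put $${}_0^lI_x^{\sigma}w=\frac1{\Gamma(\sigma)}\int_0^x\frac{w(s)}{(x-s)^{1-\sigma}}\,ds,\qquad {}_x^rI_1^{\sigma}w=\frac1{\Gamma(\sigma)}\int_x^1\frac{w(s)}{(s-x)^{1-\sigma}}\,ds,\qquad I^\beta_\theta w=\theta\,{}_0^lI_x^\beta w+(1-\theta)\,{}_x^rI_1^\beta w,$$ and write ${}_0^lI_1^\beta w$ and ${}_0^rI_1^\beta w$ for the values of ${}_0^lI_x^\beta w$ at $x=1$ and of ${}_x^rI_1^\beta w$ at $x=0$. For $\mu>0$ let $H^\mu_0(0,1)$ be the completion of $C_0^\infty(0,1)$ with respect to the norm $\big(\|w\|_{L^2(\mathbb R)}^2+\||\omega|^\mu\mathcal F w\|_{L^2(\mathbb R)}^2\big)^{1/2}$, regarded as a subspace of $L^2(0,1)$; all functions are real valued, and $H^1(0,1)$ is the space of $w\in L^2(0,1)$ with weak derivative $Dw\in L^2(0,1)$.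 All equations between functions below hold almost everywhere on $(0,1)$. Let $w_l,w_r\in H^1(0,1)$ be the weak solutions of $$(K\,Dw_l,Dv)_{L^2(0,1)}=0=(K\,Dw_r,Dv)_{L^2(0,1)}\quad\forall v\in H^1_0(0,1),\qquad w_l(0)=w_r(1)=1,\quad w_l(1)=w_r(0)=0,$$ let $w_l^c(x)=1-x$, $w_r^c(x)=x$, and let $u_l,u_r\in H_0^{1-\beta}(0,1)$ be the solutions of $$I^\beta_\theta u_l-(1-\theta)({}_0^rI^\beta_1u_l)\,w_l^c-\theta({}_0^lI^\beta_1u_l)\,w_r^c=w_l-w_l^c,$$ $$I^\beta_\theta u_r-(1-\theta)({}_0^rI^\beta_1u_r)\,w_l^c-\theta({}_0^lI^\beta_1u_r)\,w_r^c=w_r-w_r^c.$$ Then each of $w_l,w_r,u_l,u_r$ exists and is unique, and the two conditions $$1+\theta\,({}_0^lI^\beta_1u_l)-(1-\theta)\,({}_0^rI^\beta_1u_l)\neq0,\qquad 1-\theta\,({}_0^lI^\beta_1u_r)+(1-\theta)\,({}_0^rI^\beta_1u_r)\neq0$$ are equivalent. If they hold, then the space $$\mathcal V=\Big\{g\in H^1_0(0,1):\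 \exists\,\phi\in H^{1-\beta}_0(0,1),\ \ I^\beta_\theta\phi-(1-\theta)({}_0^rI^\beta_1\phi)\,w_l-\theta({}_0^lI^\beta_1\phi)\,w_r=g\Big\}$$ equals $H^1_0(0,1)$; that is, every $g\in H^1_0(0,1)$ is of the displayed form for some $\phi\in H^{1-\beta}_0(0,1)$. -/

import Mathlib

open MeasureTheory Set
open scoped ContDiff FourierTransform ENNReal

noncomputable section

namespace TwoSidedFDE

/-- Lebesgue measure on the interval `(0,1)`. -/
abbrev vol01 : Measure ℝ := volume.restrict (Ioo (0 : ℝ) 1)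

/-- The real Hilbert space `L²(0,1)` (functions modulo a.e. equality). -/
abbrev L2 : Type := Lp ℝ 2 vol01

/-- Test functions: real functions on the line of class `C^∞`, with compact support
contained in the open interval `(0,1)`. -/
def IsTest (ψ : ℝ → ℝ) : Prop :=
  ContDiff ℝ ∞ ψ ∧ HasCompactSupport ψ ∧ tsupport ψ ⊆ Ioo 0 1

/-- The norm `(‖f‖_{L²(ℝ)}² + ‖|y|^μ (𝓕 f)(y)‖_{L²(ℝ)}²)^{1/2}` of `H^μ(ℝ)`, with values in `[0,∞]`.
It is used only for integrable `f`, so that the Fourier transform is given by its integral. -/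
def sobolevNorm (μ : ℝ) (f : ℝ → ℂ) : ℝ≥0∞ :=
  (eLpNorm f 2 volume ^ 2 +
    eLpNorm (fun y : ℝ => ((|y| ^ μ : ℝ) : ℂ) * 𝓕 f y) 2 volume ^ 2) ^ (1 / 2 : ℝ)

/-- Extension by zero of a function on `(0,1)` to the line. -/
def zeroExt (w : ℝ → ℝ) : ℝ → ℝ := (Ioo (0 : ℝ) 1).indicator w

/-- The space `H^μ_0(0,1)`: the completion of the test functions on `(0,1)` with respect to the norm
of `H^μ(ℝ)`, realised inside `L²(0,1)` as the set of those `w` whose extension by zero is a limit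
of test functions in that norm. -/
def H0 (μ : ℝ) : Set L2 :=
  {w | ∀ ε : ℝ≥0∞, 0 < ε → ∃ ψ : ℝ → ℝ, IsTest ψ ∧
    sobolevNorm μ (fun x => ((zeroExt w x - ψ x : ℝ) : ℂ)) < ε}

/-- `w' ∈ L²(0,1)` is the weak derivative of `w ∈ L²(0,1)`;
`w` belongs to `H¹(0,1)` exactly when such a `w'` exists. -/
def HasWeakDeriv (w w' : L2) : Prop :=
  ∀ ψ : ℝ → ℝ, IsTest ψ → ∫ x, w x * deriv ψ x ∂vol01 = - ∫ x, w' x * ψ x ∂vol01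

/-- The boundary values of `w` are `w(0) = p` and `w(1) = q`: they are those of
the representative of `w` that is continuous on `[0,1]`. -/
def HasBoundaryValues (w : L2) (p q : ℝ) : Prop :=
  ∃ c : ℝ → ℝ, ContinuousOn c (Icc 0 1) ∧ w =ᵐ[vol01] c ∧ c 0 = p ∧ c 1 = q

/-- `w ∈ H¹(0,1)` is a weak solution of `-D(K D w) = 0` with `w(0) = p`, `w(1) = q`,
that is, `(K D w, D v)_{L²(0,1)} = 0` for all `v ∈ H¹_0(0,1)`. -/
def IsWeakSolution (K : ℝ → ℝ) (p q : ℝ) (w : L2) : Prop :=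
  ∃ w' : L2, HasWeakDeriv w w' ∧ HasBoundaryValues w p q ∧
    ∀ v ∈ H0 1, ∀ v' : L2, HasWeakDeriv v v' → ∫ x, K x * w' x * v' x ∂vol01 = 0

/-- The left fractional integral of order `σ` with base point `a`. -/
def leftInt (a σ : ℝ) (w : ℝ → ℝ) (x : ℝ) : ℝ :=
  1 / Real.Gamma σ * ∫ s in a..x, w s / (x - s) ^ (1 - σ)

/-- The right fractional integral of order `σ` with base point `b`. -/
def rightInt (b σ : ℝ) (w : ℝ → ℝ) (x : ℝ) : ℝ :=
  1 / Real.Gamma σ * ∫ s in x..b, w s / (s - x) ^ (1 - σ)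

/-- The two-sided fractional integral `I^β_θ` on `(0,1)`. -/
def twoSidedInt (β θ : ℝ) (w : ℝ → ℝ) (x : ℝ) : ℝ :=
  θ * leftInt 0 β w x + (1 - θ) * rightInt 1 β w x

/-- The function
`I^β_θ φ - (1-θ) (right fractional integral of φ at 0) p - θ (left fractional integral of φ at 1) q`.
-/
def boundaryCorrected (β θ : ℝ) (p q φ : ℝ → ℝ) (x : ℝ) : ℝ :=
  twoSidedInt β θ φ x - (1 - θ) * rightInt 1 β φ 0 * p x - θ * leftInt 0 β φ 1 * q x

/-- `u ∈ H^{1-β}_0(0,1)` solves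
`I^β_θ u - (1-θ) (right integral of u at 0) (1-x) - θ (left integral of u at 1) x = w - wc`. -/
def IsCorrector (β θ : ℝ) (w : L2) (wc : ℝ → ℝ) (u : L2) : Prop :=
  u ∈ H0 (1 - β) ∧
    boundaryCorrected β θ (fun x => 1 - x) (fun x => x) u =ᵐ[vol01] fun x => w x - wc x

/-- The space `𝒱`. -/
def spaceV (β θ : ℝ) (wl wr : L2) : Set L2 :=
  {g | g ∈ H0 1 ∧ ∃ φ ∈ H0 (1 - β), boundaryCorrected β θ wl wr φ =ᵐ[vol01] g}

end TwoSidedFDE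

end

noncomputable section

namespace TwoSidedFDE

/-! Write I_l, I_r for the left and right integrals of order β. For φ in H^{1-β}_0 set a = D I_l φ
and b = D I_r φ; for test functions these are I_l φ' and I_r φ'. The equations concern T φ = θ a +
(1-θ) b, the derivative of I^β_θ φ, and the number τ(φ) = θ (I_l φ)(1) - (1-θ) (I_r φ)(0), which is
the mean of T φ. With the corrections 1-x and x, the equation with datum g in H^1_0 becomes T φ = g'
+ τ(φ). With w_l = 1 - W and w_r = W, where W is the primitive of the multiple k of 1/K with mean
one, it becomes T φ = g' + τ(φ) k.

The heart is that the range of T is closed, of codimension one, and transversal to the constants,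
and that T is injective. The semigroup law gives (a,b) as a positive multiple of the Riesz energy ∬
|x-y|^(2β-1) φ'(x) φ'(y). This energy is also a multiple of the squared L²(ℝ) norm of I_l φ', and of
I_r φ', and, on the Fourier side, of the squared Sobolev seminorm of order 1-β. Hence (a,b)
dominates the squares of the norms of a and b (`exists_graph_coercive`), and the closed graph of φ ↦
(a,b) lives over exactly H^{1-β}_0. Testing T φ against a + b bounds T from below, so its range is
closed (`isClosed_rangeD`).

If h annihilates the range, adjointness and the lemma of du Bois-Reymond make (1-θ) I_l h + θ I_r h
a constant C, and pairing with h gives C ∫ h as a positive multiple of the energy of order β of h.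
Thus C and ∫ h are nonzero unless h = 0 (`eq_zero_of_const_mul_integral`), so annihilators form at
most a line. They are not trivial: the kernel representing the value φ(1) = 0 is orthogonal to every
a and cannot lie in the range. So T is bijective modulo constants (`exists_graph_add_const`,
`graph_eq_zero_of_combine_eq_const`), which solves the constant coefficient problem.

The data of u_l and u_r are opposite, so u_r = -u_l and both conditions say 1 + τ(u_l) ≠ 0. Given g,
solve T φ₀ = g' + c and add s u_l: since T u_l = 1 - k + τ(u_l), the equation for φ₀ + s u_l holds
when c + s (1 + τ(u_l)) = 0. -/

/-! ### Fractional kernels and their convolutions -/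

/-- The causal kernel `z_+^(σ-1) / Γ(σ)` of fractional integration. -/
def kappa (σ z : ℝ) : ℝ := (Ioi (0 : ℝ)).indicator (fun z => z ^ (σ - 1) / Real.Gamma σ) z

lemma kappa_of_pos {σ z : ℝ} (hz : 0 < z) : kappa σ z = z ^ (σ - 1) / Real.Gamma σ :=
  indicator_of_mem (mem_Ioi.2 hz) _

lemma kappa_of_nonpos {σ z : ℝ} (hz : z ≤ 0) : kappa σ z = 0 :=
  indicator_of_notMem (notMem_Ioi.2 hz) _

lemma kappa_nonneg {σ : ℝ} (hσ : 0 < σ) (z : ℝ) : 0 ≤ kappa σ z := by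
  rcases le_or_gt z 0 with h | h
  · rw [kappa_of_nonpos h]
  · rw [kappa_of_pos h]
    have := Real.Gamma_pos_of_pos hσ
    positivity

@[fun_prop]
lemma measurable_kappa (σ : ℝ) : Measurable (kappa σ) :=
  (by fun_prop : Measurable fun z : ℝ => z ^ (σ - 1) / Real.Gamma σ).indicator measurableSet_Ioi

lemma kappa_one_of_pos {z : ℝ} (hz : 0 < z) : kappa 1 z = 1 := by
  simp [kappa_of_pos hz]

/-- Integrating a nonnegative kernel against a function over a product space. -/
lemma integrable_kernel_mul {T Z : Type*} [MeasurableSpace T] [MeasurableSpace Z]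
    {μ : Measure T} [SFinite μ] {ν : Measure Z} [SFinite ν] {k : T → Z → ℝ} {m F : Z → ℝ}
    (hk : Measurable (Function.uncurry k)) (hk0 : ∀ t z, 0 ≤ k t z)
    (hm : ∀ᵐ z ∂ν, ∫⁻ t, ENNReal.ofReal (k t z) ∂μ = ENNReal.ofReal (m z)) (hm0 : ∀ᵐ z ∂ν, 0 ≤ m z)
    (hF : AEStronglyMeasurable F ν) (hmF : Integrable (fun z => m z * F z) ν) :
    Integrable (fun p : T × Z => k p.1 p.2 * F p.2) (μ.prod ν) := by
  have hmeas : AEStronglyMeasurable (fun p : T × Z => k p.1 p.2 * F p.2) (μ.prod ν) :=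
    hk.aestronglyMeasurable.mul hF.comp_snd
  rw [integrable_prod_iff' hmeas]
  have hint : ∀ᵐ z ∂ν, Integrable (fun t => k t z) μ := by
    filter_upwards [hm] with z hz
    have h1 : Measurable fun t => k t z := hk.comp measurable_prodMk_right
    refine ⟨h1.aestronglyMeasurable, ?_⟩
    rw [hasFiniteIntegral_iff_ofReal (ae_of_all _ fun t => hk0 t z), hz]
    exact ENNReal.ofReal_lt_top
  refine ⟨hint.mono fun z hz => hz.mul_const (F z), hmF.norm.congr ?_⟩
  filter_upwards [hm, hm0] with z hz hz0
  have h1 : Measurable fun t => k t z := hk.comp measurable_prodMk_right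
  simp only [norm_mul, integral_mul_const]
  congr 1
  simp_rw [fun t => Real.norm_of_nonneg (hk0 t z)]
  rw [integral_eq_lintegral_of_nonneg_ae (ae_of_all _ fun t => hk0 t z) h1.aestronglyMeasurable, hz,
    ENNReal.toReal_ofReal hz0, Real.norm_of_nonneg hz0]

lemma integral_integral_kernel_mul {T Z : Type*} [MeasurableSpace T] [MeasurableSpace Z]
    {μ : Measure T} [SFinite μ] {ν : Measure Z} [SFinite ν] {k : T → Z → ℝ} {m F : Z → ℝ}
    (hk : Measurable (Function.uncurry k)) (hk0 : ∀ t z, 0 ≤ k t z)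
    (hm : ∀ᵐ z ∂ν, ∫⁻ t, ENNReal.ofReal (k t z) ∂μ = ENNReal.ofReal (m z)) (hm0 : ∀ᵐ z ∂ν, 0 ≤ m z)
    (hF : AEStronglyMeasurable F ν) (hmF : Integrable (fun z => m z * F z) ν) :
    ∫ t, ∫ z, k t z * F z ∂ν ∂μ = ∫ z, m z * F z ∂ν := by
  rw [integral_integral_swap (integrable_kernel_mul hk hk0 hm hm0 hF hmF)]
  refine integral_congr_ae ?_
  filter_upwards [hm, hm0] with z hz hz0
  have h1 : Measurable fun t => k t z := hk.comp measurable_prodMk_right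
  rw [integral_mul_const, integral_eq_lintegral_of_nonneg_ae (ae_of_all _ fun t => hk0 t z)
    h1.aestronglyMeasurable, hz, ENNReal.toReal_ofReal hz0]

/-- The semigroup law of fractional integration, for the kernels. -/
lemma lintegral_kappa_mul_kappa {p q : ℝ} (hp : 0 < p) (hq : 0 < q) (x y : ℝ) :
    ∫⁻ t, ENNReal.ofReal (kappa p (x - t) * kappa q (t - y)) =
      ENNReal.ofReal (kappa (p + q) (x - y)) := by
  rcases le_or_gt x y with hxy | hxy
  · rw [kappa_of_nonpos (by linarith)]
    have : ∀ t, kappa p (x - t) * kappa q (t - y) = 0 := by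
      intro t
      rcases le_or_gt x t with h | h
      · rw [kappa_of_nonpos (z := x - t) (by linarith), zero_mul]
      · rw [kappa_of_nonpos (z := t - y) (by linarith), mul_zero]
    simp [this]
  have hr : 0 < x - y := sub_pos.2 hxy
  set r := x - y with hrdef
  -- With u = (t-y)/r the product is a multiple of the Beta(q,p) density in u; that the density has
  -- mass one is the Beta integral.
  have key : ∀ t, kappa p (x - t) * kappa q (t - y) =
      r ^ (p + q - 2) / Real.Gamma (p + q) *
        ProbabilityTheory.betaPDFReal q p (r⁻¹ * (t - y)) := by
    intro t
    by_cases h1 : 0 < t - y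
    · by_cases h2 : 0 < x - t
      · have hu : 0 < r⁻¹ * (t - y) := by positivity
        have hu' : 1 - r⁻¹ * (t - y) = r⁻¹ * (x - t) := by
          field_simp; rw [hrdef]; ring
        have hu1 : r⁻¹ * (t - y) < 1 := by
          have : 0 < r⁻¹ * (x - t) := by positivity
          linarith
        rw [kappa_of_pos h1, kappa_of_pos h2, ProbabilityTheory.betaPDFReal, if_pos ⟨hu, hu1⟩, hu',
          ProbabilityTheory.beta, Real.mul_rpow (by positivity) h1.le,
          Real.mul_rpow (by positivity) h2.le, add_comm q p, Real.inv_rpow hr.le, Real.inv_rpow hr.le,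
          show p + q - 2 = (p - 1) + (q - 1) by ring, Real.rpow_add hr]
        field_simp
      · rw [kappa_of_nonpos (z := x - t) (by linarith), ProbabilityTheory.betaPDFReal, if_neg]
        · simp
        · rintro ⟨-, h⟩
          rw [inv_mul_lt_iff₀ hr] at h
          linarith
    · rw [kappa_of_nonpos (z := t - y) (by linarith), ProbabilityTheory.betaPDFReal, if_neg]
      · simp
      · rintro ⟨h, -⟩
        exact h1 (pos_of_mul_pos_right h (by positivity))
  have hmeas : Measurable (ProbabilityTheory.betaPDFReal q p) := by fun_prop
  have h0 : ∀ u, 0 ≤ ProbabilityTheory.betaPDFReal q p u := by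
    intro u
    by_cases hu : 0 < u ∧ u < 1
    · exact (ProbabilityTheory.betaPDFReal_pos hu.1 hu.2 hq hp).le
    · rw [ProbabilityTheory.betaPDFReal, if_neg hu]
  have hone : ∫⁻ u, ENNReal.ofReal (ProbabilityTheory.betaPDFReal q p u) = 1 :=
    ProbabilityTheory.lintegral_betaPDF_eq_one hq hp
  have hint : Integrable (ProbabilityTheory.betaPDFReal q p) := by
    refine ⟨hmeas.aestronglyMeasurable, ?_⟩
    rw [hasFiniteIntegral_iff_ofReal (ae_of_all _ h0), hone]
    exact ENNReal.one_lt_top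
  have hval : ∫ u, ProbabilityTheory.betaPDFReal q p u = 1 := by
    rw [integral_eq_lintegral_of_nonneg_ae (ae_of_all _ h0) hmeas.aestronglyMeasurable, hone]
    simp
  have hint2 : Integrable fun t => ProbabilityTheory.betaPDFReal q p (r⁻¹ * (t - y)) :=
    (hint.comp_mul_left' (inv_ne_zero hr.ne')).comp_sub_right y
  simp_rw [key]
  rw [← ofReal_integral_eq_lintegral_ofReal (hint2.const_mul _)
    (ae_of_all _ fun t => mul_nonneg (by positivity) (h0 _)), integral_const_mul,
    integral_sub_right_eq_self (fun t => ProbabilityTheory.betaPDFReal q p (r⁻¹ * t)),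
    Measure.integral_comp_inv_mul_left, hval, kappa_of_pos hr]
  congr 1
  rw [abs_of_pos hr, show p + q - 2 = (p + q - 1) - 1 by ring, Real.rpow_sub_one hr.ne']
  simp only [smul_eq_mul]
  field_simp

/-- Two causal kernels with the same direction. -/
lemma exists_lintegral_kappa_mul_kappa_self {β : ℝ} (h0 : 0 < β) (h1 : β < 1 / 2) :
    ∃ c : ℝ, 0 < c ∧ ∀ x y : ℝ, x ≠ y →
      ∫⁻ t, ENNReal.ofReal (kappa β (t - x) * kappa β (t - y)) =
        ENNReal.ofReal (c * |x - y| ^ (2 * β - 1)) := by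
  set g : ℝ → ℝ := fun u => kappa β u * kappa β (u + 1) with hg
  have hgm : Measurable g := by fun_prop
  have hg0 : ∀ u, 0 ≤ g u := fun u => mul_nonneg (kappa_nonneg h0 _) (kappa_nonneg h0 _)
  have hgz : ∀ u ∉ Ioi (0 : ℝ), g u = 0 := fun u hu => by
    simp [hg, kappa_of_nonpos (notMem_Ioi.1 hu)]
  have hgpos : ∀ u ∈ Ioi (0 : ℝ), g u = u ^ (β - 1) * (u + 1) ^ (β - 1) / Real.Gamma β ^ 2 := by
    intro u hu
    have hu' : 0 < u := hu
    simp only [hg]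
    rw [kappa_of_pos hu', kappa_of_pos (by linarith)]
    ring
  have hgi : Integrable g := by
    have e : g = (Ioi (0 : ℝ)).indicator g := by
      ext u
      by_cases hu : u ∈ Ioi (0 : ℝ)
      · simp [hu]
      · rw [indicator_of_notMem hu, hgz u hu]
    -- Near 0 the integrand is at most a multiple of u^(β-1), on (1,∞) of u^(2β-2); the latter is
    -- integrable because β < 1/2.
    rw [e, integrable_indicator_iff measurableSet_Ioi, ← Ioc_union_Ioi_eq_Ioi zero_le_one]
    refine IntegrableOn.union ?_ ?_
    · have h2 : IntegrableOn (fun u : ℝ => u ^ (β - 1) / Real.Gamma β ^ 2) (Ioc 0 1) :=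
        ((intervalIntegral.intervalIntegrable_rpow' (a := 0) (b := 1)
          (by linarith : -1 < β - 1)).1).div_const _
      refine Integrable.mono' h2 hgm.aestronglyMeasurable ?_
      refine (ae_restrict_iff' measurableSet_Ioc).2 (ae_of_all _ fun u hu => ?_)
      rw [Real.norm_of_nonneg (hg0 u), hgpos u hu.1]
      have hu0 : 0 < u := hu.1
      have : (u + 1) ^ (β - 1) ≤ 1 :=
        Real.rpow_le_one_of_one_le_of_nonpos (by linarith) (by linarith)
      have h3 : 0 ≤ u ^ (β - 1) := by positivity
      gcongr
      nlinarith
    · have h2 : IntegrableOn (fun u : ℝ => u ^ (2 * β - 2) / Real.Gamma β ^ 2) (Ioi 1) :=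
        (integrableOn_Ioi_rpow_of_lt (by linarith) one_pos).div_const _
      refine Integrable.mono' h2 hgm.aestronglyMeasurable ?_
      refine (ae_restrict_iff' measurableSet_Ioi).2 (ae_of_all _ fun u hu => ?_)
      have hu0 : (0 : ℝ) < u := lt_trans one_pos hu
      rw [Real.norm_of_nonneg (hg0 u), hgpos u hu0]
      have : (u + 1) ^ (β - 1) ≤ u ^ (β - 1) :=
        Real.rpow_le_rpow_of_nonpos hu0 (by linarith) (by linarith)
      rw [show 2 * β - 2 = (β - 1) + (β - 1) by ring, Real.rpow_add hu0]
      gcongr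
  have hpos : 0 < ∫ u, g u := by
    rw [integral_pos_iff_support_of_nonneg hg0 hgi]
    have : Ioi (0 : ℝ) ⊆ Function.support g := by
      intro u hu
      have hu0 : (0 : ℝ) < u := hu
      rw [Function.mem_support, hgpos u hu]
      positivity
    exact lt_of_lt_of_le (by simp) (measure_mono this)
  have main : ∀ x y : ℝ, y < x → ∫⁻ t, ENNReal.ofReal (kappa β (t - x) * kappa β (t - y)) =
        ENNReal.ofReal ((∫ u, g u) * |x - y| ^ (2 * β - 1)) := by
    intro x y hxy
    have hr : 0 < x - y := sub_pos.2 hxy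
    -- Scaling t = x + (x-y) u extracts the power 2β-2 of the distance; the Jacobian raises it to
    -- 2β-1.
    have key : ∀ t, kappa β (t - x) * kappa β (t - y) =
        (x - y) ^ (2 * β - 2) * g ((x - y)⁻¹ * (t - x)) := by
      intro t
      rcases le_or_gt (t - x) 0 with h | h
      · rw [kappa_of_nonpos h, hgz]
        · simp
        · rw [notMem_Ioi]
          exact mul_nonpos_of_nonneg_of_nonpos (by positivity) h
      · have hy : 0 < t - y := by linarith
        have e : (x - y)⁻¹ * (t - x) + 1 = (x - y)⁻¹ * (t - y) := by
          field_simp; ring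
        rw [hgpos _ (mem_Ioi.2 (by positivity)), e, kappa_of_pos h, kappa_of_pos hy,
          Real.mul_rpow (by positivity) h.le, Real.mul_rpow (by positivity) hy.le,
          Real.inv_rpow hr.le, show 2 * β - 2 = (β - 1) + (β - 1) by ring, Real.rpow_add hr]
        field_simp
    have hi2 : Integrable fun t => g ((x - y)⁻¹ * (t - x)) :=
      (hgi.comp_mul_left' (inv_ne_zero hr.ne')).comp_sub_right x
    simp_rw [key]
    rw [← ofReal_integral_eq_lintegral_ofReal (hi2.const_mul _)
      (ae_of_all _ fun t => mul_nonneg (by positivity) (hg0 _)), integral_const_mul,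
      integral_sub_right_eq_self (fun t => g ((x - y)⁻¹ * t)),
      Measure.integral_comp_inv_mul_left]
    congr 1
    rw [abs_of_pos hr, show 2 * β - 2 = (2 * β - 1) - 1 by ring, Real.rpow_sub_one hr.ne']
    simp only [smul_eq_mul]
    field_simp
  refine ⟨_, hpos, fun x y hxy => ?_⟩
  rcases lt_or_gt_of_ne hxy with h | h
  · simp_rw [mul_comm (kappa β (_ - x))]
    rw [main y x h, abs_sub_comm]
  · exact main x y h


/-! ### Integrability on the unit square and the Riesz energy -/

lemma integrableOn_kappa_Iic {σ : ℝ} (hσ : 0 < σ) (R : ℝ) : IntegrableOn (kappa σ) (Iic R) := by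
  have h1 : IntegrableOn (kappa σ) (Ioc 0 (max R 0)) := by
    have h2 : IntegrableOn (fun u : ℝ => u ^ (σ - 1) / Real.Gamma σ) (Ioc 0 (max R 0)) :=
      ((intervalIntegral.intervalIntegrable_rpow' (a := 0) (b := max R 0)
        (by linarith : -1 < σ - 1)).1).div_const _
    exact h2.congr_fun (fun u hu => (kappa_of_pos hu.1).symm) measurableSet_Ioc
  have h3 : IntegrableOn (kappa σ) (Iic 0) :=
    integrableOn_zero.congr_fun (fun u hu => (kappa_of_nonpos hu).symm) measurableSet_Iic
  refine (h3.union h1).mono_set fun u hu => ?_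
  rcases le_or_gt u 0 with h | h
  · exact Or.inl h
  · exact Or.inr ⟨h, le_max_of_le_left hu⟩

lemma integrable_kappa_sub_left {σ : ℝ} (hσ : 0 < σ) (x : ℝ) :
    Integrable (fun s => kappa σ (x - s)) vol01 := by
  have h := (integrable_indicator_iff measurableSet_Iic).2 (integrableOn_kappa_Iic hσ x)
  have h2 := (h.comp_sub_left x).integrableOn (s := Ioo 0 1)
  refine h2.congr_fun (fun s hs => ?_) measurableSet_Ioo
  have : x - s ∈ Iic x := by simpa using hs.1.le
  simp only [indicator_of_mem this]

lemma integrable_kappa_sub_right {σ : ℝ} (hσ : 0 < σ) (x : ℝ) :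
    Integrable (fun s => kappa σ (s - x)) vol01 := by
  have h := (integrable_indicator_iff measurableSet_Iic).2 (integrableOn_kappa_Iic hσ (1 - x))
  have h2 := (h.comp_sub_right x).integrableOn (s := Ioo 0 1)
  refine h2.congr_fun (fun s hs => ?_) measurableSet_Ioo
  have : s - x ∈ Iic (1 - x) := by simpa using hs.2.le
  simp only [indicator_of_mem this]

lemma abs_rpow_eq_kappa {σ : ℝ} (hσ : 0 < σ) {z : ℝ} (hz : z ≠ 0) :
    |z| ^ (σ - 1) = Real.Gamma σ * (kappa σ z + kappa σ (-z)) := by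
  rcases lt_or_gt_of_ne hz with h | h
  · rw [kappa_of_nonpos h.le, kappa_of_pos (by linarith : 0 < -z), abs_of_neg h]
    field_simp; ring
  · rw [kappa_of_nonpos (by linarith : -z ≤ 0), kappa_of_pos h, abs_of_pos h]
    field_simp; ring

lemma ae_prod_ne : ∀ᵐ z : ℝ × ℝ ∂vol01.prod vol01, z.1 ≠ z.2 := by
  have hs : MeasurableSet {z : ℝ × ℝ | z.1 ≠ z.2} :=
    (measurableSet_eq_fun measurable_fst measurable_snd).compl
  rw [Measure.ae_prod_iff_ae_ae hs]
  refine ae_of_all _ fun x => ?_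
  have : ∀ᵐ y ∂vol01, y ≠ x := Measure.ae_ne _ x
  exact this.mono fun y hy => hy.symm

/-- Shorthand for the product measure on the unit square. -/
abbrev vol01sq : Measure (ℝ × ℝ) := vol01.prod vol01

/-- This is the integrand of a convolution of two integrable functions: differences of points of
(0,1) are at most 1, so the kernel may be cut off there. -/
lemma integrable_kappa_mul_fst {σ : ℝ} (hσ : 0 < σ) {f : ℝ → ℝ} (hf : Integrable f vol01) :
    Integrable (fun z : ℝ × ℝ => kappa σ (z.2 - z.1) * f z.1) vol01sq := by
  have hf' : Integrable ((Ioo (0 : ℝ) 1).indicator f) :=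
    (integrable_indicator_iff measurableSet_Ioo).2 hf
  have hk : Integrable ((Iic (1 : ℝ)).indicator (kappa σ)) :=
    (integrable_indicator_iff measurableSet_Iic).2 (integrableOn_kappa_Iic hσ 1)
  have h := hf'.convolution_integrand (ContinuousLinearMap.mul ℝ ℝ) hk
  have e : (volume.prod volume).restrict (Ioo (0 : ℝ) 1 ×ˢ Ioo (0 : ℝ) 1) = vol01sq := by
    rw [vol01sq, Measure.prod_restrict]
  have h3 : Integrable (fun p : ℝ × ℝ => (ContinuousLinearMap.mul ℝ ℝ)
      ((Ioo (0 : ℝ) 1).indicator f p.2) ((Iic (1 : ℝ)).indicator (kappa σ) (p.1 - p.2))) vol01sq := by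
    rw [← e]; exact h.integrableOn (s := Ioo 0 1 ×ˢ Ioo 0 1)
  have h4 := h3.swap
  have hmem : ∀ᵐ z ∂vol01sq, z ∈ Ioo (0 : ℝ) 1 ×ˢ Ioo (0 : ℝ) 1 := by
    rw [← e]; exact ae_restrict_mem (measurableSet_Ioo.prod measurableSet_Ioo)
  refine h4.congr ?_
  filter_upwards [hmem] with z hz
  have hz2 : z.2 - z.1 ∈ Iic (1 : ℝ) := by
    have := hz.1.1; have := hz.2.2; rw [mem_Iic]; linarith
  simp only [Function.comp, Prod.fst_swap, Prod.snd_swap, ContinuousLinearMap.mul_apply']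
  rw [indicator_of_mem hz.1, indicator_of_mem hz2, mul_comm]

/-- The reflection x ↦ 1 - x, combined with a swap of the variables, preserves the kernel and
exchanges the roles of the two points. -/
lemma integrable_kappa_mul_snd {σ : ℝ} (hσ : 0 < σ) {f : ℝ → ℝ} (hf : Integrable f vol01) :
    Integrable (fun z : ℝ × ℝ => kappa σ (z.2 - z.1) * f z.2) vol01sq := by
  have hrefl : MeasurePreserving (fun x : ℝ => 1 - x) vol01 vol01 := by
    have h := (Measure.measurePreserving_sub_left volume (1 : ℝ)).restrict_preimage
      (measurableSet_Ioo (a := (0 : ℝ)) (b := 1))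
    have e : (fun x : ℝ => 1 - x) ⁻¹' Ioo 0 1 = Ioo 0 1 := by
      ext x; simp only [mem_preimage, mem_Ioo]; constructor <;> rintro ⟨h1, h2⟩ <;>
        constructor <;> linarith
    rw [e] at h
    exact h
  have h1 : Integrable (fun x => f (1 - x)) vol01 := hrefl.integrable_comp_of_integrable hf
  have h2 := (integrable_kappa_mul_fst hσ h1).swap
  have h3 := (hrefl.prod hrefl).integrable_comp_of_integrable h2
  refine h3.congr (ae_of_all _ fun z => ?_)
  simp only [Function.comp, Prod.map, Prod.fst_swap, Prod.snd_swap]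
  congr 2 <;> ring

/-- By |f g| ≤ f² + g² the two cases with a single integrable factor suffice. -/
lemma integrable_kappa_mul_mul {σ : ℝ} (hσ : 0 < σ) {f g : ℝ → ℝ} (hf : MemLp f 2 vol01)
    (hg : MemLp g 2 vol01) :
    Integrable (fun z : ℝ × ℝ => kappa σ (z.2 - z.1) * (f z.1 * g z.2)) vol01sq := by
  have h := (integrable_kappa_mul_fst hσ hf.integrable_sq).add
    (integrable_kappa_mul_snd hσ hg.integrable_sq)
  refine h.mono' ?_ (ae_of_all _ fun z => ?_)
  · exact (by fun_prop : Measurable fun z : ℝ × ℝ => kappa σ (z.2 - z.1)).aestronglyMeasurable.mul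
      (hf.1.comp_fst.mul hg.1.comp_snd)
  · have hk := kappa_nonneg hσ (z.2 - z.1)
    simp only [Pi.add_apply]
    rw [norm_mul, Real.norm_of_nonneg hk, ← mul_add]
    gcongr
    rw [Real.norm_eq_abs, abs_le]
    constructor <;> nlinarith [sq_nonneg (f z.1 + g z.2), sq_nonneg (f z.1 - g z.2),
      sq_nonneg (f z.1), sq_nonneg (g z.2)]

/-- The energy `∬ |x-y|^(σ-1) f(x) f(y)`. -/
def energy (σ : ℝ) (f : ℝ → ℝ) : ℝ :=
  ∫ z, |z.1 - z.2| ^ (σ - 1) * (f z.1 * f z.2) ∂vol01sq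

lemma riesz_eq_kappa {σ : ℝ} (hσ : 0 < σ) (f : ℝ → ℝ) :
    (fun z : ℝ × ℝ => |z.1 - z.2| ^ (σ - 1) * (f z.1 * f z.2)) =ᵐ[vol01sq] fun z =>
      Real.Gamma σ * (kappa σ (z.2 - z.1) * (f z.1 * f z.2)) +
      Real.Gamma σ * (kappa σ (z.1 - z.2) * (f z.2 * f z.1)) := by
  filter_upwards [ae_prod_ne] with z hz
  rw [abs_rpow_eq_kappa hσ (sub_ne_zero.2 hz), neg_sub]
  ring

lemma integrable_riesz {σ : ℝ} (hσ : 0 < σ) {f : ℝ → ℝ} (hf : MemLp f 2 vol01) :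
    Integrable (fun z : ℝ × ℝ => |z.1 - z.2| ^ (σ - 1) * (f z.1 * f z.2)) vol01sq := by
  have h := (integrable_kappa_mul_mul hσ hf hf).const_mul (Real.Gamma σ)
  exact (h.add h.swap).congr (riesz_eq_kappa hσ f).symm

lemma energy_eq_kappa {σ : ℝ} (hσ : 0 < σ) {f : ℝ → ℝ} (hf : MemLp f 2 vol01) :
    energy σ f = 2 * Real.Gamma σ * ∫ z, kappa σ (z.2 - z.1) * (f z.1 * f z.2) ∂vol01sq := by
  have h := (integrable_kappa_mul_mul hσ hf hf).const_mul (Real.Gamma σ)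
  rw [energy, integral_congr_ae (riesz_eq_kappa hσ f), integral_add h]
  · have e := integral_prod_swap (μ := vol01) (ν := vol01)
      (fun z : ℝ × ℝ => Real.Gamma σ * (kappa σ (z.2 - z.1) * (f z.1 * f z.2)))
    simp only [Prod.fst_swap, Prod.snd_swap] at e
    rw [e, integral_const_mul]
    ring
  · exact h.swap

/-! ### Fractional integrals on (0,1) and their L² pairings -/

/-- Left fractional integral on `(0,1)`, with the kernel `kappa`. -/
def leftI (σ : ℝ) (f : ℝ → ℝ) (x : ℝ) : ℝ := ∫ s, kappa σ (x - s) * f s ∂vol01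

/-- Right fractional integral on `(0,1)`, with the kernel `kappa`. -/
def rightI (σ : ℝ) (f : ℝ → ℝ) (x : ℝ) : ℝ := ∫ s, kappa σ (s - x) * f s ∂vol01

lemma leftInt_eq_leftI (σ : ℝ) (f : ℝ → ℝ) {x : ℝ} (hx : x ∈ Icc (0 : ℝ) 1) :
    leftInt 0 σ f x = leftI σ f x := by
  rw [leftInt, leftI, intervalIntegral.integral_of_le hx.1, integral_Ioc_eq_integral_Ioo,
    ← integral_const_mul]
  have e : (fun s => kappa σ (x - s) * f s) =
      (Iio x).indicator fun s => 1 / Real.Gamma σ * (f s / (x - s) ^ (1 - σ)) := by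
    ext s
    by_cases h : s < x
    · have h' : 0 < x - s := sub_pos.2 h
      rw [indicator_of_mem (mem_Iio.2 h), kappa_of_pos h', show σ - 1 = -(1 - σ) by ring,
        Real.rpow_neg h'.le]
      ring
    · rw [indicator_of_notMem (by simpa using h), kappa_of_nonpos (by linarith), zero_mul]
  rw [e, setIntegral_indicator measurableSet_Iio]
  congr 2
  ext s
  simp only [mem_Ioo, mem_inter_iff, mem_Iio]
  exact ⟨fun h => ⟨⟨h.1, h.2.trans_le hx.2⟩, h.2⟩, fun h => ⟨h.1.1, h.2⟩⟩

lemma rightInt_eq_rightI (σ : ℝ) (f : ℝ → ℝ) {x : ℝ} (hx : x ∈ Icc (0 : ℝ) 1) :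
    rightInt 1 σ f x = rightI σ f x := by
  rw [rightInt, rightI, intervalIntegral.integral_of_le hx.2, integral_Ioc_eq_integral_Ioo,
    ← integral_const_mul]
  have e : (fun s => kappa σ (s - x) * f s) =
      (Ioi x).indicator fun s => 1 / Real.Gamma σ * (f s / (s - x) ^ (1 - σ)) := by
    ext s
    by_cases h : x < s
    · have h' : 0 < s - x := sub_pos.2 h
      rw [indicator_of_mem (mem_Ioi.2 h), kappa_of_pos h', show σ - 1 = -(1 - σ) by ring,
        Real.rpow_neg h'.le]
      ring
    · rw [indicator_of_notMem (by simpa using h), kappa_of_nonpos (by linarith), zero_mul]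
  rw [e, setIntegral_indicator measurableSet_Ioi]
  congr 2
  ext s
  simp only [mem_Ioo, mem_inter_iff, mem_Ioi]
  exact ⟨fun h => ⟨⟨hx.1.trans_lt h.1, h.2⟩, h.1⟩, fun h => ⟨h.2, h.1.2⟩⟩

lemma leftI_of_nonpos {σ : ℝ} (f : ℝ → ℝ) {x : ℝ} (hx : x ≤ 0) : leftI σ f x = 0 := by
  rw [leftI, setIntegral_congr_fun (g := fun _ => 0) measurableSet_Ioo]
  · simp
  · intro s hs
    simp only
    rw [kappa_of_nonpos (by linarith [hs.1]), zero_mul]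

lemma rightI_of_one_le {σ : ℝ} (f : ℝ → ℝ) {x : ℝ} (hx : 1 ≤ x) : rightI σ f x = 0 := by
  rw [rightI, setIntegral_congr_fun (g := fun _ => 0) measurableSet_Ioo]
  · simp
  · intro s hs
    simp only
    rw [kappa_of_nonpos (by linarith [hs.2]), zero_mul]

/-- Fubini for a product of two kernel integrals. -/
lemma integral_mul_kernel {k₁ k₂ : ℝ → ℝ → ℝ} {m : ℝ × ℝ → ℝ} {f g : ℝ → ℝ}
    (hk₁ : Measurable (Function.uncurry k₁)) (hk₂ : Measurable (Function.uncurry k₂))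
    (hk₁0 : ∀ t x, 0 ≤ k₁ t x) (hk₂0 : ∀ t x, 0 ≤ k₂ t x)
    (hm : ∀ᵐ z ∂vol01sq, ∫⁻ t, ENNReal.ofReal (k₁ t z.1 * k₂ t z.2) = ENNReal.ofReal (m z))
    (hm0 : ∀ᵐ z ∂vol01sq, 0 ≤ m z) (hf : AEStronglyMeasurable f vol01)
    (hg : AEStronglyMeasurable g vol01)
    (hmF : Integrable (fun z : ℝ × ℝ => m z * (f z.1 * g z.2)) vol01sq) :
    Integrable (fun t => (∫ x, k₁ t x * f x ∂vol01) * ∫ y, k₂ t y * g y ∂vol01) ∧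
    ∫ t, (∫ x, k₁ t x * f x ∂vol01) * ∫ y, k₂ t y * g y ∂vol01 =
      ∫ z, m z * (f z.1 * g z.2) ∂vol01sq := by
  have hk : Measurable (Function.uncurry fun (t : ℝ) (z : ℝ × ℝ) => k₁ t z.1 * k₂ t z.2) :=
    (hk₁.comp (measurable_fst.prodMk (measurable_fst.comp measurable_snd))).mul
      (hk₂.comp (measurable_fst.prodMk (measurable_snd.comp measurable_snd)))
  have hk0 : ∀ (t : ℝ) (z : ℝ × ℝ), 0 ≤ k₁ t z.1 * k₂ t z.2 :=
    fun t z => mul_nonneg (hk₁0 _ _) (hk₂0 _ _)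
  have hF : AEStronglyMeasurable (fun z : ℝ × ℝ => f z.1 * g z.2) vol01sq :=
    hf.comp_fst.mul hg.comp_snd
  have e : ∀ t, (∫ x, k₁ t x * f x ∂vol01) * ∫ y, k₂ t y * g y ∂vol01 =
      ∫ z : ℝ × ℝ, (k₁ t z.1 * k₂ t z.2) * (f z.1 * g z.2) ∂vol01sq := by
    intro t
    rw [← integral_prod_mul]
    congr 1
    ext z
    ring
  have hint := integrable_kernel_mul (μ := volume) hk hk0 hm hm0 hF hmF
  have heq := integral_integral_kernel_mul (μ := volume) hk hk0 hm hm0 hF hmF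
  simp_rw [e]
  exact ⟨hint.integral_prod_left, heq⟩

lemma measurable_kappa_sub (σ : ℝ) : Measurable (Function.uncurry fun t x : ℝ => kappa σ (t - x)) := by
  unfold Function.uncurry; fun_prop

lemma measurable_kappa_sub' (σ : ℝ) :
    Measurable (Function.uncurry fun t x : ℝ => kappa σ (x - t)) := by
  unfold Function.uncurry; fun_prop

/-- `(I_l f, I_r f) = c ∬ |x-y|^(2β-1) f f`. -/
lemma integral_leftI_mul_rightI {β : ℝ} (hβ : 0 < β) {f : ℝ → ℝ} (hf : MemLp f 2 vol01) :
    ∫ t, leftI β f t * rightI β f t ∂vol01 = (2 * Real.Gamma (2 * β))⁻¹ * energy (2 * β) f := by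
  have hm : ∀ z : ℝ × ℝ, ∫⁻ t, ENNReal.ofReal (kappa β (t - z.1) * kappa β (z.2 - t)) =
      ENNReal.ofReal (kappa (2 * β) (z.2 - z.1)) := by
    intro z
    rw [two_mul, ← lintegral_kappa_mul_kappa hβ hβ]
    simp_rw [mul_comm]
  have h := (integral_mul_kernel (measurable_kappa_sub β) (measurable_kappa_sub' β)
    (fun t x => kappa_nonneg hβ _) (fun t x => kappa_nonneg hβ _) (ae_of_all _ hm)
    (ae_of_all _ fun z => kappa_nonneg (by linarith : 0 < 2 * β) _) hf.1 hf.1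
    (integrable_kappa_mul_mul (by linarith : 0 < 2 * β) hf hf)).2
  rw [energy_eq_kappa (by linarith) hf, ← h]
  rw [← mul_assoc, inv_mul_cancel₀ (by positivity), one_mul]
  -- The left integral vanishes for t ≤ 0 and the right one for t ≥ 1, so the product lives on (0,1)
  -- and the kernel identity on the whole line applies.
  refine setIntegral_eq_integral_of_forall_compl_eq_zero fun t ht => ?_
  rcases le_or_gt t 0 with h0 | h0
  · rw [leftI_of_nonpos f h0, zero_mul]
  · rw [rightI_of_one_le f (not_lt.1 fun h1 => ht ⟨h0, h1⟩), mul_zero]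

/-- Here the integrals run over the whole line, where each potential has a tail outside (0,1); this
is what makes both squared norms exact multiples of the energy. Restriction to (0,1) then only gives
upper bounds, which is the direction needed for coercivity. -/
lemma exists_integral_leftI_sq {β : ℝ} (h0 : 0 < β) (h1 : β < 1 / 2) :
    ∃ c : ℝ, 0 < c ∧ ∀ f : ℝ → ℝ, MemLp f 2 vol01 →
      (Integrable (fun t => leftI β f t * leftI β f t) ∧
        ∫ t, leftI β f t * leftI β f t = c * energy (2 * β) f) ∧
      (Integrable (fun t => rightI β f t * rightI β f t) ∧
        ∫ t, rightI β f t * rightI β f t = c * energy (2 * β) f) := by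
  obtain ⟨c, hc, h⟩ := exists_lintegral_kappa_mul_kappa_self h0 h1
  refine ⟨c, hc, fun f hf => ?_⟩
  have hi : Integrable (fun z : ℝ × ℝ => (c * |z.1 - z.2| ^ (2 * β - 1)) * (f z.1 * f z.2))
      vol01sq := by
    simp_rw [mul_assoc]
    exact (integrable_riesz (by linarith) hf).const_mul c
  have e : c * energy (2 * β) f =
      ∫ z, (c * |z.1 - z.2| ^ (2 * β - 1)) * (f z.1 * f z.2) ∂vol01sq := by
    rw [energy, ← integral_const_mul]
    simp_rw [mul_assoc]
  have h' : ∀ x y : ℝ, x ≠ y → ∫⁻ t, ENNReal.ofReal (kappa β (x - t) * kappa β (y - t)) =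
        ENNReal.ofReal (c * |x - y| ^ (2 * β - 1)) := by
    intro x y hxy
    have e1 := h (-x) (-y) (fun h => hxy (neg_injective h))
    rw [← lintegral_neg_eq_self, show -x - -y = -(x - y) by ring, abs_neg] at e1
    rw [← e1]
    congr 1
    ext t
    congr 3 <;> ring
  rw [e]
  constructor
  · exact integral_mul_kernel (measurable_kappa_sub β) (measurable_kappa_sub β)
      (fun t x => kappa_nonneg h0 _) (fun t x => kappa_nonneg h0 _)
      (ae_prod_ne.mono fun z hz => h z.1 z.2 hz) (ae_of_all _ fun z => by positivity) hf.1 hf.1 hi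
  · exact integral_mul_kernel (measurable_kappa_sub' β) (measurable_kappa_sub' β)
      (fun t x => kappa_nonneg h0 _) (fun t x => kappa_nonneg h0 _)
      (ae_prod_ne.mono fun z hz => h' z.1 z.2 hz) (ae_of_all _ fun z => by positivity) hf.1 hf.1 hi

/-- The left and right fractional integrals are adjoint. -/
lemma integral_mul_leftI {β : ℝ} (hβ : 0 < β) {f h : ℝ → ℝ} (hf : MemLp f 2 vol01)
    (hh : MemLp h 2 vol01) :
    ∫ x, h x * leftI β f x ∂vol01 = ∫ s, f s * rightI β h s ∂vol01 := by
  have hi := integrable_kappa_mul_mul hβ hf hh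
  have e1 : ∀ x, h x * leftI β f x = ∫ s, kappa β (x - s) * (f s * h x) ∂vol01 := by
    intro x
    rw [leftI, ← integral_const_mul]
    congr 1
    ext s
    ring
  have e2 : ∀ s, f s * rightI β h s = ∫ x, kappa β (x - s) * (f s * h x) ∂vol01 := by
    intro s
    rw [rightI, ← integral_const_mul]
    congr 1
    ext x
    ring
  simp_rw [e1, e2]
  exact integral_integral_swap (f := fun x s => kappa β (x - s) * (f s * h x)) hi.swap

lemma integrable_mul_leftI {β : ℝ} (hβ : 0 < β) {f h : ℝ → ℝ} (hf : MemLp f 2 vol01)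
    (hh : MemLp h 2 vol01) : Integrable (fun x => h x * leftI β f x) vol01 := by
  have hi := (integrable_kappa_mul_mul hβ hf hh).integral_prod_right
  refine hi.congr (ae_of_all _ fun x => ?_)
  simp only [leftI]
  rw [← integral_const_mul]
  congr 1
  ext s
  ring

lemma integrable_mul_rightI {β : ℝ} (hβ : 0 < β) {f h : ℝ → ℝ} (hf : MemLp f 2 vol01)
    (hh : MemLp h 2 vol01) : Integrable (fun x => f x * rightI β h x) vol01 := by
  have hi := (integrable_kappa_mul_mul hβ hf hh).integral_prod_left
  refine hi.congr (ae_of_all _ fun x => ?_)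
  simp only [rightI]
  rw [← integral_const_mul]
  congr 1
  ext s
  ring

/-- The semigroup law `I_l^p I_l^q = I_l^1` for `p + q = 1`. -/
lemma integral_kappa_mul_leftI {p q : ℝ} (hp : 0 < p) (hq : 0 < q) (hpq : p + q = 1) {f : ℝ → ℝ}
    (hf : Integrable f vol01) (x : ℝ) :
    ∫ t, kappa p (x - t) * leftI q f t = leftI 1 f x := by
  have hmF : Integrable (fun s => kappa 1 (x - s) * f s) vol01 := by
    refine hf.norm.mono' ((by fun_prop : Measurable fun s => kappa 1 (x - s)).aestronglyMeasurable.mul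
      hf.1) (ae_of_all _ fun s => ?_)
    rw [norm_mul]
    refine mul_le_of_le_one_left (norm_nonneg _) ?_
    rcases le_or_gt (x - s) 0 with h | h
    · simp [kappa_of_nonpos h]
    · simp [kappa_one_of_pos h]
  have h := integral_integral_kernel_mul (μ := volume) (ν := vol01)
    (k := fun t s => kappa p (x - t) * kappa q (t - s)) (m := fun s => kappa 1 (x - s)) (F := f)
    (by unfold Function.uncurry; fun_prop) (fun t s => mul_nonneg (kappa_nonneg hp _) (kappa_nonneg hq _))
    (ae_of_all _ fun s => by rw [← hpq]; exact lintegral_kappa_mul_kappa hp hq x s)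
    (ae_of_all _ fun s => kappa_nonneg one_pos _) hf.1 hmF
  rw [leftI, ← h]
  congr 1
  ext t
  rw [leftI, ← integral_const_mul]
  simp_rw [mul_assoc]


/-! ### The energy on the Fourier side -/

/-- The Fourier transform of the extension by zero of a function on `(0,1)`. -/
def fourier01 (f : ℝ → ℝ) (ξ : ℝ) : ℂ :=
  ∫ s, Complex.exp (((-2 * Real.pi * s * ξ : ℝ) : ℂ) * Complex.I) * (f s : ℂ) ∂vol01

lemma norm_sq_fourier01 (f : ℝ → ℝ) (ξ : ℝ) :
    ((‖fourier01 f ξ‖ ^ 2 : ℝ) : ℂ) =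
      ∫ z, Complex.exp (((-2 * Real.pi * ξ * (z.1 - z.2) : ℝ) : ℂ) * Complex.I) *
        ((f z.1 * f z.2 : ℝ) : ℂ) ∂vol01sq := by
  have e1 : ((‖fourier01 f ξ‖ ^ 2 : ℝ) : ℂ) =
      fourier01 f ξ * (starRingEnd ℂ) (fourier01 f ξ) := by
    rw [Complex.mul_conj, Complex.normSq_eq_norm_sq]
  rw [e1, fourier01, ← integral_conj, ← integral_prod_mul]
  congr 1
  ext z
  rw [map_mul, ← Complex.exp_conj, map_mul, Complex.conj_I, Complex.conj_ofReal,
    Complex.conj_ofReal, mul_mul_mul_comm, ← Complex.exp_add]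
  push_cast
  congr 2
  ring

lemma integral_gaussian_mul_exp {t : ℝ} (ht : 0 < t) (z : ℝ) :
    ∫ ξ : ℝ, Complex.exp (((-2 * Real.pi * ξ * z : ℝ) : ℂ) * Complex.I) *
      ((t ^ (-(1 / 2) : ℝ) * Real.exp (-(Real.pi * ξ ^ 2 / t)) : ℝ) : ℂ) =
      ((Real.exp (-(t * (Real.pi * z ^ 2))) : ℝ) : ℂ) := by
  have hb : 0 < ((t⁻¹ : ℝ) : ℂ).re := by simpa using ht
  have h := congrFun (fourier_gaussian_pi hb) z
  rw [Real.fourier_real_eq_integral_exp_smul] at h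
  have e : ∀ ξ : ℝ, Complex.exp (((-2 * Real.pi * ξ * z : ℝ) : ℂ) * Complex.I) *
      ((t ^ (-(1 / 2) : ℝ) * Real.exp (-(Real.pi * ξ ^ 2 / t)) : ℝ) : ℂ) =
      ((t ^ (-(1 / 2) : ℝ) : ℝ) : ℂ) * (Complex.exp (((-2 * Real.pi * ξ * z : ℝ) : ℂ) * Complex.I) •
        Complex.exp (-Real.pi * ((t⁻¹ : ℝ) : ℂ) * ξ ^ 2)) := by
    intro ξ
    push_cast
    rw [smul_eq_mul, mul_left_comm]
    congr 3
    ring_nf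
  simp_rw [e]
  rw [integral_const_mul, h, ← Complex.ofReal_ofNat 2, ← Complex.ofReal_one, ← Complex.ofReal_div,
    ← Complex.ofReal_cpow (by positivity)]
  have e2 : t ^ (-(1 / 2) : ℝ) * (1 / (t⁻¹) ^ (1 / 2 : ℝ)) = 1 := by
    rw [Real.inv_rpow ht.le, Real.rpow_neg ht.le]
    have := Real.rpow_pos_of_pos ht (1 / 2)
    field_simp
  rw [← mul_assoc, ← Complex.ofReal_div, ← Complex.ofReal_mul, e2, Complex.ofReal_one, one_mul,
    Complex.ofReal_exp]
  congr 1
  push_cast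
  have : (t : ℂ) ≠ 0 := by exact_mod_cast ht.ne'
  field_simp

lemma integrable_gaussian {t : ℝ} (ht : 0 < t) :
    Integrable fun ξ : ℝ => t ^ (-(1 / 2) : ℝ) * Real.exp (-(Real.pi * ξ ^ 2 / t)) := by
  refine ((integrable_exp_neg_mul_sq (b := Real.pi / t) (by positivity)).congr
    (ae_of_all _ fun ξ => ?_)).const_mul _
  simp only
  congr 1
  ring

/-- A Gaussian is the Fourier transform of a Gaussian; Fubini then turns the double integral of the
phase into the squared modulus of the transform. Everything converges absolutely, which would fail
for the Riesz kernel itself. -/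
lemma integral_gaussian_energy {t : ℝ} (ht : 0 < t) {f : ℝ → ℝ} (hf : Integrable f vol01) :
    ∫ z, Real.exp (-(t * (Real.pi * (z.1 - z.2) ^ 2))) * (f z.1 * f z.2) ∂vol01sq =
      ∫ ξ, t ^ (-(1 / 2) : ℝ) * Real.exp (-(Real.pi * ξ ^ 2 / t)) * ‖fourier01 f ξ‖ ^ 2 := by
  have hff : Integrable (fun z : ℝ × ℝ => ((f z.1 * f z.2 : ℝ) : ℂ)) vol01sq :=
    (hf.mul_prod hf).ofReal
  have hg : Integrable (fun ξ : ℝ =>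
      ((t ^ (-(1 / 2) : ℝ) * Real.exp (-(Real.pi * ξ ^ 2 / t)) : ℝ) : ℂ)) :=
    (integrable_gaussian ht).ofReal
  have hint : Integrable (fun p : ℝ × (ℝ × ℝ) =>
      Complex.exp (((-2 * Real.pi * p.1 * (p.2.1 - p.2.2) : ℝ) : ℂ) * Complex.I) *
      (((t ^ (-(1 / 2) : ℝ) * Real.exp (-(Real.pi * p.1 ^ 2 / t)) : ℝ) : ℂ) *
        ((f p.2.1 * f p.2.2 : ℝ) : ℂ))) (volume.prod vol01sq) := by
    refine (hg.mul_prod hff).bdd_mul (c := 1) (by fun_prop) (ae_of_all _ fun p => ?_)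
    rw [Complex.norm_exp_ofReal_mul_I]
  apply Complex.ofReal_injective
  rw [← integral_complex_ofReal, ← integral_complex_ofReal]
  have e : ∀ ξ : ℝ, ((t ^ (-(1 / 2) : ℝ) * Real.exp (-(Real.pi * ξ ^ 2 / t)) *
      ‖fourier01 f ξ‖ ^ 2 : ℝ) : ℂ) = ∫ z : ℝ × ℝ,
      Complex.exp (((-2 * Real.pi * ξ * (z.1 - z.2) : ℝ) : ℂ) * Complex.I) *
      (((t ^ (-(1 / 2) : ℝ) * Real.exp (-(Real.pi * ξ ^ 2 / t)) : ℝ) : ℂ) *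
        ((f z.1 * f z.2 : ℝ) : ℂ)) ∂vol01sq := by
    intro ξ
    rw [Complex.ofReal_mul, norm_sq_fourier01, ← integral_const_mul]
    congr 1
    ext z
    ring
  simp_rw [e]
  rw [integral_integral_swap hint]
  congr 1
  ext z
  simp only [← mul_assoc (Complex.exp _)]
  rw [integral_mul_const, integral_gaussian_mul_exp ht, Complex.ofReal_mul]

/-- The Bochner integral of a non-integrable function is 0, while the known value here is positive.
-/
lemma integrableOn_rpow_mul_exp {a r : ℝ} (ha : 0 < a) (hr : 0 < r) :
    IntegrableOn (fun t : ℝ => t ^ (a - 1) * Real.exp (-(t * r))) (Ioi 0) := by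
  by_contra h
  have h1 := Real.integral_rpow_mul_exp_neg_mul_Ioi ha hr
  simp_rw [mul_comm r] at h1
  rw [integral_undef h] at h1
  have : 0 < (1 / r) ^ a * Real.Gamma a := mul_pos (by positivity) (Real.Gamma_pos_of_pos ha)
  linarith

lemma lintegral_rpow_mul_exp {a r : ℝ} (ha : 0 < a) (hr : 0 < r) :
    ∫⁻ t in Ioi (0 : ℝ), ENNReal.ofReal (t ^ (a - 1) * Real.exp (-(t * r))) =
      ENNReal.ofReal (Real.Gamma a * r ^ (-a)) := by
  rw [← ofReal_integral_eq_lintegral_ofReal (integrableOn_rpow_mul_exp ha hr)]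
  · have h1 := Real.integral_rpow_mul_exp_neg_mul_Ioi ha hr
    simp_rw [mul_comm r] at h1
    rw [h1, one_div, Real.inv_rpow hr.le, Real.rpow_neg hr.le, mul_comm]
  · refine (ae_restrict_iff' measurableSet_Ioi).2 (ae_of_all _ fun t ht => ?_)
    have : (0 : ℝ) < t := ht
    simp only [Pi.zero_apply]
    positivity

/-- The substitution t ↦ 1/t reduces this to the Gamma integral. It performs the integration over
the Gaussian width once the frequency is fixed. -/
lemma lintegral_rpow_mul_exp_inv {a r : ℝ} (ha : 0 < a) (hr : 0 < r) :
    ∫⁻ t in Ioi (0 : ℝ), ENNReal.ofReal (t ^ (-1 - a) * Real.exp (-(r / t))) =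
      ENNReal.ofReal (Real.Gamma a * r ^ (-a)) := by
  set g : ℝ → ℝ := fun u => u ^ (a - 1) * Real.exp (-(u * r)) with hg
  have e : EqOn (fun x : ℝ => (|(-1 : ℝ)| * x ^ ((-1 : ℝ) - 1)) • g (x ^ (-1 : ℝ)))
      (fun t => t ^ (-1 - a) * Real.exp (-(r / t))) (Ioi 0) := by
    intro x hx
    have hx0 : (0 : ℝ) < x := hx
    simp only [hg, smul_eq_mul, abs_neg, abs_one, one_mul]
    rw [← Real.rpow_mul hx0.le, Real.rpow_neg_one, ← mul_assoc, ← Real.rpow_add hx0]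
    congr 2
    · ring
    · ring
  have hval := integral_comp_rpow_Ioi g (p := -1) (by norm_num)
  rw [setIntegral_congr_fun measurableSet_Ioi e] at hval
  have h1 := Real.integral_rpow_mul_exp_neg_mul_Ioi ha hr
  simp_rw [mul_comm r] at h1
  rw [h1, one_div, Real.inv_rpow hr.le, ← Real.rpow_neg hr.le, mul_comm] at hval
  have hpos : 0 < Real.Gamma a * r ^ (-a) := mul_pos (Real.Gamma_pos_of_pos ha) (by positivity)
  have hi : IntegrableOn (fun t => t ^ (-1 - a) * Real.exp (-(r / t))) (Ioi 0) := by
    by_contra h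
    rw [integral_undef h] at hval
    linarith
  rw [← ofReal_integral_eq_lintegral_ofReal hi, hval]
  refine (ae_restrict_iff' measurableSet_Ioi).2 (ae_of_all _ fun t ht => ?_)
  have : (0 : ℝ) < t := ht
  simp only [Pi.zero_apply]
  positivity

lemma continuous_fourier01 {f : ℝ → ℝ} (hf : Integrable f vol01) : Continuous (fourier01 f) := by
  refine continuous_of_dominated (bound := fun s => ‖f s‖) ?_ ?_ hf.norm ?_
  · intro ξ
    exact (by fun_prop : Continuous fun s : ℝ => Complex.exp (((-2 * Real.pi * s * ξ : ℝ) : ℂ) *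
      Complex.I)).aestronglyMeasurable.mul hf.ofReal.1
  · intro ξ
    refine ae_of_all _ fun s => ?_
    rw [norm_mul, Complex.norm_exp_ofReal_mul_I, one_mul, Complex.norm_real]
  · exact ae_of_all _ fun s => by fun_prop

lemma norm_fourier01_le {f : ℝ → ℝ} (ξ : ℝ) : ‖fourier01 f ξ‖ ≤ ∫ s, ‖f s‖ ∂vol01 := by
  refine (norm_integral_le_integral_norm _).trans (le_of_eq ?_)
  congr 1
  ext s
  rw [norm_mul, Complex.norm_exp_ofReal_mul_I, one_mul, Complex.norm_real]

/-- The energy on the Fourier side. -/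
lemma exists_energy_eq_fourier {σ : ℝ} (h0 : 0 < σ) (h1 : σ < 1) :
    ∃ C : ℝ, 0 < C ∧ ∀ f : ℝ → ℝ, MemLp f 2 vol01 →
      0 ≤ energy σ f ∧ ENNReal.ofReal (energy σ f) = ENNReal.ofReal C *
        ∫⁻ ξ, ENNReal.ofReal (|ξ| ^ (-σ) * ‖fourier01 f ξ‖ ^ 2) := by
  set s : ℝ := (1 - σ) / 2 with hs
  have hs0 : 0 < s := by rw [hs]; linarith
  set c₁ : ℝ := Real.Gamma s * Real.pi ^ (-s) with hc₁
  set c₂ : ℝ := Real.Gamma (σ / 2) * Real.pi ^ (-(σ / 2)) with hc₂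
  have hc₁0 : 0 < c₁ := mul_pos (Real.Gamma_pos_of_pos hs0) (by positivity)
  have hc₂0 : 0 < c₂ := mul_pos (Real.Gamma_pos_of_pos (by linarith)) (by positivity)
  refine ⟨c₁⁻¹ * c₂, by positivity, fun f hf => ?_⟩
  have hf1 : Integrable f vol01 := hf.integrable (by norm_num)
  -- Subordination: the Riesz kernel is a mixture over t > 0 of the Gaussians exp(-tπ|x-y|²), with s
  -- chosen so that -2s = σ - 1. The absolute value of t keeps the kernel nonnegative for all real
  -- t.
  set k : ℝ → ℝ × ℝ → ℝ := fun t z =>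
    |t| ^ (s - 1) * Real.exp (-(t * (Real.pi * (z.1 - z.2) ^ 2))) with hk
  have hkm : Measurable (Function.uncurry k) := by
    simp only [hk, Function.uncurry_def]; fun_prop
  have hk0 : ∀ t z, 0 ≤ k t z := fun t z => by positivity
  have hm : ∀ᵐ z ∂vol01sq, ∫⁻ t, ENNReal.ofReal (k t z) ∂volume.restrict (Ioi 0) =
      ENNReal.ofReal (c₁ * |z.1 - z.2| ^ (σ - 1)) := by
    filter_upwards [ae_prod_ne] with z hz
    have hz0 : z.1 - z.2 ≠ 0 := sub_ne_zero.2 hz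
    have hz1 : 0 < |z.1 - z.2| := abs_pos.2 hz0
    have hr : 0 < Real.pi * (z.1 - z.2) ^ 2 := by positivity
    rw [setLIntegral_congr_fun (g := fun t => ENNReal.ofReal
      (t ^ (s - 1) * Real.exp (-(t * (Real.pi * (z.1 - z.2) ^ 2))))) measurableSet_Ioi,
      lintegral_rpow_mul_exp hs0 hr]
    · congr 1
      rw [hc₁, Real.mul_rpow Real.pi_pos.le (sq_nonneg _), ← sq_abs, ← Real.rpow_natCast,
        ← Real.rpow_mul hz1.le, ← mul_assoc]
      congr 2
      rw [hs]; push_cast; ring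
    · intro t ht
      simp only [hk]
      rw [abs_of_pos ht]
  have hmF : Integrable (fun z : ℝ × ℝ => (c₁ * |z.1 - z.2| ^ (σ - 1)) * (f z.1 * f z.2))
      vol01sq := by
    simp_rw [mul_assoc]
    exact (integrable_riesz h0 hf).const_mul c₁
  have hF : AEStronglyMeasurable (fun z : ℝ × ℝ => f z.1 * f z.2) vol01sq :=
    hf.1.comp_fst.mul hf.1.comp_snd
  have hm0 : ∀ᵐ z : ℝ × ℝ ∂vol01sq, 0 ≤ c₁ * |z.1 - z.2| ^ (σ - 1) :=
    ae_of_all _ fun z => by positivity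
  have hint := (integrable_kernel_mul (μ := volume.restrict (Ioi (0 : ℝ))) hkm hk0 hm hm0 hF
    hmF).integral_prod_left
  have heq := integral_integral_kernel_mul (μ := volume.restrict (Ioi (0 : ℝ))) hkm hk0 hm hm0 hF hmF
  have hE : ∫ z : ℝ × ℝ, (c₁ * |z.1 - z.2| ^ (σ - 1)) * (f z.1 * f z.2) ∂vol01sq =
      c₁ * energy σ f := by
    simp_rw [mul_assoc]
    rw [integral_const_mul, energy]
  have hF01 : Continuous (fourier01 f) := continuous_fourier01 hf1
  -- For fixed t the Gaussian identity applies; the powers combine as (s-1) - 1/2 = -1 - σ/2. Each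
  -- slice is therefore nonnegative, which permits Tonelli in t and ξ.
  have hslice : ∀ t ∈ Ioi (0 : ℝ), ∫ z : ℝ × ℝ, k t z * (f z.1 * f z.2) ∂vol01sq =
      ∫ ξ, t ^ (-1 - σ / 2) * Real.exp (-(Real.pi * ξ ^ 2 / t)) * ‖fourier01 f ξ‖ ^ 2 := by
    intro t ht
    have ht0 : (0 : ℝ) < t := ht
    simp only [hk, abs_of_pos ht0, mul_assoc]
    rw [integral_const_mul]
    have := integral_gaussian_energy ht0 hf1
    rw [this, ← integral_const_mul]
    congr 1
    ext ξ
    rw [← mul_assoc, ← mul_assoc, ← Real.rpow_add ht0, ← mul_assoc]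
    congr 3
    rw [hs]; ring
  have hslice0 : ∀ t ∈ Ioi (0 : ℝ), 0 ≤ ∫ z : ℝ × ℝ, k t z * (f z.1 * f z.2) ∂vol01sq := by
    intro t ht
    have ht0 : (0 : ℝ) < t := ht
    rw [hslice t ht]
    exact integral_nonneg fun ξ => by positivity
  have hae0 : 0 ≤ᵐ[volume.restrict (Ioi (0 : ℝ))]
      fun t => ∫ z : ℝ × ℝ, k t z * (f z.1 * f z.2) ∂vol01sq :=
    (ae_restrict_iff' measurableSet_Ioi).2 (ae_of_all _ hslice0)
  have hcE : 0 ≤ c₁ * energy σ f := by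
    rw [← hE, ← heq]
    exact integral_nonneg_of_ae hae0
  have hslice' : ∀ t ∈ Ioi (0 : ℝ), ENNReal.ofReal (∫ z : ℝ × ℝ, k t z * (f z.1 * f z.2) ∂vol01sq) =
      ∫⁻ ξ, ENNReal.ofReal (t ^ (-1 - σ / 2) * Real.exp (-(Real.pi * ξ ^ 2 / t))) *
        ENNReal.ofReal (‖fourier01 f ξ‖ ^ 2) := by
    intro t ht
    have ht0 : (0 : ℝ) < t := ht
    rw [hslice t ht, ofReal_integral_eq_lintegral_ofReal]
    · congr 1
      ext ξ
      rw [ENNReal.ofReal_mul (by positivity)]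
    · have hg : Integrable fun ξ : ℝ => t ^ (-1 - σ / 2) * Real.exp (-(Real.pi * ξ ^ 2 / t)) := by
        refine ((integrable_exp_neg_mul_sq (b := Real.pi / t) (by positivity)).congr
          (ae_of_all _ fun ξ => ?_)).const_mul _
        simp only
        congr 1
        ring
      refine hg.mul_bdd (c := (∫ s, ‖f s‖ ∂vol01) ^ 2) (by fun_prop) (ae_of_all _ fun ξ => ?_)
      rw [norm_pow, norm_norm]
      gcongr
      exact norm_fourier01_le ξ
    · exact ae_of_all _ fun ξ => by
        simp only [Pi.zero_apply]
        positivity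
  have hmain : ENNReal.ofReal (c₁ * energy σ f) = ENNReal.ofReal c₂ *
        ∫⁻ ξ, ENNReal.ofReal (|ξ| ^ (-σ) * ‖fourier01 f ξ‖ ^ 2) := by
    rw [← hE, ← heq, ofReal_integral_eq_lintegral_ofReal hint hae0,
      setLIntegral_congr_fun measurableSet_Ioi hslice', lintegral_lintegral_swap,
      ← lintegral_const_mul _ (by fun_prop)]
    · refine lintegral_congr_ae ?_
      have hne : ∀ᵐ ξ : ℝ, ξ ≠ 0 := Measure.ae_ne _ 0
      filter_upwards [hne] with ξ hξ
      have hξ1 : 0 < |ξ| := abs_pos.2 hξ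
      have hξ2 : 0 < Real.pi * ξ ^ 2 := by positivity
      rw [lintegral_mul_const _ (by fun_prop), lintegral_rpow_mul_exp_inv (by linarith) hξ2,
        ENNReal.ofReal_mul (p := |ξ| ^ (-σ)) (by positivity), ← mul_assoc,
        ← ENNReal.ofReal_mul hc₂0.le]
      congr 2
      rw [hc₂, Real.mul_rpow Real.pi_pos.le (sq_nonneg _), ← sq_abs, ← Real.rpow_natCast,
        ← Real.rpow_mul hξ1.le, ← mul_assoc]
      congr 2
      push_cast; ring
    · refine Measurable.aemeasurable ?_
      unfold Function.uncurry
      fun_prop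
  refine ⟨nonneg_of_mul_nonneg_right hcE hc₁0, ?_⟩
  rw [ENNReal.ofReal_mul (by positivity), mul_assoc, ← hmain, ← ENNReal.ofReal_mul (by positivity),
    ← mul_assoc, inv_mul_cancel₀ hc₁0.ne', one_mul]


/-! ### Semigroup laws and primitives on (0,1) -/

lemma integral_kappa_mul_rightI {p q : ℝ} (hp : 0 < p) (hq : 0 < q) (hpq : p + q = 1) {f : ℝ → ℝ}
    (hf : Integrable f vol01) (x : ℝ) :
    ∫ t, kappa p (t - x) * rightI q f t = rightI 1 f x := by
  have hmF : Integrable (fun s => kappa 1 (s - x) * f s) vol01 := by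
    refine hf.norm.mono' ((by fun_prop : Measurable fun s => kappa 1 (s - x)).aestronglyMeasurable.mul
      hf.1) (ae_of_all _ fun s => ?_)
    rw [norm_mul]
    refine mul_le_of_le_one_left (norm_nonneg _) ?_
    rcases le_or_gt (s - x) 0 with h | h
    · simp [kappa_of_nonpos h]
    · simp [kappa_one_of_pos h]
  have h := integral_integral_kernel_mul (μ := volume) (ν := vol01)
    (k := fun t s => kappa p (t - x) * kappa q (s - t)) (m := fun s => kappa 1 (s - x)) (F := f)
    (by unfold Function.uncurry; fun_prop) (fun t s => mul_nonneg (kappa_nonneg hp _) (kappa_nonneg hq _))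
    (ae_of_all _ fun s => by
      rw [← hpq, add_comm, ← lintegral_kappa_mul_kappa hq hp s x]
      simp_rw [mul_comm])
    (ae_of_all _ fun s => kappa_nonneg one_pos _) hf.1 hmF
  rw [rightI, ← h]
  congr 1
  ext t
  rw [rightI, ← integral_const_mul]
  simp_rw [mul_assoc]

/-- Cutting the outer integral down to (0,1) loses nothing when x ≤ 1: the inner integral vanishes
for t ≤ 0 and the outer kernel for t ≥ 1. -/
lemma leftI_leftI {p q : ℝ} (hp : 0 < p) (hq : 0 < q) (hpq : p + q = 1) {f : ℝ → ℝ}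
    (hf : Integrable f vol01) {x : ℝ} (hx : x ≤ 1) : leftI p (leftI q f) x = leftI 1 f x := by
  rw [← integral_kappa_mul_leftI hp hq hpq hf x, leftI]
  refine setIntegral_eq_integral_of_forall_compl_eq_zero fun t ht => ?_
  rcases le_or_gt t 0 with h | h
  · rw [leftI_of_nonpos f h, mul_zero]
  · rw [kappa_of_nonpos, zero_mul]
    have : 1 ≤ t := not_lt.1 fun h1 => ht ⟨h, h1⟩
    linarith

lemma rightI_rightI {p q : ℝ} (hp : 0 < p) (hq : 0 < q) (hpq : p + q = 1) {f : ℝ → ℝ}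
    (hf : Integrable f vol01) {x : ℝ} (hx : 0 ≤ x) : rightI p (rightI q f) x = rightI 1 f x := by
  rw [← integral_kappa_mul_rightI hp hq hpq hf x, rightI]
  refine setIntegral_eq_integral_of_forall_compl_eq_zero fun t ht => ?_
  rcases le_or_gt 1 t with h | h
  · rw [rightI_of_one_le f h, mul_zero]
  · rw [kappa_of_nonpos, zero_mul]
    have : t ≤ 0 := not_lt.1 fun h1 => ht ⟨h1, h⟩
    linarith

lemma leftI_congr {σ : ℝ} {f g : ℝ → ℝ} (h : f =ᵐ[vol01] g) : leftI σ f = leftI σ g := by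
  ext x
  exact integral_congr_ae (h.mono fun s hs => by simp only [hs])

lemma rightI_congr {σ : ℝ} {f g : ℝ → ℝ} (h : f =ᵐ[vol01] g) : rightI σ f = rightI σ g := by
  ext x
  exact integral_congr_ae (h.mono fun s hs => by simp only [hs])

lemma leftI_one {f : ℝ → ℝ} {x : ℝ} (hx : x ∈ Icc (0 : ℝ) 1) : leftI 1 f x = ∫ s in 0..x, f s := by
  rw [← leftInt_eq_leftI 1 f hx, leftInt]
  simp

lemma rightI_one {f : ℝ → ℝ} {x : ℝ} (hx : x ∈ Icc (0 : ℝ) 1) :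
    rightI 1 f x = ∫ s in x..1, f s := by
  rw [← rightInt_eq_rightI 1 f hx, rightInt]
  simp

lemma leftI_one_one (f : ℝ → ℝ) : leftI 1 f 1 = ∫ s, f s ∂vol01 := by
  refine setIntegral_congr_fun measurableSet_Ioo fun s hs => ?_
  rw [kappa_one_of_pos (by linarith [hs.2]), one_mul]

lemma rightI_one_zero (f : ℝ → ℝ) : rightI 1 f 0 = ∫ s, f s ∂vol01 := by
  refine setIntegral_congr_fun measurableSet_Ioo fun s hs => ?_
  rw [kappa_one_of_pos (by linarith [hs.1]), one_mul]

lemma intervalIntegrable_of_vol01 {f : ℝ → ℝ} (hf : Integrable f vol01) {x y : ℝ}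
    (hx : x ∈ Icc (0 : ℝ) 1) (hy : y ∈ Icc (0 : ℝ) 1) : IntervalIntegrable f volume x y := by
  have h : IntegrableOn f (Icc 0 1) := (integrableOn_Icc_iff_integrableOn_Ioo (by simp) (by simp)).2 hf
  refine (h.mono_set ?_).intervalIntegrable
  rw [← uIcc_of_le (zero_le_one' ℝ)] at hx hy ⊢
  exact uIcc_subset_uIcc hx hy

lemma leftI_one_add_rightI_one {f : ℝ → ℝ} (hf : Integrable f vol01) {x : ℝ}
    (hx : x ∈ Icc (0 : ℝ) 1) : leftI 1 f x + rightI 1 f x = ∫ s, f s ∂vol01 := by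
  have h0 : (0 : ℝ) ∈ Icc (0 : ℝ) 1 := ⟨le_rfl, zero_le_one⟩
  have h1 : (1 : ℝ) ∈ Icc (0 : ℝ) 1 := ⟨zero_le_one, le_rfl⟩
  rw [leftI_one hx, rightI_one hx, intervalIntegral.integral_add_adjacent_intervals
    (intervalIntegrable_of_vol01 hf h0 hx) (intervalIntegrable_of_vol01 hf hx h1),
    ← leftI_one_one, leftI_one h1]

lemma aestronglyMeasurable_leftI (σ : ℝ) {f : ℝ → ℝ} (hf : AEStronglyMeasurable f vol01) :
    AEStronglyMeasurable (leftI σ f) := by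
  have h : AEStronglyMeasurable (fun p : ℝ × ℝ => kappa σ (p.1 - p.2) * f p.2)
      (volume.prod vol01) :=
    (by fun_prop : Measurable fun p : ℝ × ℝ => kappa σ (p.1 - p.2)).aestronglyMeasurable.mul
      hf.comp_snd
  exact h.integral_prod_right'

lemma aestronglyMeasurable_rightI (σ : ℝ) {f : ℝ → ℝ} (hf : AEStronglyMeasurable f vol01) :
    AEStronglyMeasurable (rightI σ f) := by
  have h : AEStronglyMeasurable (fun p : ℝ × ℝ => kappa σ (p.2 - p.1) * f p.2)
      (volume.prod vol01) :=
    (by fun_prop : Measurable fun p : ℝ × ℝ => kappa σ (p.2 - p.1)).aestronglyMeasurable.mul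
      hf.comp_snd
  exact h.integral_prod_right'

lemma memLp_leftI {β : ℝ} (h0 : 0 < β) (h1 : β < 1 / 2) {f : ℝ → ℝ} (hf : MemLp f 2 vol01) :
    MemLp (leftI β f) 2 vol01 := by
  obtain ⟨c, -, h⟩ := exists_integral_leftI_sq h0 h1
  rw [memLp_two_iff_integrable_sq (aestronglyMeasurable_leftI β hf.1).restrict]
  simp_rw [pow_two]
  exact (h f hf).1.1.integrableOn

lemma memLp_rightI {β : ℝ} (h0 : 0 < β) (h1 : β < 1 / 2) {f : ℝ → ℝ} (hf : MemLp f 2 vol01) :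
    MemLp (rightI β f) 2 vol01 := by
  obtain ⟨c, -, h⟩ := exists_integral_leftI_sq h0 h1
  rw [memLp_two_iff_integrable_sq (aestronglyMeasurable_rightI β hf.1).restrict]
  simp_rw [pow_two]
  exact (h f hf).2.1.integrableOn

/-! ### Orders above 1/2: pointwise values and bounded operators -/

lemma inner_eq_integral (u v : L2) : inner ℝ u v = ∫ x, u x * v x ∂vol01 := by
  rw [L2.inner_def]
  congr 1
  ext x
  simp [mul_comm]

lemma inner_eq_integral_of_ae {u v : L2} {f g : ℝ → ℝ} (hu : u =ᵐ[vol01] f) (hv : v =ᵐ[vol01] g) :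
    inner ℝ u v = ∫ x, f x * g x ∂vol01 := by
  rw [inner_eq_integral]
  refine integral_congr_ae ?_
  filter_upwards [hu, hv] with x h1 h2
  rw [h1, h2]

lemma integrable_coe (u : L2) : Integrable u vol01 := (Lp.memLp u).integrable (by norm_num)

lemma kappa_sq {σ : ℝ} (hσ : 1 / 2 < σ) (z : ℝ) :
    kappa σ z ^ 2 = Real.Gamma (2 * σ - 1) / Real.Gamma σ ^ 2 * kappa (2 * σ - 1) z := by
  rcases le_or_gt z 0 with h | h
  · simp [kappa_of_nonpos h]
  · have h1 := Real.Gamma_pos_of_pos (by linarith : 0 < σ)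
    have h2 := Real.Gamma_pos_of_pos (by linarith : 0 < 2 * σ - 1)
    rw [kappa_of_pos h, kappa_of_pos h, show 2 * σ - 1 - 1 = (σ - 1) + (σ - 1) by ring,
      Real.rpow_add h]
    generalize Real.Gamma (2 * σ - 1) = g at h2 ⊢
    field_simp

lemma memLp_kappa_sub_left {σ : ℝ} (hσ : 1 / 2 < σ) (x : ℝ) :
    MemLp (fun s => kappa σ (x - s)) 2 vol01 := by
  rw [memLp_two_iff_integrable_sq (by fun_prop : Measurable fun s => kappa σ (x - s)).aestronglyMeasurable]
  simp_rw [kappa_sq hσ]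
  exact (integrable_kappa_sub_left (by linarith) x).const_mul _

lemma memLp_kappa_sub_right {σ : ℝ} (hσ : 1 / 2 < σ) (x : ℝ) :
    MemLp (fun s => kappa σ (s - x)) 2 vol01 := by
  rw [memLp_two_iff_integrable_sq (by fun_prop : Measurable fun s => kappa σ (s - x)).aestronglyMeasurable]
  simp_rw [kappa_sq hσ]
  exact (integrable_kappa_sub_right (by linarith) x).const_mul _

lemma leftI_eq_inner {σ : ℝ} (hσ : 1 / 2 < σ) (u : L2) (x : ℝ) :
    leftI σ u x = inner ℝ ((memLp_kappa_sub_left hσ x).toLp _) u := by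
  rw [inner_eq_integral_of_ae (MemLp.coeFn_toLp _) (ae_eq_refl u), leftI]

lemma rightI_eq_inner {σ : ℝ} (hσ : 1 / 2 < σ) (u : L2) (x : ℝ) :
    rightI σ u x = inner ℝ ((memLp_kappa_sub_right hσ x).toLp _) u := by
  rw [inner_eq_integral_of_ae (MemLp.coeFn_toLp _) (ae_eq_refl u), rightI]

/-- For σ > 1/2 the squared kernel is a multiple of the kernel of order 2σ-1 > 0, whose integral is
bounded uniformly in x; Cauchy-Schwarz does the rest. It is applied with σ = 1-β and σ = 1, and
makes endpoint values continuous functionals on L². -/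
lemma exists_abs_leftI_le {σ : ℝ} (hσ : 1 / 2 < σ) :
    ∃ C : ℝ, 0 ≤ C ∧ ∀ (u : L2) (x : ℝ), x ∈ Icc (0 : ℝ) 1 →
      |leftI σ u x| ≤ C * ‖u‖ ∧ |rightI σ u x| ≤ C * ‖u‖ := by
  have hs : 0 < 2 * σ - 1 := by linarith
  have hG : 0 < Real.Gamma (2 * σ - 1) / Real.Gamma σ ^ 2 :=
    div_pos (Real.Gamma_pos_of_pos hs) (pow_pos (Real.Gamma_pos_of_pos (by linarith)) 2)
  set M : ℝ := Real.Gamma (2 * σ - 1) / Real.Gamma σ ^ 2 * ∫ z in Iic 1, kappa (2 * σ - 1) z with hM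
  have hI : IntegrableOn (kappa (2 * σ - 1)) (Iic 1) := integrableOn_kappa_Iic hs 1
  have hI' := (integrable_indicator_iff measurableSet_Iic).2 hI
  have h0 : 0 ≤ (Iic (1 : ℝ)).indicator (kappa (2 * σ - 1)) := fun z =>
    indicator_nonneg (fun z _ => kappa_nonneg hs z) z
  have hL : ∀ x ∈ Icc (0 : ℝ) 1, ∫ s, kappa (2 * σ - 1) (x - s) ∂vol01 ≤
      ∫ z in Iic 1, kappa (2 * σ - 1) z := by
    intro x hx
    rw [← integral_indicator measurableSet_Iic,
      ← integral_sub_left_eq_self ((Iic (1 : ℝ)).indicator (kappa (2 * σ - 1))) volume x,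
      setIntegral_congr_fun (g := fun s => (Iic (1 : ℝ)).indicator (kappa (2 * σ - 1)) (x - s))
        measurableSet_Ioo]
    · exact setIntegral_le_integral (hI'.comp_sub_left x) (ae_of_all _ fun s => h0 (_ - _))
    · intro s hs
      simp only
      rw [indicator_of_mem]
      rw [mem_Iic]
      linarith [hs.1, hx.2]
  have hR : ∀ x ∈ Icc (0 : ℝ) 1, ∫ s, kappa (2 * σ - 1) (s - x) ∂vol01 ≤
      ∫ z in Iic 1, kappa (2 * σ - 1) z := by
    intro x hx
    rw [← integral_indicator measurableSet_Iic,
      ← integral_sub_right_eq_self ((Iic (1 : ℝ)).indicator (kappa (2 * σ - 1))) x,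
      setIntegral_congr_fun (g := fun s => (Iic (1 : ℝ)).indicator (kappa (2 * σ - 1)) (s - x))
        measurableSet_Ioo]
    · exact setIntegral_le_integral (hI'.comp_sub_right x) (ae_of_all _ fun s => h0 (_ - _))
    · intro s hs
      simp only
      rw [indicator_of_mem]
      rw [mem_Iic]
      linarith [hs.2, hx.1]
  refine ⟨√M, Real.sqrt_nonneg _, fun u x hx => ⟨?_, ?_⟩⟩
  · rw [leftI_eq_inner hσ]
    refine (abs_real_inner_le_norm _ _).trans (mul_le_mul_of_nonneg_right ?_ (norm_nonneg _))
    apply Real.le_sqrt_of_sq_le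
    rw [← real_inner_self_eq_norm_sq,
      inner_eq_integral_of_ae (MemLp.coeFn_toLp _) (MemLp.coeFn_toLp _)]
    simp_rw [← pow_two, kappa_sq hσ]
    rw [integral_const_mul]
    exact mul_le_mul_of_nonneg_left (hL x hx) hG.le
  · rw [rightI_eq_inner hσ]
    refine (abs_real_inner_le_norm _ _).trans (mul_le_mul_of_nonneg_right ?_ (norm_nonneg _))
    apply Real.le_sqrt_of_sq_le
    rw [← real_inner_self_eq_norm_sq,
      inner_eq_integral_of_ae (MemLp.coeFn_toLp _) (MemLp.coeFn_toLp _)]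
    simp_rw [← pow_two, kappa_sq hσ]
    rw [integral_const_mul]
    exact mul_le_mul_of_nonneg_left (hR x hx) hG.le

lemma memLp_of_bound {f : ℝ → ℝ} (hf : AEStronglyMeasurable f vol01) {C : ℝ}
    (h : ∀ x ∈ Ioo (0 : ℝ) 1, |f x| ≤ C) : MemLp f 2 vol01 :=
  MemLp.of_bound hf C ((ae_restrict_iff' measurableSet_Ioo).2 (ae_of_all _ h))

lemma norm_le_of_bound {u : L2} {C : ℝ} (hC : 0 ≤ C) {f : ℝ → ℝ} (hu : u =ᵐ[vol01] f)
    (h : ∀ x ∈ Ioo (0 : ℝ) 1, |f x| ≤ C) : ‖u‖ ≤ C := by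
  have h1 := Lp.norm_le_of_ae_bound (f := u) hC (by
    filter_upwards [hu, ae_restrict_mem measurableSet_Ioo] with x hx hx'
    rw [hx]
    exact h x hx')
  simpa [measureUnivNNReal] using h1

lemma memLp_leftI_of_half_lt {σ : ℝ} (hσ : 1 / 2 < σ) (u : L2) : MemLp (leftI σ u) 2 vol01 := by
  obtain ⟨C, -, h⟩ := exists_abs_leftI_le hσ
  exact memLp_of_bound (aestronglyMeasurable_leftI σ (Lp.memLp u).1).restrict
    fun x hx => (h u x (Ioo_subset_Icc_self hx)).1

lemma memLp_rightI_of_half_lt {σ : ℝ} (hσ : 1 / 2 < σ) (u : L2) : MemLp (rightI σ u) 2 vol01 := by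
  obtain ⟨C, -, h⟩ := exists_abs_leftI_le hσ
  exact memLp_of_bound (aestronglyMeasurable_rightI σ (Lp.memLp u).1).restrict
    fun x hx => (h u x (Ioo_subset_Icc_self hx)).2

lemma leftI_add {σ : ℝ} (hσ : 1 / 2 < σ) (u v : L2) (x : ℝ) :
    leftI σ (u + v : L2) x = leftI σ u x + leftI σ v x := by
  simp only [leftI_eq_inner hσ, inner_add_right]

lemma leftI_smul {σ : ℝ} (hσ : 1 / 2 < σ) (c : ℝ) (u : L2) (x : ℝ) :
    leftI σ (c • u : L2) x = c * leftI σ u x := by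
  simp only [leftI_eq_inner hσ, inner_smul_right]

lemma rightI_add {σ : ℝ} (hσ : 1 / 2 < σ) (u v : L2) (x : ℝ) :
    rightI σ (u + v : L2) x = rightI σ u x + rightI σ v x := by
  simp only [rightI_eq_inner hσ, inner_add_right]

lemma rightI_smul {σ : ℝ} (hσ : 1 / 2 < σ) (c : ℝ) (u : L2) (x : ℝ) :
    rightI σ (c • u : L2) x = c * rightI σ u x := by
  simp only [rightI_eq_inner hσ, inner_smul_right]

lemma exists_leftOp {σ : ℝ} (hσ : 1 / 2 < σ) :
    ∃ A : L2 →L[ℝ] L2, ∀ u : L2, A u =ᵐ[vol01] leftI σ u := by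
  obtain ⟨C, hC, h⟩ := exists_abs_leftI_le hσ
  refine ⟨LinearMap.mkContinuous
    { toFun := fun u => (memLp_leftI_of_half_lt hσ u).toLp _
      map_add' := fun u v => ?_
      map_smul' := fun c u => ?_ } C fun u => ?_,
    fun u => (memLp_leftI_of_half_lt hσ u).coeFn_toLp⟩
  · rw [← MemLp.toLp_add]
    congr 1
    ext x
    exact leftI_add hσ u v x
  · rw [RingHom.id_apply, ← MemLp.toLp_const_smul]
    congr 1
    ext x
    exact leftI_smul hσ c u x
  · exact norm_le_of_bound (mul_nonneg hC (norm_nonneg _)) (memLp_leftI_of_half_lt hσ u).coeFn_toLp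
      fun x hx => (h u x (Ioo_subset_Icc_self hx)).1

lemma exists_rightOp {σ : ℝ} (hσ : 1 / 2 < σ) :
    ∃ A : L2 →L[ℝ] L2, ∀ u : L2, A u =ᵐ[vol01] rightI σ u := by
  obtain ⟨C, hC, h⟩ := exists_abs_leftI_le hσ
  refine ⟨LinearMap.mkContinuous
    { toFun := fun u => (memLp_rightI_of_half_lt hσ u).toLp _
      map_add' := fun u v => ?_
      map_smul' := fun c u => ?_ } C fun u => ?_,
    fun u => (memLp_rightI_of_half_lt hσ u).coeFn_toLp⟩
  · rw [← MemLp.toLp_add]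
    congr 1
    ext x
    exact rightI_add hσ u v x
  · rw [RingHom.id_apply, ← MemLp.toLp_const_smul]
    congr 1
    ext x
    exact rightI_smul hσ c u x
  · exact norm_le_of_bound (mul_nonneg hC (norm_nonneg _)) (memLp_rightI_of_half_lt hσ u).coeFn_toLp
      fun x hx => (h u x (Ioo_subset_Icc_self hx)).2

/-- The set is the graph of a bounded operator. Closedness lets identities checked on test functions
pass to limits. -/
lemma isClosed_leftI {σ : ℝ} (hσ : 1 / 2 < σ) :
    IsClosed {p : L2 × L2 | p.1 =ᵐ[vol01] leftI σ p.2} := by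
  obtain ⟨A, hA⟩ := exists_leftOp hσ
  have : {p : L2 × L2 | p.1 =ᵐ[vol01] leftI σ p.2} = {p | p.1 = A p.2} := by
    ext p
    simp only [mem_ofPred_eq]
    rw [Lp.ext_iff]
    exact ⟨fun h => h.trans (hA p.2).symm, fun h => h.trans (hA p.2)⟩
  rw [this]
  exact isClosed_eq continuous_fst (A.continuous.comp continuous_snd)

lemma isClosed_rightI {σ : ℝ} (hσ : 1 / 2 < σ) :
    IsClosed {p : L2 × L2 | p.1 =ᵐ[vol01] fun x => -rightI σ p.2 x} := by
  obtain ⟨A, hA⟩ := exists_rightOp hσ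
  have : {p : L2 × L2 | p.1 =ᵐ[vol01] fun x => -rightI σ p.2 x} = {p | p.1 = -A p.2} := by
    ext p
    simp only [mem_ofPred_eq]
    have hA' : (-A p.2 : L2) =ᵐ[vol01] fun x => -rightI σ p.2 x := by
      filter_upwards [Lp.coeFn_neg (A p.2), hA p.2] with x h1 h2
      rw [h1, Pi.neg_apply, h2]
    rw [Lp.ext_iff]
    exact ⟨fun h => h.trans hA'.symm, fun h => h.trans hA'⟩
  rw [this]
  exact isClosed_eq continuous_fst (A.continuous.comp continuous_snd).neg

lemma isClosed_leftI_eq_zero {σ : ℝ} (hσ : 1 / 2 < σ) (x : ℝ) :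
    IsClosed {u : L2 | leftI σ u x = 0} := by
  simp_rw [leftI_eq_inner hσ]
  exact isClosed_eq (by fun_prop) continuous_const


/-! ### Test functions -/

lemma IsTest.eq_zero {ψ : ℝ → ℝ} (h : IsTest ψ) {x : ℝ} (hx : x ∉ Ioo (0 : ℝ) 1) : ψ x = 0 :=
  image_eq_zero_of_notMem_tsupport fun hx' => hx (h.2.2 hx')

lemma IsTest.exists_Icc {ψ : ℝ → ℝ} (h : IsTest ψ) :
    ∃ a b : ℝ, 0 < a ∧ b < 1 ∧ ∀ x ∉ Icc a b, ψ x = 0 := by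
  rcases (tsupport ψ).eq_empty_or_nonempty with he | hne
  · exact ⟨1 / 2, 1 / 2, by norm_num, by norm_num, fun x _ =>
      image_eq_zero_of_notMem_tsupport (by simp [he])⟩
  · obtain ⟨a, ha⟩ := IsCompact.exists_isLeast h.2.1 hne
    obtain ⟨b, hb⟩ := IsCompact.exists_isGreatest h.2.1 hne
    exact ⟨a, b, (h.2.2 ha.1).1, (h.2.2 hb.1).2, fun x hx =>
      image_eq_zero_of_notMem_tsupport fun hx' => hx ⟨ha.2 hx', hb.2 hx'⟩⟩

lemma isTest_of_Icc {ψ : ℝ → ℝ} (h : ContDiff ℝ ∞ ψ) {a b : ℝ} (ha : 0 < a) (hb : b < 1)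
    (h0 : ∀ x ∉ Icc a b, ψ x = 0) : IsTest ψ := by
  have hs : tsupport ψ ⊆ Icc a b := by
    refine closure_minimal (fun x hx => ?_) isClosed_Icc
    by_contra hx'
    exact hx (h0 x hx')
  exact ⟨h, HasCompactSupport.of_support_subset_isCompact isCompact_Icc
    ((subset_tsupport ψ).trans hs), hs.trans fun x hx => ⟨ha.trans_le hx.1, hx.2.trans_lt hb⟩⟩

lemma IsTest.zero : IsTest fun _ => 0 :=
  isTest_of_Icc contDiff_const (a := 1 / 2) (b := 1 / 2) (by norm_num) (by norm_num) fun _ _ => rfl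

lemma IsTest.add {ψ χ : ℝ → ℝ} (h : IsTest ψ) (h' : IsTest χ) : IsTest (ψ + χ) := by
  obtain ⟨a, b, ha, hb, h0⟩ := h.exists_Icc
  obtain ⟨a', b', ha', hb', h0'⟩ := h'.exists_Icc
  refine isTest_of_Icc (h.1.add h'.1) (lt_min ha ha') (max_lt hb hb') fun x hx => ?_
  rw [Pi.add_apply, h0 x fun hx' => hx ⟨min_le_of_left_le hx'.1, le_max_of_le_left hx'.2⟩,
    h0' x fun hx' => hx ⟨min_le_of_right_le hx'.1, le_max_of_le_right hx'.2⟩, add_zero]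

lemma IsTest.const_smul {ψ : ℝ → ℝ} (c : ℝ) (h : IsTest ψ) : IsTest (c • ψ) := by
  obtain ⟨a, b, ha, hb, h0⟩ := h.exists_Icc
  refine isTest_of_Icc (contDiff_const.smul h.1) ha hb fun x hx => ?_
  simp [h0 x hx]

lemma IsTest.sub {ψ χ : ℝ → ℝ} (h : IsTest ψ) (h' : IsTest χ) : IsTest (ψ - χ) := by
  have := h.add (h'.const_smul (-1))
  simpa [sub_eq_add_neg] using this

lemma IsTest.differentiable {ψ : ℝ → ℝ} (h : IsTest ψ) : Differentiable ℝ ψ :=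
  h.1.differentiable (by simp)

lemma IsTest.isTest_deriv {ψ : ℝ → ℝ} (h : IsTest ψ) : IsTest (deriv ψ) := by
  refine ⟨h.1.deriv' , h.2.1.deriv, ?_⟩
  exact (closure_mono (support_deriv_subset (f := ψ))).trans
    ((isClosed_tsupport ψ).closure_eq.subset.trans h.2.2)

lemma IsTest.continuous {ψ : ℝ → ℝ} (h : IsTest ψ) : Continuous ψ := h.1.continuous

lemma IsTest.integrable {ψ : ℝ → ℝ} (h : IsTest ψ) : Integrable ψ :=
  h.continuous.integrable_of_hasCompactSupport h.2.1

lemma IsTest.memLp {ψ : ℝ → ℝ} (h : IsTest ψ) : MemLp ψ 2 vol01 :=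
  (h.continuous.memLp_of_hasCompactSupport h.2.1).restrict _

lemma IsTest.integral_eq {ψ : ℝ → ℝ} (h : IsTest ψ) (f : ℝ → ℝ) :
    ∫ x, f x * ψ x ∂vol01 = ∫ x, f x * ψ x :=
  setIntegral_eq_integral_of_forall_compl_eq_zero fun x hx => by rw [h.eq_zero hx, mul_zero]

lemma IsTest.leftI_deriv {ψ : ℝ → ℝ} (h : IsTest ψ) {x : ℝ} (hx : x ∈ Icc (0 : ℝ) 1) :
    leftI 1 (deriv ψ) x = ψ x := by
  rw [leftI_one hx, intervalIntegral.integral_deriv_eq_sub (fun y _ => h.differentiable y)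
    (h.isTest_deriv.continuous.intervalIntegrable _ _), h.eq_zero (x := 0) (by simp), sub_zero]

lemma IsTest.rightI_deriv {ψ : ℝ → ℝ} (h : IsTest ψ) {x : ℝ} (hx : x ∈ Icc (0 : ℝ) 1) :
    rightI 1 (deriv ψ) x = -ψ x := by
  rw [rightI_one hx, intervalIntegral.integral_deriv_eq_sub (fun y _ => h.differentiable y)
    (h.isTest_deriv.continuous.intervalIntegrable _ _), h.eq_zero (x := 1) (by simp), zero_sub]

lemma IsTest.integral_deriv {ψ : ℝ → ℝ} (h : IsTest ψ) : ∫ x, deriv ψ x ∂vol01 = 0 := by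
  rw [← leftI_one_one, h.leftI_deriv ⟨zero_le_one, le_rfl⟩, h.eq_zero (by simp)]

/-! ### The Sobolev norms on the Fourier side -/

lemma fourier_zeroExt (f : ℝ → ℝ) : 𝓕 (fun x => ((zeroExt f x : ℝ) : ℂ)) = fourier01 f := by
  ext y
  rw [Real.fourier_real_eq_integral_exp_smul, fourier01, ← integral_indicator measurableSet_Ioo]
  congr 1
  ext x
  by_cases hx : x ∈ Ioo (0 : ℝ) 1
  · simp [zeroExt, hx]
  · simp [zeroExt, hx]

lemma IsTest.zeroExt_eq {ψ : ℝ → ℝ} (h : IsTest ψ) : zeroExt ψ = ψ := by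
  ext x
  by_cases hx : x ∈ Ioo (0 : ℝ) 1
  · simp [zeroExt, hx]
  · simp [zeroExt, hx, h.eq_zero hx]

/-- The homogeneous part of the Sobolev norm. -/
def seminormS (μ : ℝ) (f : ℝ → ℝ) : ℝ≥0∞ :=
  eLpNorm (fun y : ℝ => ((|y| ^ μ : ℝ) : ℂ) * fourier01 f y) 2 volume

lemma sobolevNorm_zeroExt (μ : ℝ) (f : ℝ → ℝ) :
    sobolevNorm μ (fun x => ((zeroExt f x : ℝ) : ℂ)) =
      (eLpNorm f 2 vol01 ^ 2 + seminormS μ f ^ 2) ^ (1 / 2 : ℝ) := by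
  have : eLpNorm (fun x => ((zeroExt f x : ℝ) : ℂ)) 2 volume = eLpNorm f 2 vol01 := by
    rw [← eLpNorm_indicator_eq_eLpNorm_restrict measurableSet_Ioo]
    exact eLpNorm_congr_norm_ae (ae_of_all _ fun x => by simp [zeroExt])
  rw [sobolevNorm, fourier_zeroExt, this, seminormS]

lemma mem_H0_iff {μ : ℝ} {w : L2} : w ∈ H0 μ ↔ ∀ ε : ℝ≥0∞, 0 < ε → ∃ ψ : ℝ → ℝ, IsTest ψ ∧
    eLpNorm (fun x => w x - ψ x) 2 vol01 < ε ∧ seminormS μ (fun x => w x - ψ x) < ε := by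
  have key : ∀ ψ : ℝ → ℝ, IsTest ψ → sobolevNorm μ (fun x => ((zeroExt w x - ψ x : ℝ) : ℂ)) =
      (eLpNorm (fun x => w x - ψ x) 2 vol01 ^ 2 + seminormS μ (fun x => w x - ψ x) ^ 2)
        ^ (1 / 2 : ℝ) := by
    intro ψ hψ
    rw [← sobolevNorm_zeroExt]
    congr 1
    ext x
    by_cases hx : x ∈ Ioo (0 : ℝ) 1
    · simp [zeroExt, hx]
    · simp [zeroExt, hx, hψ.eq_zero hx]
  have hsq : ∀ a : ℝ≥0∞, (a ^ 2) ^ (1 / 2 : ℝ) = a := by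
    intro a
    rw [← ENNReal.rpow_natCast, ← ENNReal.rpow_mul]
    norm_num
  constructor
  · intro h ε hε
    obtain ⟨ψ, hψ, hlt⟩ := h ε hε
    rw [key ψ hψ] at hlt
    refine ⟨ψ, hψ, lt_of_le_of_lt ?_ hlt, lt_of_le_of_lt ?_ hlt⟩
    · nth_rewrite 1 [← hsq (eLpNorm (fun x => w x - ψ x) 2 vol01)]
      exact ENNReal.rpow_le_rpow le_self_add (by norm_num)
    · nth_rewrite 1 [← hsq (seminormS μ (fun x => w x - ψ x))]
      exact ENNReal.rpow_le_rpow le_add_self (by norm_num)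
  · intro h ε hε
    obtain ⟨ψ, hψ, h1, h2⟩ := h (ε / 2) (ENNReal.half_pos hε.ne')
    refine ⟨ψ, hψ, ?_⟩
    rw [key ψ hψ]
    calc _ ≤ ((eLpNorm (fun x => w x - ψ x) 2 vol01 + seminormS μ (fun x => w x - ψ x)) ^ 2)
          ^ (1 / 2 : ℝ) := by
          refine ENNReal.rpow_le_rpow ?_ (by norm_num)
          rw [add_sq, add_right_comm]
          exact le_self_add
      _ < ε := by
          rw [hsq]
          exact (ENNReal.add_lt_add h1 h2).trans_eq (ENNReal.add_halves ε)

lemma fourier01_sub {f g : ℝ → ℝ} (hf : Integrable f vol01) (hg : Integrable g vol01) (y : ℝ) :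
    fourier01 (fun x => f x - g x) y = fourier01 f y - fourier01 g y := by
  have hi : ∀ f : ℝ → ℝ, Integrable f vol01 → Integrable (fun s : ℝ =>
      Complex.exp (((-2 * Real.pi * s * y : ℝ) : ℂ) * Complex.I) * (f s : ℂ)) vol01 := by
    intro f hf
    refine hf.ofReal.bdd_mul (c := 1) (by fun_prop) (ae_of_all _ fun p => ?_)
    rw [Complex.norm_exp_ofReal_mul_I]
  rw [fourier01, fourier01, fourier01, ← integral_sub (hi f hf) (hi g hg)]
  congr 1
  ext s
  push_cast
  ring

lemma fourier01_congr {f g : ℝ → ℝ} (h : f =ᵐ[vol01] g) : fourier01 f = fourier01 g := by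
  ext y
  exact integral_congr_ae (h.mono fun x hx => by simp only [hx])

lemma seminormS_congr {μ : ℝ} {f g : ℝ → ℝ} (h : f =ᵐ[vol01] g) :
    seminormS μ f = seminormS μ g := by
  rw [seminormS, seminormS, fourier01_congr h]

lemma aestronglyMeasurable_weight {μ : ℝ} {f : ℝ → ℝ} (hf : Integrable f vol01) :
    AEStronglyMeasurable (fun y : ℝ => ((|y| ^ μ : ℝ) : ℂ) * fourier01 f y) volume :=
  (by fun_prop : Measurable fun y : ℝ => ((|y| ^ μ : ℝ) : ℂ)).aestronglyMeasurable.mul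
    (continuous_fourier01 hf).aestronglyMeasurable

/-- Two approximants f, g of the same h are compared without knowing that the seminorm of h is
finite; this yields Cauchy sequences. -/
lemma seminormS_sub_le {μ : ℝ} {f g h : ℝ → ℝ} (hf : Integrable f vol01) (hg : Integrable g vol01)
    (hh : Integrable h vol01) : seminormS μ (fun x => f x - g x) ≤
      seminormS μ (fun x => h x - f x) + seminormS μ (fun x => h x - g x) := by
  have e : (fun y : ℝ => ((|y| ^ μ : ℝ) : ℂ) * fourier01 (fun x => f x - g x) y) =
      (fun y : ℝ => ((|y| ^ μ : ℝ) : ℂ) * fourier01 (fun x => h x - g x) y) -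
      (fun y : ℝ => ((|y| ^ μ : ℝ) : ℂ) * fourier01 (fun x => h x - f x) y) := by
    ext y
    rw [Pi.sub_apply, fourier01_sub hf hg, fourier01_sub hh hg, fourier01_sub hh hf]
    ring
  rw [seminormS, e, add_comm]
  exact eLpNorm_sub_le (aestronglyMeasurable_weight (hh.sub hg))
    (aestronglyMeasurable_weight (hh.sub hf)) (by norm_num)

lemma IsTest.fourier01_eq {ψ : ℝ → ℝ} (h : IsTest ψ) :
    fourier01 ψ = 𝓕 (fun x => (ψ x : ℂ)) := by
  rw [← fourier_zeroExt, h.zeroExt_eq]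

lemma IsTest.fourier01_deriv {ψ : ℝ → ℝ} (h : IsTest ψ) (y : ℝ) :
    fourier01 (deriv ψ) y = 2 * Real.pi * Complex.I * y * fourier01 ψ y := by
  have hd : (fun x => ((deriv ψ x : ℝ) : ℂ)) = deriv fun x => (ψ x : ℂ) := by
    ext x
    exact ((h.differentiable x).hasDerivAt.ofReal_comp).deriv.symm
  rw [h.fourier01_eq, h.isTest_deriv.fourier01_eq, hd, Real.fourier_deriv h.integrable.ofReal]
  · simp
  · exact fun x => (h.differentiable x).hasDerivAt.ofReal_comp.differentiableAt
  · rw [← hd]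
    exact h.isTest_deriv.integrable.ofReal

lemma eLpNorm_two_sq {f : ℝ → ℂ} :
    eLpNorm f 2 volume ^ 2 = ∫⁻ x, ENNReal.ofReal (‖f x‖ ^ 2) := by
  have h := eLpNorm_nnreal_pow_eq_lintegral (f := f) (μ := (volume : Measure ℝ)) (p := 2) (by norm_num)
  simp only [NNReal.coe_ofNat, ENNReal.coe_ofNat, ENNReal.rpow_ofNat] at h
  rw [h]
  congr 1
  ext x
  rw [ENNReal.ofReal_pow (norm_nonneg _), ofReal_norm]

/-- For test functions, the energy of the derivative is a multiple of the Sobolev seminorm. -/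
lemma exists_energy_deriv_eq {β : ℝ} (h0 : 0 < β) (h1 : β < 1 / 2) :
    ∃ C : ℝ, 0 < C ∧ ∀ ψ : ℝ → ℝ, IsTest ψ → 0 ≤ energy (2 * β) (deriv ψ) ∧
      ENNReal.ofReal (energy (2 * β) (deriv ψ)) =
        ENNReal.ofReal C * seminormS (1 - β) ψ ^ 2 := by
  obtain ⟨C, hC, h⟩ := exists_energy_eq_fourier (σ := 2 * β) (by linarith) (by linarith)
  -- Differentiation multiplies the transform by 2πiy, which turns the weight |y|^(-2β) into (2π)²
  -- |y|^(2(1-β)).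
  refine ⟨C * (2 * Real.pi) ^ 2, by positivity, fun ψ hψ => ?_⟩
  obtain ⟨hE, h⟩ := h _ hψ.isTest_deriv.memLp
  refine ⟨hE, ?_⟩
  rw [h, seminormS, eLpNorm_two_sq, ENNReal.ofReal_mul hC.le, mul_assoc]
  congr 1
  rw [← lintegral_const_mul' _ _ ENNReal.ofReal_ne_top]
  refine lintegral_congr_ae ?_
  filter_upwards [Measure.ae_ne volume (0 : ℝ)] with y hy
  have hy' : 0 < |y| := abs_pos.2 hy
  rw [← ENNReal.ofReal_mul (by positivity), hψ.fourier01_deriv]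
  congr 1
  simp only [norm_mul, Complex.norm_real, Complex.norm_I, Complex.norm_ofNat, Real.norm_eq_abs,
    abs_of_pos Real.pi_pos, mul_one]
  rw [abs_of_pos (Real.rpow_pos_of_pos hy' _), mul_pow, mul_pow, mul_pow, mul_pow,
    show -(2 * β) = (1 - β) + (1 - β) - 2 by ring, Real.rpow_sub hy', Real.rpow_add hy',
    Real.rpow_two]
  field_simp

/-- Plancherel's identity for test functions. -/
lemma IsTest.eLpNorm_deriv {ψ : ℝ → ℝ} (h : IsTest ψ) :
    eLpNorm (deriv ψ) 2 vol01 = ENNReal.ofReal (2 * Real.pi) * seminormS 1 ψ := by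
  have hd := h.isTest_deriv
  have hc : HasCompactSupport fun x => ((deriv ψ x : ℝ) : ℂ) :=
    hd.2.1.comp_left (g := fun r : ℝ => (r : ℂ)) (by simp)
  have hs : ContDiff ℝ ∞ fun x => ((deriv ψ x : ℝ) : ℂ) :=
    Complex.ofRealCLM.contDiff.comp hd.1
  set f := hc.toSchwartzMap hs with hf
  have hf' : (f : ℝ → ℂ) = fun x => ((deriv ψ x : ℝ) : ℂ) := by
    ext x
    simp [hf]
  have hP := SchwartzMap.norm_fourier_toL2_eq f
  rw [SchwartzMap.norm_toLp, SchwartzMap.norm_toLp] at hP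
  have hP' : eLpNorm (𝓕 f : SchwartzMap ℝ ℂ) 2 volume = eLpNorm f 2 volume := by
    rwa [ENNReal.toReal_eq_toReal_iff' ((𝓕 f).memLp 2 volume).2.ne (f.memLp 2 volume).2.ne] at hP
  rw [SchwartzMap.fourier_coe, hf', ← hd.fourier01_eq] at hP'
  have e1 : eLpNorm (deriv ψ) 2 vol01 =
      eLpNorm (fun x => ((deriv ψ x : ℝ) : ℂ)) 2 volume := by
    rw [← eLpNorm_indicator_eq_eLpNorm_restrict measurableSet_Ioo]
    have := hd.zeroExt_eq
    rw [zeroExt] at this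
    rw [this]
    exact eLpNorm_congr_norm_ae (ae_of_all _ fun x => by simp)
  rw [e1, ← hP', seminormS]
  have e2 : fourier01 (deriv ψ) = (2 * Real.pi * Complex.I : ℂ) •
      fun y : ℝ => (y : ℂ) * fourier01 ψ y := by
    ext y
    rw [h.fourier01_deriv, Pi.smul_apply, smul_eq_mul]
    ring
  rw [e2, eLpNorm_const_smul]
  congr 1
  · rw [← ofReal_norm]
    simp [abs_of_pos Real.pi_pos]
  · refine eLpNorm_congr_norm_ae (ae_of_all _ fun y => ?_)
    simp


/-! ### The graph of the pair of fractional derivatives -/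

instance : IsProbabilityMeasure vol01 := ⟨by simp⟩

/-- `(u, a, b)` consists of the class of the test function `ψ` and of the left and right fractional
integrals of its derivative. -/
structure IsTestTriple (β : ℝ) (ψ : ℝ → ℝ) (p : L2 × L2 × L2) : Prop where
  isTest : IsTest ψ
  fst : p.1 =ᵐ[vol01] ψ
  left : p.2.1 =ᵐ[vol01] leftI β (deriv ψ)
  right : p.2.2 =ᵐ[vol01] rightI β (deriv ψ)

lemma exists_isTestTriple {β : ℝ} (h0 : 0 < β) (h1 : β < 1 / 2) {ψ : ℝ → ℝ} (hψ : IsTest ψ) :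
    ∃ p, IsTestTriple β ψ p :=
  ⟨(hψ.memLp.toLp _, (memLp_leftI h0 h1 hψ.isTest_deriv.memLp).toLp _,
    (memLp_rightI h0 h1 hψ.isTest_deriv.memLp).toLp _),
    hψ, hψ.memLp.coeFn_toLp, (memLp_leftI h0 h1 hψ.isTest_deriv.memLp).coeFn_toLp,
    (memLp_rightI h0 h1 hψ.isTest_deriv.memLp).coeFn_toLp⟩

lemma integrable_kappa_left_mul {β : ℝ} (h0 : 0 < β) {ψ : ℝ → ℝ} (hψ : IsTest ψ) (x : ℝ) :
    Integrable (fun s => kappa β (x - s) * ψ s) vol01 := by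
  obtain ⟨C, hC⟩ := hψ.2.1.exists_bound_of_continuous hψ.continuous
  exact (integrable_kappa_sub_left h0 x).mul_bdd (c := C)
    hψ.continuous.aestronglyMeasurable (ae_of_all _ hC)

lemma integrable_kappa_right_mul {β : ℝ} (h0 : 0 < β) {ψ : ℝ → ℝ} (hψ : IsTest ψ) (x : ℝ) :
    Integrable (fun s => kappa β (s - x) * ψ s) vol01 := by
  obtain ⟨C, hC⟩ := hψ.2.1.exists_bound_of_continuous hψ.continuous
  exact (integrable_kappa_sub_right h0 x).mul_bdd (c := C)
    hψ.continuous.aestronglyMeasurable (ae_of_all _ hC)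

lemma IsTest.leftI_add {β : ℝ} (h0 : 0 < β) {ψ χ : ℝ → ℝ} (hψ : IsTest ψ) (hχ : IsTest χ) :
    leftI β (ψ + χ) = leftI β ψ + leftI β χ := by
  ext x
  simp only [leftI, Pi.add_apply, mul_add]
  exact integral_add (integrable_kappa_left_mul h0 hψ x) (integrable_kappa_left_mul h0 hχ x)

lemma IsTest.rightI_add {β : ℝ} (h0 : 0 < β) {ψ χ : ℝ → ℝ} (hψ : IsTest ψ) (hχ : IsTest χ) :
    rightI β (ψ + χ) = rightI β ψ + rightI β χ := by
  ext x
  simp only [rightI, Pi.add_apply, mul_add]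
  exact integral_add (integrable_kappa_right_mul h0 hψ x) (integrable_kappa_right_mul h0 hχ x)

lemma leftI_const_smul (β c : ℝ) (f : ℝ → ℝ) : leftI β (c • f) = c • leftI β f := by
  ext x
  simp only [leftI, Pi.smul_apply, smul_eq_mul, mul_left_comm _ c]
  exact integral_const_mul _ _

lemma rightI_const_smul (β c : ℝ) (f : ℝ → ℝ) : rightI β (c • f) = c • rightI β f := by
  ext x
  simp only [rightI, Pi.smul_apply, smul_eq_mul, mul_left_comm _ c]
  exact integral_const_mul _ _

lemma IsTest.deriv_add {ψ χ : ℝ → ℝ} (hψ : IsTest ψ) (hχ : IsTest χ) :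
    deriv (ψ + χ) = deriv ψ + deriv χ := by
  ext x
  exact _root_.deriv_add (hψ.differentiable x) (hχ.differentiable x)

lemma IsTest.deriv_smul {ψ : ℝ → ℝ} (c : ℝ) (hψ : IsTest ψ) : deriv (c • ψ) = c • deriv ψ := by
  ext x
  exact _root_.deriv_const_smul c (hψ.differentiable x)

/-- The span of the triples of test functions. -/
def coreGraph (β : ℝ) (h0 : 0 < β) : Submodule ℝ (L2 × L2 × L2) where
  carrier := {p | ∃ ψ, IsTestTriple β ψ p}
  zero_mem' := by
    have hd : deriv (fun _ : ℝ => (0 : ℝ)) = (0 : ℝ) • fun _ : ℝ => (0 : ℝ) := by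
      ext x; simp
    refine ⟨fun _ => 0, IsTest.zero, Lp.coeFn_zero _ _ _, ?_, ?_⟩
    · rw [hd, leftI_const_smul, zero_smul]
      exact Lp.coeFn_zero _ _ _
    · rw [hd, rightI_const_smul, zero_smul]
      exact Lp.coeFn_zero _ _ _
  add_mem' := by
    rintro p q ⟨ψ, hψ⟩ ⟨χ, hχ⟩
    refine ⟨ψ + χ, hψ.isTest.add hχ.isTest, (Lp.coeFn_add _ _).trans (hψ.fst.add hχ.fst), ?_, ?_⟩
    · rw [IsTest.deriv_add hψ.isTest hχ.isTest,
        IsTest.leftI_add h0 hψ.isTest.isTest_deriv hχ.isTest.isTest_deriv]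
      exact (Lp.coeFn_add _ _).trans (hψ.left.add hχ.left)
    · rw [IsTest.deriv_add hψ.isTest hχ.isTest,
        IsTest.rightI_add h0 hψ.isTest.isTest_deriv hχ.isTest.isTest_deriv]
      exact (Lp.coeFn_add _ _).trans (hψ.right.add hχ.right)
  smul_mem' := by
    rintro c p ⟨ψ, hψ⟩
    refine ⟨c • ψ, hψ.isTest.const_smul c, (Lp.coeFn_smul _ _).trans (hψ.fst.const_smul c), ?_, ?_⟩
    · rw [IsTest.deriv_smul c hψ.isTest, leftI_const_smul]
      exact (Lp.coeFn_smul _ _).trans (hψ.left.const_smul c)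
    · rw [IsTest.deriv_smul c hψ.isTest, rightI_const_smul]
      exact (Lp.coeFn_smul _ _).trans (hψ.right.const_smul c)

/-- The graph of the pair of fractional derivatives on `H^{1-β}_0(0,1)`. -/
def graph (β : ℝ) (h0 : 0 < β) : Submodule ℝ (L2 × L2 × L2) := (coreGraph β h0).topologicalClosure

lemma isClosed_graph (β : ℝ) (h0 : 0 < β) : IsClosed (graph β h0 : Set (L2 × L2 × L2)) :=
  Submodule.isClosed_topologicalClosure _

/-- Induction principle for the graph: a closed condition need only be verified on test functions.
-/
lemma graph_subset {β : ℝ} {h0 : 0 < β} {S : Set (L2 × L2 × L2)} (hS : IsClosed S)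
    (h : ∀ p ψ, IsTestTriple β ψ p → p ∈ S) {p : L2 × L2 × L2} (hp : p ∈ graph β h0) : p ∈ S :=
  closure_minimal (s := (coreGraph β h0 : Set (L2 × L2 × L2)))
    (fun p hp => by obtain ⟨ψ, hψ⟩ := hp; exact h p ψ hψ) hS hp

lemma graph_fst_eq_left {β : ℝ} {h0 : 0 < β} (h1 : β < 1 / 2) {p : L2 × L2 × L2}
    (hp : p ∈ graph β h0) : p.1 =ᵐ[vol01] leftI (1 - β) p.2.1 := by
  refine graph_subset (S := {p | p.1 =ᵐ[vol01] leftI (1 - β) p.2.1})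
    ((isClosed_leftI (σ := 1 - β) (by linarith)).preimage
      (f := fun p : L2 × L2 × L2 => (p.1, p.2.1)) (by fun_prop)) (fun p ψ hψ => ?_) hp
  have hd : Integrable (deriv ψ) vol01 := hψ.isTest.isTest_deriv.integrable.restrict
  rw [mem_ofPred_eq, leftI_congr hψ.left]
  filter_upwards [hψ.fst, ae_restrict_mem measurableSet_Ioo] with x hx hx'
  rw [hx, leftI_leftI (by linarith) h0 (by ring) hd hx'.2.le,
    hψ.isTest.leftI_deriv (Ioo_subset_Icc_self hx')]

lemma graph_fst_eq_right {β : ℝ} {h0 : 0 < β} (h1 : β < 1 / 2) {p : L2 × L2 × L2}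
    (hp : p ∈ graph β h0) : p.1 =ᵐ[vol01] fun x => -rightI (1 - β) p.2.2 x := by
  refine graph_subset (S := {p | p.1 =ᵐ[vol01] fun x => -rightI (1 - β) p.2.2 x})
    ((isClosed_rightI (σ := 1 - β) (by linarith)).preimage
      (f := fun p : L2 × L2 × L2 => (p.1, p.2.2)) (by fun_prop)) (fun p ψ hψ => ?_) hp
  have hd : Integrable (deriv ψ) vol01 := hψ.isTest.isTest_deriv.integrable.restrict
  rw [mem_ofPred_eq, rightI_congr hψ.right]
  filter_upwards [hψ.fst, ae_restrict_mem measurableSet_Ioo] with x hx hx'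
  rw [hx, rightI_rightI (by linarith) h0 (by ring) hd hx'.1.le,
    hψ.isTest.rightI_deriv (Ioo_subset_Icc_self hx'), neg_neg]

/-- This is the boundary condition φ(1) = 0, meaningful because 1-β > 1/2; it is the obstruction
that keeps the two-sided derivative from being onto. -/
lemma graph_leftI_one {β : ℝ} {h0 : 0 < β} (h1 : β < 1 / 2) {p : L2 × L2 × L2}
    (hp : p ∈ graph β h0) : leftI (1 - β) p.2.1 1 = 0 := by
  refine graph_subset (S := {p | leftI (1 - β) p.2.1 1 = 0})
    ((isClosed_leftI_eq_zero (σ := 1 - β) (by linarith) 1).preimage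
      (f := fun p : L2 × L2 × L2 => p.2.1) (by fun_prop)) (fun p ψ hψ => ?_) hp
  have hd : Integrable (deriv ψ) vol01 := hψ.isTest.isTest_deriv.integrable.restrict
  rw [mem_ofPred_eq, leftI_congr hψ.left, leftI_leftI (by linarith) h0 (by ring) hd le_rfl,
    hψ.isTest.leftI_deriv ⟨zero_le_one, le_rfl⟩, hψ.isTest.eq_zero (by simp)]

/-- Since φ is the left integral of order 1-β of a, the semigroup law makes its left integral of
order β the primitive of a. It holds at every point of [0,1], endpoints included. -/
lemma graph_leftI {β : ℝ} {h0 : 0 < β} (h1 : β < 1 / 2) {p : L2 × L2 × L2}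
    (hp : p ∈ graph β h0) {x : ℝ} (hx : x ∈ Icc (0 : ℝ) 1) : leftI β p.1 x = leftI 1 p.2.1 x := by
  rw [leftI_congr (graph_fst_eq_left h1 hp),
    leftI_leftI h0 (by linarith) (by ring) (integrable_coe _) hx.2]

lemma graph_rightI {β : ℝ} {h0 : 0 < β} (h1 : β < 1 / 2) {p : L2 × L2 × L2}
    (hp : p ∈ graph β h0) {x : ℝ} (hx : x ∈ Icc (0 : ℝ) 1) :
    rightI β p.1 x = -rightI 1 p.2.2 x := by
  rw [rightI_congr (graph_fst_eq_right h1 hp),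
    ← rightI_rightI h0 (by linarith : 0 < 1 - β) (by ring) (integrable_coe p.2.2) hx.1]
  simp only [rightI, mul_neg]
  exact integral_neg _

/-- On triples of test functions, `(a, b)` is equivalent to the squares of the norms of `a`, of `b`
and of the Sobolev seminorm. -/
lemma exists_isTestTriple_estimates {β : ℝ} (h0 : 0 < β) (h1 : β < 1 / 2) :
    ∃ κ D : ℝ, 0 < κ ∧ 0 < D ∧ ∀ p ψ, IsTestTriple β ψ p →
      κ * ‖p.2.1‖ ^ 2 ≤ inner ℝ p.2.1 p.2.2 ∧ κ * ‖p.2.2‖ ^ 2 ≤ inner ℝ p.2.1 p.2.2 ∧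
      seminormS (1 - β) ψ = ENNReal.ofReal (D * √(inner ℝ p.2.1 p.2.2)) := by
  obtain ⟨c, hc, hsq⟩ := exists_integral_leftI_sq h0 h1
  obtain ⟨C, hC, hE⟩ := exists_energy_deriv_eq h0 h1
  have hG : 0 < 2 * Real.Gamma (2 * β) :=
    mul_pos two_pos (Real.Gamma_pos_of_pos (by linarith))
  set d := 2 * Real.Gamma (2 * β) with hd
  -- With E the energy of ψ': (a,b) = E/d, the squared norms of a and b are at most cE, and the
  -- squared seminorm is E/C.
  refine ⟨d⁻¹ * c⁻¹, √(d / C), by positivity, by positivity, fun p ψ hψ => ?_⟩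
  obtain ⟨hE0, hE⟩ := hE ψ hψ.isTest
  have hm := hψ.isTest.isTest_deriv.memLp
  have hab : inner ℝ p.2.1 p.2.2 = d⁻¹ * energy (2 * β) (deriv ψ) := by
    rw [inner_eq_integral_of_ae hψ.left hψ.right, integral_leftI_mul_rightI h0 hm]
  obtain ⟨⟨i1, e1⟩, i2, e2⟩ := hsq _ hm
  have ha : ‖p.2.1‖ ^ 2 ≤ c * energy (2 * β) (deriv ψ) := by
    rw [← real_inner_self_eq_norm_sq, inner_eq_integral_of_ae hψ.left hψ.left, ← e1]
    exact setIntegral_le_integral i1 (ae_of_all _ fun t => mul_self_nonneg _)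
  have hb : ‖p.2.2‖ ^ 2 ≤ c * energy (2 * β) (deriv ψ) := by
    rw [← real_inner_self_eq_norm_sq, inner_eq_integral_of_ae hψ.right hψ.right, ← e2]
    exact setIntegral_le_integral i2 (ae_of_all _ fun t => mul_self_nonneg _)
  refine ⟨?_, ?_, ?_⟩
  · rw [hab, mul_assoc]
    gcongr
    rwa [inv_mul_le_iff₀ hc]
  · rw [hab, mul_assoc]
    gcongr
    rwa [inv_mul_le_iff₀ hc]
  · have hfin : seminormS (1 - β) ψ ≠ ⊤ := by
      intro htop
      rw [htop, ENNReal.top_pow two_ne_zero, ENNReal.mul_top (by simpa using hC)] at hE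
      exact ENNReal.ofReal_ne_top hE
    rw [← ENNReal.ofReal_toReal hfin] at hE
    rw [← ENNReal.ofReal_toReal hfin]
    rw [← ENNReal.ofReal_pow ENNReal.toReal_nonneg, ← ENNReal.ofReal_mul hC.le,
      ENNReal.ofReal_eq_ofReal_iff hE0 (by positivity)] at hE
    congr 1
    rw [← Real.sqrt_mul (by positivity), hab, hE, eq_comm, Real.sqrt_eq_iff_mul_self_eq (by positivity)
      ENNReal.toReal_nonneg]
    field_simp

lemma exists_graph_coercive {β : ℝ} (h0 : 0 < β) (h1 : β < 1 / 2) :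
    ∃ κ : ℝ, 0 < κ ∧ ∀ p ∈ graph β h0,
      κ * ‖p.2.1‖ ^ 2 ≤ inner ℝ p.2.1 p.2.2 ∧ κ * ‖p.2.2‖ ^ 2 ≤ inner ℝ p.2.1 p.2.2 := by
  obtain ⟨κ, D, hκ, -, h⟩ := exists_isTestTriple_estimates h0 h1
  refine ⟨κ, hκ, fun p hp => ?_⟩
  refine graph_subset (S := {p | κ * ‖p.2.1‖ ^ 2 ≤ inner ℝ p.2.1 p.2.2 ∧
    κ * ‖p.2.2‖ ^ 2 ≤ inner ℝ p.2.1 p.2.2}) ?_ (fun p ψ hψ => ⟨(h p ψ hψ).1, (h p ψ hψ).2.1⟩) hp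
  have hi : Continuous fun p : L2 × L2 × L2 => inner ℝ p.2.1 p.2.2 := by fun_prop
  have ha : Continuous fun p : L2 × L2 × L2 => κ * ‖p.2.1‖ ^ 2 := by fun_prop
  have hb : Continuous fun p : L2 × L2 × L2 => κ * ‖p.2.2‖ ^ 2 := by fun_prop
  exact (isClosed_le ha hi).inter (isClosed_le hb hi)

/-- Every element of `H^{1-β}_0(0,1)` is the first component of an element of the graph. -/
lemma exists_mem_graph_of_mem_H0 {β : ℝ} (h0 : 0 < β) (h1 : β < 1 / 2) {φ : L2}
    (hφ : φ ∈ H0 (1 - β)) : ∃ a b : L2, (φ, a, b) ∈ graph β h0 := by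
  obtain ⟨κ, D, hκ, hD, h⟩ := exists_isTestTriple_estimates h0 h1
  rw [mem_H0_iff] at hφ
  have hε : ∀ n : ℕ, 0 < ENNReal.ofReal (1 / ((n : ℝ) + 1)) := fun n => by
    rw [ENNReal.ofReal_pos]; positivity
  choose ψ hψ hψ1 hψ2 using fun n => hφ _ (hε n)
  choose p hp using fun n => exists_isTestTriple h0 h1 (hψ n)
  have hu : ∀ n, ‖φ - (p n).1‖ ≤ 1 / ((n : ℝ) + 1) := by
    intro n
    rw [Lp.norm_def]
    refine ENNReal.toReal_le_of_le_ofReal (by positivity) (le_of_lt ?_)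
    refine lt_of_eq_of_lt (eLpNorm_congr_ae ?_) (hψ1 n)
    filter_upwards [Lp.coeFn_sub φ (p n).1, (hp n).fst] with x h1 h2
    rw [h1, Pi.sub_apply, h2]
  -- Differences of test triples are test triples, so convergence in the Sobolev seminorm controls
  -- the energies and hence makes the a and b components Cauchy.
  have hdiff : ∀ n m, IsTestTriple β (ψ n - ψ m) (p n - p m) := by
    intro n m
    have e : ψ n - ψ m = ψ n + (-1 : ℝ) • ψ m := by simp [sub_eq_add_neg]
    have hs := (hψ m).const_smul (-1)
    have hd : deriv (ψ n - ψ m) = deriv (ψ n) + (-1 : ℝ) • deriv (ψ m) := by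
      rw [e, IsTest.deriv_add (hψ n) hs, IsTest.deriv_smul _ (hψ m)]
    have hds := (hψ m).isTest_deriv.const_smul (-1)
    refine ⟨(hψ n).sub (hψ m), (Lp.coeFn_sub _ _).trans ((hp n).fst.sub (hp m).fst), ?_, ?_⟩
    · rw [hd, IsTest.leftI_add h0 (hψ n).isTest_deriv hds, leftI_const_smul, neg_one_smul,
        ← sub_eq_add_neg]
      exact (Lp.coeFn_sub _ _).trans ((hp n).left.sub (hp m).left)
    · rw [hd, IsTest.rightI_add h0 (hψ n).isTest_deriv hds, rightI_const_smul, neg_one_smul,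
        ← sub_eq_add_neg]
      exact (Lp.coeFn_sub _ _).trans ((hp n).right.sub (hp m).right)
  have hS : ∀ n m N : ℕ, N ≤ n → N ≤ m →
      D * √(inner ℝ (p n - p m).2.1 (p n - p m).2.2) ≤ 2 * (1 / ((N : ℝ) + 1)) := by
    intro n m N hn hm
    have e := (h _ _ (hdiff n m)).2.2
    have le := seminormS_sub_le (μ := 1 - β) (hψ n).integrable.restrict (hψ m).integrable.restrict
      (integrable_coe φ)
    rw [show (fun x => ψ n x - ψ m x) = ψ n - ψ m from rfl, e] at le
    have mono : ∀ k : ℕ, N ≤ k →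
        ENNReal.ofReal (1 / ((k : ℝ) + 1)) ≤ ENNReal.ofReal (1 / ((N : ℝ) + 1)) := by
      intro k hk
      exact ENNReal.ofReal_le_ofReal (Nat.one_div_le_one_div hk)
    have le2 := le.trans (add_le_add ((hψ2 n).le.trans (mono n hn)) ((hψ2 m).le.trans (mono m hm)))
    rw [← ENNReal.ofReal_add (by positivity) (by positivity),
      ENNReal.ofReal_le_ofReal_iff (by positivity)] at le2
    linarith
  have hkey : ∀ (a i R : ℝ), 0 ≤ R → κ * a ^ 2 ≤ i → D * √i ≤ R → a ≤ √(1 / κ) * (R / D) := by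
    intro a i R hR h1 h2
    have hi : √i ≤ R / D := by rwa [le_div_iff₀ hD, mul_comm]
    calc a ≤ |a| := le_abs_self a
      _ = √(a ^ 2) := (Real.sqrt_sq_eq_abs a).symm
      _ ≤ √(1 / κ * i) := by
          apply Real.sqrt_le_sqrt
          rw [one_div, inv_mul_eq_div, le_div_iff₀ hκ]
          linarith
      _ = √(1 / κ) * √i := Real.sqrt_mul (by positivity) _
      _ ≤ √(1 / κ) * (R / D) := by gcongr
  set M : ℝ := max 2 (√(1 / κ) * (2 / D)) with hM
  have hcauchy : CauchySeq p := by
    refine cauchySeq_of_le_tendsto_0 (fun N : ℕ => M * (1 / ((N : ℝ) + 1))) ?_ ?_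
    · intro n m N hn hm
      have est := h _ _ (hdiff n m)
      have hS' := hS n m N hn hm
      have e : √(1 / κ) * (2 * (1 / ((N : ℝ) + 1)) / D) =
          √(1 / κ) * (2 / D) * (1 / ((N : ℝ) + 1)) := by ring
      rw [dist_eq_norm, Prod.norm_def, Prod.norm_def]
      refine max_le ?_ (max_le ?_ ?_)
      · have t : (p n - p m).1 = (φ - (p m).1) - (φ - (p n).1) := by
          simp
        rw [t]
        have h3 := (norm_sub_le (φ - (p m).1) (φ - (p n).1)).trans (add_le_add
          ((hu m).trans (Nat.one_div_le_one_div hm)) ((hu n).trans (Nat.one_div_le_one_div hn)))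
        refine h3.trans ?_
        have : 2 * (1 / ((N : ℝ) + 1)) ≤ M * (1 / ((N : ℝ) + 1)) := by
          gcongr
          exact le_max_left _ _
        linarith
      · refine (hkey _ _ _ (by positivity) est.1 hS').trans ?_
        rw [e]
        gcongr
        exact le_max_right _ _
      · refine (hkey _ _ _ (by positivity) est.2.1 hS').trans ?_
        rw [e]
        gcongr
        exact le_max_right _ _
    · simpa using tendsto_one_div_add_atTop_nhds_zero_nat.const_mul M
  obtain ⟨q, hq⟩ := cauchySeq_tendsto_of_complete hcauchy
  have hqg : q ∈ graph β h0 := (isClosed_graph β h0).mem_of_tendsto hq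
    (Filter.Eventually.of_forall fun n => subset_closure ⟨ψ n, hp n⟩)
  have hq1 : q.1 = φ := by
    refine tendsto_nhds_unique ((continuous_fst.tendsto q).comp hq) ?_
    rw [tendsto_iff_norm_sub_tendsto_zero]
    refine squeeze_zero (fun n => norm_nonneg _) (fun n => ?_)
      tendsto_one_div_add_atTop_nhds_zero_nat
    rw [Function.comp, norm_sub_rev]
    exact hu n
  exact ⟨q.2.1, q.2.2, by rw [← hq1]; exact hqg⟩

/-- First components of elements of the graph belong to `H^{1-β}_0(0,1)`. -/
lemma mem_H0_of_mem_graph {β : ℝ} {h0 : 0 < β} (h1 : β < 1 / 2) {p : L2 × L2 × L2}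
    (hp : p ∈ graph β h0) : p.1 ∈ H0 (1 - β) := by
  obtain ⟨κ, D, hκ, hD, h⟩ := exists_isTestTriple_estimates h0 h1
  have hpc : p ∈ closure (coreGraph β h0 : Set (L2 × L2 × L2)) := hp
  rw [mem_H0_iff]
  intro ε hε
  obtain ⟨δ, hδ, hδε⟩ : ∃ δ : ℝ, 0 < δ ∧ ENNReal.ofReal δ < ε := by
    obtain ⟨r, hr0, hr⟩ := ENNReal.lt_iff_exists_nnreal_btwn.1 hε
    exact ⟨r, by exact_mod_cast hr0, by simpa using hr⟩
  -- The first bound serves the L² part, the second the seminorm, which on test triples is at most D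
  -- times the norm of the triple.
  obtain ⟨q, ⟨ψ, hψ⟩, hq⟩ := Metric.mem_closure_iff.1 hpc (min (δ / 2) (δ / (2 * D)))
    (lt_min (by positivity) (by positivity))
  obtain ⟨s, hs, hst⟩ := mem_closure_iff_seq_limit.1 hpc
  choose χ hχ using hs
  rw [dist_eq_norm] at hq
  refine ⟨ψ, hψ.isTest, lt_of_le_of_lt ?_ hδε, lt_of_le_of_lt ?_ hδε⟩
  · have e : (fun x => p.1 x - ψ x) =ᵐ[vol01] (p.1 - q.1 : L2) := by
      filter_upwards [Lp.coeFn_sub p.1 q.1, hψ.fst] with x h1 h2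
      rw [h1, Pi.sub_apply, h2]
    rw [eLpNorm_congr_ae e, ← Lp.enorm_def, ← ofReal_norm]
    refine ENNReal.ofReal_le_ofReal ?_
    have := (norm_fst_le (p - q)).trans hq.le
    have h3 := min_le_left (δ / 2) (δ / (2 * D))
    have h4 : (p - q).1 = p.1 - q.1 := rfl
    rw [h4] at this
    linarith
  · have hχint : ∀ n, Integrable (χ n) vol01 := fun n => (hχ n).isTest.integrable.restrict
    have hψint : Integrable ψ vol01 := hψ.isTest.integrable.restrict
    -- L² convergence on a probability space implies L¹ convergence, hence convergence of the
    -- transforms at every frequency.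
    have hlim : ∀ y : ℝ, Filter.Tendsto (fun n => ((|y| ^ (1 - β) : ℝ) : ℂ) *
        fourier01 (fun x => χ n x - ψ x) y) Filter.atTop
        (nhds (((|y| ^ (1 - β) : ℝ) : ℂ) * fourier01 (fun x => p.1 x - ψ x) y)) := by
      intro y
      refine Filter.Tendsto.const_mul _ ?_
      simp_rw [fourier01_sub (hχint _) hψint y, fourier01_sub (integrable_coe p.1) hψint y]
      refine Filter.Tendsto.sub_const ?_ _
      rw [tendsto_iff_norm_sub_tendsto_zero]
      have hn : Filter.Tendsto (fun n => ‖(s n).1 - p.1‖) Filter.atTop (nhds 0) :=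
        tendsto_iff_norm_sub_tendsto_zero.1 ((continuous_fst.tendsto p).comp hst)
      refine squeeze_zero (fun n => norm_nonneg _) (fun n => ?_) hn
      have e : (fun x => χ n x - p.1 x) =ᵐ[vol01] ((s n).1 - p.1 : L2) := by
        filter_upwards [Lp.coeFn_sub (s n).1 p.1, (hχ n).fst] with x h1 h2
        rw [h1, Pi.sub_apply, h2]
      rw [← fourier01_sub (hχint n) (integrable_coe p.1), fourier01_congr e]
      refine (norm_fourier01_le y).trans ?_
      have hle := eLpNorm_le_eLpNorm_of_exponent_le (p := 1) (q := 2) (by norm_num)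
        (Lp.memLp ((s n).1 - p.1 : L2)).1
      rw [integral_norm_eq_lintegral_enorm (Lp.memLp _).1, ← eLpNorm_one_eq_lintegral_enorm,
        Lp.norm_def]
      exact ENNReal.toReal_mono (Lp.memLp _).2.ne hle
    -- The seminorm is lower semicontinuous by Fatou, so it suffices to bound it for the
    -- approximating test functions.
    refine Lp.eLpNorm_le_of_ae_tendsto ?_ (fun n =>
      aestronglyMeasurable_weight ((hχint n).sub hψint)) (ae_of_all _ hlim)
    have hnear : ∀ᶠ n in Filter.atTop, ‖s n - q‖ < δ / D := by
      have t : Filter.Tendsto (fun n => ‖s n - q‖) Filter.atTop (nhds ‖p - q‖) :=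
        ((hst.sub_const q).norm)
      refine t.eventually_lt_const ?_
      have := min_le_right (δ / 2) (δ / (2 * D))
      have h5 : δ / (2 * D) < δ / D := by
        gcongr; linarith
      linarith
    filter_upwards [hnear] with n hn
    obtain ⟨χ', hχ'⟩ : ∃ χ', IsTestTriple β χ' (s n - q) :=
      (coreGraph β h0).sub_mem ⟨_, hχ n⟩ ⟨_, hψ⟩
    have e : (fun x => χ n x - ψ x) =ᵐ[vol01] χ' := by
      filter_upwards [(hχ n).fst, hψ.fst, hχ'.fst, Lp.coeFn_sub (s n).1 q.1] with x h1 h2 h3 h4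
      rw [← h3, Prod.fst_sub, h4, Pi.sub_apply, h1, h2]
    have e2 := seminormS_congr (μ := 1 - β) e
    rw [(h _ _ hχ').2.2] at e2
    refine (show _ = seminormS (1 - β) (fun x => χ n x - ψ x) from rfl).trans_le ?_
    rw [e2]
    refine ENNReal.ofReal_le_ofReal ?_
    have hin : inner ℝ (s n - q).2.1 (s n - q).2.2 ≤ ‖s n - q‖ ^ 2 := by
      refine (real_inner_le_norm _ _).trans ?_
      rw [pow_two]
      exact mul_le_mul ((norm_fst_le (s n - q).2).trans (norm_snd_le (s n - q)))
        ((norm_snd_le (s n - q).2).trans (norm_snd_le (s n - q))) (norm_nonneg _) (norm_nonneg _)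
    have hsq : √(inner ℝ (s n - q).2.1 (s n - q).2.2) ≤ ‖s n - q‖ :=
      (Real.sqrt_le_sqrt hin).trans_eq (Real.sqrt_sq (norm_nonneg _))
    calc D * √(inner ℝ (s n - q).2.1 (s n - q).2.2) ≤ D * (δ / D) := by
          gcongr
          exact hsq.trans hn.le
      _ = δ := by field_simp


/-! ### Du Bois-Reymond and vanishing criteria -/

lemma IsTest.integrable_mul {ψ : ℝ → ℝ} (h : IsTest ψ) {f : ℝ → ℝ} (hf : Integrable f vol01) :
    Integrable (fun x => f x * ψ x) vol01 := by
  obtain ⟨C, hC⟩ := h.2.1.exists_bound_of_continuous h.continuous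
  exact hf.mul_bdd (c := C) h.continuous.aestronglyMeasurable (ae_of_all _ hC)

lemma ae_eq_zero_of_forall_isTest {f : ℝ → ℝ} (hf : Integrable f vol01)
    (h : ∀ ψ, IsTest ψ → ∫ x, f x * ψ x ∂vol01 = 0) : f =ᵐ[vol01] 0 := by
  have hloc : LocallyIntegrableOn f (Ioo 0 1) :=
    (show IntegrableOn f (Ioo 0 1) volume from hf).locallyIntegrableOn
  have := isOpen_Ioo.ae_eq_zero_of_integral_contDiff_smul_eq_zero hloc (fun g hg1 hg2 hg3 => by
    have hg : IsTest g := ⟨hg1, hg2, hg3⟩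
    rw [← h g hg, hg.integral_eq]
    simp_rw [smul_eq_mul, mul_comm])
  exact (ae_restrict_iff' measurableSet_Ioo).2 this

lemma exists_isTest_integral_eq_one : ∃ η : ℝ → ℝ, IsTest η ∧ ∫ x, η x = 1 := by
  let b : ContDiffBump (1 / 2 : ℝ) := ⟨1 / 8, 1 / 4, by norm_num, by norm_num⟩
  refine ⟨b.normed volume, ⟨b.contDiff_normed, b.hasCompactSupport_normed, ?_⟩, b.integral_normed⟩
  rw [b.tsupport_normed_eq, Real.closedBall_eq_Icc]
  intro x hx
  have : b.rOut = 1 / 4 := rfl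
  rw [this] at hx
  constructor <;> norm_num at hx ⊢ <;> linarith [hx.1, hx.2]

/-- Mean zero is exactly what makes the primitive vanish again to the right of the support. -/
lemma IsTest.exists_primitive {χ : ℝ → ℝ} (h : IsTest χ) (h0 : ∫ x, χ x = 0) :
    ∃ Ψ, IsTest Ψ ∧ deriv Ψ = χ := by
  obtain ⟨a, b, ha, hb, hz⟩ := h.exists_Icc
  set Ψ : ℝ → ℝ := fun x => ∫ t in a..x, χ t with hΨ
  have hd : ∀ x, HasDerivAt Ψ (χ x) x := fun x =>
    intervalIntegral.integral_hasDerivAt_right (h.continuous.intervalIntegrable _ _)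
      h.continuous.stronglyMeasurable.stronglyMeasurableAtFilter h.continuous.continuousAt
  have hde : deriv Ψ = χ := funext fun x => (hd x).deriv
  refine ⟨Ψ, isTest_of_Icc ?_ ha hb fun x hx => ?_, hde⟩
  · rw [contDiff_infty_iff_deriv, hde]
    exact ⟨fun x => (hd x).differentiableAt, h.1⟩
  · have hza : ∀ t < a, χ t = 0 := fun t ht => hz t fun h' => absurd h'.1 (not_le.2 ht)
    have hzb : ∀ t, b < t → χ t = 0 := fun t ht => hz t fun h' => absurd h'.2 (not_le.2 ht)
    simp only [hΨ]
    rcases lt_or_ge x a with hxa | hxa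
    · rw [intervalIntegral.integral_symm, intervalIntegral.integral_of_le hxa.le,
        integral_Ioc_eq_integral_Ioo, setIntegral_congr_fun (g := fun _ => 0) measurableSet_Ioo
        (fun t ht => hza t ht.2)]
      simp
    · have hxb : b < x := not_le.1 fun h' => hx ⟨hxa, h'⟩
      rw [intervalIntegral.integral_of_le hxa, ← integral_Icc_eq_integral_Ioc,
        setIntegral_eq_integral_of_forall_compl_eq_zero, h0]
      intro t ht
      by_contra hne
      refine ht ⟨not_lt.1 fun h' => hne (hza t h'), not_lt.1 fun h' => hne (hzb t (hxb.trans h'))⟩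

/-- The lemma of du Bois-Reymond. -/
lemma exists_ae_eq_const {f : ℝ → ℝ} (hf : Integrable f vol01)
    (h : ∀ ψ, IsTest ψ → ∫ x, f x * deriv ψ x ∂vol01 = 0) : ∃ c : ℝ, f =ᵐ[vol01] fun _ => c := by
  obtain ⟨η, hη, hη1⟩ := exists_isTest_integral_eq_one
  refine ⟨∫ x, f x * η x ∂vol01, ?_⟩
  set c := ∫ x, f x * η x ∂vol01 with hc
  have key : (fun x => f x - c) =ᵐ[vol01] 0 := by
    refine ae_eq_zero_of_forall_isTest (hf.sub (integrable_const c)) fun ψ hψ => ?_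
    have hψ1 : ∫ x, ψ x ∂vol01 = ∫ x, ψ x := by
      simpa using hψ.integral_eq fun _ => 1
    -- Subtracting a multiple of a bump of mass one gives mean zero, so the result is the derivative
    -- of a test function.
    have hχ : IsTest (ψ - (∫ x, ψ x) • η) := hψ.sub (hη.const_smul _)
    have hχ0 : ∫ x, (ψ - (∫ x, ψ x) • η) x = 0 := by
      simp only [Pi.sub_apply, Pi.smul_apply, smul_eq_mul]
      rw [integral_sub hψ.integrable (hη.integrable.const_mul _), integral_const_mul, hη1]
      ring
    obtain ⟨Ψ, hΨ, hd⟩ := hχ.exists_primitive hχ0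
    have h1 := h Ψ hΨ
    rw [hd] at h1
    have e : ∀ x, f x * (ψ - (∫ x, ψ x) • η) x = f x * ψ x - (∫ x, ψ x) * (f x * η x) := by
      intro x
      simp only [Pi.sub_apply, Pi.smul_apply, smul_eq_mul]
      ring
    simp_rw [e] at h1
    rw [integral_sub (hψ.integrable_mul hf) ((hη.integrable_mul hf).const_mul _),
      integral_const_mul] at h1
    simp_rw [sub_mul]
    rw [integral_sub (hψ.integrable_mul hf) (hψ.integrable.restrict.const_mul c),
      integral_const_mul, hψ1]
    linarith
  filter_upwards [key] with x hx
  simp only [Pi.zero_apply] at hx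
  linarith

lemma IsTest.integral_leftI_one_mul_deriv {ψ : ℝ → ℝ} (h : IsTest ψ) {f : ℝ → ℝ}
    (hf : MemLp f 2 vol01) : ∫ x, leftI 1 f x * deriv ψ x ∂vol01 = -∫ x, f x * ψ x ∂vol01 := by
  have e := integral_mul_leftI one_pos hf h.isTest_deriv.memLp
  simp_rw [mul_comm (leftI 1 f _)]
  rw [e, ← integral_neg]
  refine setIntegral_congr_fun measurableSet_Ioo fun x hx => ?_
  rw [h.rightI_deriv (Ioo_subset_Icc_self hx), mul_neg]

lemma ae_eq_zero_of_leftI_one {f : ℝ → ℝ} (hf : MemLp f 2 vol01) {c : ℝ}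
    (h : leftI 1 f =ᵐ[vol01] fun _ => c) : f =ᵐ[vol01] 0 := by
  refine ae_eq_zero_of_forall_isTest (hf.integrable (by norm_num)) fun ψ hψ => ?_
  have e := hψ.integral_leftI_one_mul_deriv hf
  rw [integral_congr_ae (g := fun x => c * deriv ψ x) (h.mono fun x hx => by simp only [hx]),
    integral_const_mul, hψ.integral_deriv] at e
  linarith

/-- The energy is a multiple of the squared norm of the potential of order σ/2 on the line. If that
potential vanishes, integrating by the complementary order 1-σ/2 shows that the primitive of f
vanishes. -/
lemma ae_eq_zero_of_energy {σ : ℝ} (h0 : 0 < σ) (h1 : σ < 1) {f : ℝ → ℝ} (hf : MemLp f 2 vol01)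
    (hE : energy σ f = 0) : f =ᵐ[vol01] 0 := by
  obtain ⟨c, -, h⟩ := exists_integral_leftI_sq (β := σ / 2) (by linarith) (by linarith)
  obtain ⟨hi, he⟩ := (h f hf).1
  rw [show 2 * (σ / 2) = σ by ring, hE, mul_zero,
    integral_eq_zero_iff_of_nonneg (fun t => mul_self_nonneg _) hi] at he
  have hf1 : Integrable f vol01 := hf.integrable (by norm_num)
  refine ae_eq_zero_of_leftI_one hf (c := 0) (ae_of_all _ fun x => ?_)
  rw [← integral_kappa_mul_leftI (p := 1 - σ / 2) (q := σ / 2) (by linarith) (by linarith) (by ring)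
    hf1 x]
  refine integral_eq_zero_of_ae ?_
  filter_upwards [he] with t ht
  have : leftI (σ / 2) f t = 0 := mul_self_eq_zero.1 ht
  simp [this]

lemma integral_mul_leftI_self {β : ℝ} (h0 : 0 < β) {h : ℝ → ℝ} (hh : MemLp h 2 vol01) :
    ∫ x, h x * leftI β h x ∂vol01 = (2 * Real.Gamma β)⁻¹ * energy β h := by
  rw [energy_eq_kappa h0 hh, ← mul_assoc, inv_mul_cancel₀ (by positivity), one_mul,
    integral_prod_symm _ (integrable_kappa_mul_mul h0 hh hh)]
  congr 1
  ext x
  rw [leftI, ← integral_const_mul]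
  congr 1
  ext s
  ring

/-! ### The range of the two-sided derivative and its annihilator -/

/-- A function that annihilates `θ I_l ψ' + (1-θ) I_r ψ'` for all test functions `ψ` has a constant
two-sided fractional integral; both this constant and the mean of the function are nonzero unless
the function vanishes. -/
lemma exists_const_of_annihilator {β θ : ℝ} (h0 : 0 < β) (h1 : β < 1 / 2) {h : L2}
    (hann : ∀ p ∈ graph β h0, inner ℝ (θ • p.2.1 + (1 - θ) • p.2.2) h = 0) :
    ∃ C : ℝ, (fun x => (1 - θ) * leftI β h x + θ * rightI β h x) =ᵐ[vol01] fun _ => C := by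
  have hh := Lp.memLp h
  have hone : MemLp (fun _ : ℝ => (1 : ℝ)) 2 vol01 := memLp_const 1
  have iL : Integrable (leftI β h) vol01 := by
    simpa using integrable_mul_leftI h0 hh hone
  have iR : Integrable (rightI β h) vol01 := by
    simpa using integrable_mul_rightI h0 hone hh
  refine exists_ae_eq_const ((iL.const_mul _).add (iR.const_mul _)) fun ψ hψ => ?_
  obtain ⟨p, hp⟩ := exists_isTestTriple h0 h1 hψ
  have hd := hψ.isTest_deriv.memLp
  have e := hann p (subset_closure ⟨ψ, hp⟩)
  rw [inner_add_left, inner_smul_left, inner_smul_left,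
    inner_eq_integral_of_ae hp.left (ae_eq_refl _),
    inner_eq_integral_of_ae hp.right (ae_eq_refl _)] at e
  simp only [conj_trivial, mul_comm (leftI β (deriv ψ) _), mul_comm (rightI β (deriv ψ) _)] at e
  -- Adjointness moves the fractional integrals from ψ' to h and exchanges left and right, hence
  -- also the weights.
  rw [integral_mul_leftI h0 hd hh, ← integral_mul_leftI h0 hh hd] at e
  have i1 := integrable_mul_leftI h0 hh hd
  have i2 := integrable_mul_rightI h0 hd hh
  have e2 : ∀ x, ((1 - θ) * leftI β h x + θ * rightI β h x) * deriv ψ x =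
      (1 - θ) * (deriv ψ x * leftI β h x) + θ * (deriv ψ x * rightI β h x) := fun x => by ring
  simp_rw [e2]
  rw [integral_add (i1.const_mul _) (i2.const_mul _), integral_const_mul, integral_const_mul]
  linarith

/-- Pair the identity with h: by adjointness the left and right integrals have the same pairing with
h, and the weights 1-θ and θ add up to one, so θ disappears. -/
lemma const_mul_integral_eq_energy {β θ : ℝ} (h0 : 0 < β) {h : L2} {C : ℝ}
    (hC : (fun x => (1 - θ) * leftI β h x + θ * rightI β h x) =ᵐ[vol01] fun _ => C) :
    C * ∫ x, h x ∂vol01 = (2 * Real.Gamma β)⁻¹ * energy β h := by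
  have hh := Lp.memLp h
  have e1 := integral_mul_leftI_self h0 hh
  have e2 := integral_mul_leftI h0 hh hh
  have i1 := integrable_mul_leftI h0 hh hh
  have i2 := integrable_mul_rightI h0 hh hh
  have e3 : ∫ x, h x * ((1 - θ) * leftI β h x + θ * rightI β h x) ∂vol01 =
      C * ∫ x, h x ∂vol01 := by
    rw [← integral_const_mul]
    refine integral_congr_ae (hC.mono fun x hx => ?_)
    simp only at hx ⊢
    rw [hx, mul_comm]
  have e4 : ∀ x, h x * ((1 - θ) * leftI β h x + θ * rightI β h x) =
      (1 - θ) * (h x * leftI β h x) + θ * (h x * rightI β h x) := fun x => by ring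
  simp_rw [e4] at e3
  rw [integral_add (i1.const_mul _) (i2.const_mul _), integral_const_mul, integral_const_mul, ← e2,
    e1] at e3
  linarith

lemma eq_zero_of_const_mul_integral {β θ : ℝ} (h0 : 0 < β) (h1 : β < 1 / 2) {h : L2} {C : ℝ}
    (hC : (fun x => (1 - θ) * leftI β h x + θ * rightI β h x) =ᵐ[vol01] fun _ => C)
    (hz : C * ∫ x, h x ∂vol01 = 0) : h = 0 := by
  rw [const_mul_integral_eq_energy h0 hC] at hz
  have hE : energy β h = 0 := by
    rcases mul_eq_zero.1 hz with h' | h'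
    · exact absurd h' (by positivity)
    · exact h'
  rw [Lp.eq_zero_iff_ae_eq_zero]
  exact ae_eq_zero_of_energy h0 (by linarith) (Lp.memLp h) hE

/-- Testing θ a + (1-θ) b against a + b gives θ‖a‖² + (1-θ)‖b‖² + (a,b), and (a,b) alone is
coercive; the bound is uniform in θ. The first component is controlled by a. -/
lemma exists_norm_le_of_graph {β : ℝ} (h0 : 0 < β) (h1 : β < 1 / 2) :
    ∃ C : ℝ, 0 ≤ C ∧ ∀ θ : ℝ, 0 ≤ θ → θ ≤ 1 → ∀ p ∈ graph β h0,
      ‖p‖ ≤ C * ‖θ • p.2.1 + (1 - θ) • p.2.2‖ := by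
  obtain ⟨κ, hκ, hco⟩ := exists_graph_coercive h0 h1
  obtain ⟨B, hB, hbd⟩ := exists_abs_leftI_le (σ := 1 - β) (by linarith)
  refine ⟨max 1 B * (2 / κ), by positivity, fun θ hθ0 hθ1 p hp => ?_⟩
  obtain ⟨ha, hb⟩ := hco p hp
  set t := θ • p.2.1 + (1 - θ) • p.2.2 with ht
  set m := ‖p.2‖ with hm
  have hm' : m = max ‖p.2.1‖ ‖p.2.2‖ := rfl
  have hin : inner ℝ t (p.2.1 + p.2.2) =
      θ * ‖p.2.1‖ ^ 2 + (1 - θ) * ‖p.2.2‖ ^ 2 + inner ℝ p.2.1 p.2.2 := by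
    rw [ht, inner_add_left, inner_add_right, inner_add_right]
    simp only [inner_smul_left, conj_trivial, real_inner_self_eq_norm_sq]
    rw [real_inner_comm p.2.1 p.2.2]
    ring
  have hκm : κ * m ^ 2 ≤ inner ℝ p.2.1 p.2.2 := by
    rcases max_choice ‖p.2.1‖ ‖p.2.2‖ with h | h <;> rw [hm', h] <;> assumption
  have h3 : κ * m ^ 2 ≤ ‖t‖ * (2 * m) := by
    calc κ * m ^ 2 ≤ inner ℝ t (p.2.1 + p.2.2) := by
          rw [hin]
          have := mul_nonneg hθ0 (sq_nonneg ‖p.2.1‖)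
          have := mul_nonneg (sub_nonneg.2 hθ1) (sq_nonneg ‖p.2.2‖)
          linarith
      _ ≤ ‖t‖ * ‖p.2.1 + p.2.2‖ := real_inner_le_norm _ _
      _ ≤ ‖t‖ * (2 * m) := by
          gcongr
          have := norm_add_le p.2.1 p.2.2
          have h5 := norm_fst_le p.2
          have h6 := norm_snd_le p.2
          linarith
  have h4 : m ≤ 2 / κ * ‖t‖ := by
    rcases (norm_nonneg p.2).eq_or_lt with h | h
    · rw [hm, ← h]; positivity
    · rw [← hm] at h
      have : κ * m ≤ 2 * ‖t‖ := by
        refine le_of_mul_le_mul_right ?_ h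
        nlinarith
      rw [div_mul_eq_mul_div, le_div_iff₀ hκ]
      linarith
  have h5 : ‖p.1‖ ≤ B * ‖p.2.1‖ := norm_le_of_bound (by positivity) (graph_fst_eq_left h1 hp)
    fun x hx => (hbd p.2.1 x (Ioo_subset_Icc_self hx)).1
  have h6 : ‖p.2.1‖ ≤ m := norm_fst_le p.2
  rw [Prod.norm_def]
  calc max ‖p.1‖ ‖p.2‖ ≤ max 1 B * m := by
        refine max_le ?_ ?_
        · exact h5.trans (mul_le_mul (le_max_right _ _) h6 (norm_nonneg _) (by positivity))
        · exact le_mul_of_one_le_left (norm_nonneg _) (le_max_left _ _)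
    _ ≤ max 1 B * (2 / κ * ‖t‖) := by gcongr
    _ = max 1 B * (2 / κ) * ‖t‖ := by ring

/-- The operator `(u, a, b) ↦ θ a + (1 - θ) b`. -/
def combine (θ : ℝ) : L2 × L2 × L2 →L[ℝ] L2 :=
  θ • (ContinuousLinearMap.fst ℝ L2 L2).comp (ContinuousLinearMap.snd ℝ L2 (L2 × L2)) +
  (1 - θ) • (ContinuousLinearMap.snd ℝ L2 L2).comp (ContinuousLinearMap.snd ℝ L2 (L2 × L2))

lemma combine_apply (θ : ℝ) (p : L2 × L2 × L2) :
    combine θ p = θ • p.2.1 + (1 - θ) • p.2.2 := rfl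

/-- The range of the two-sided derivative. -/
def rangeD (β θ : ℝ) (h0 : 0 < β) : Submodule ℝ L2 := (graph β h0).map (combine θ).toLinearMap

lemma isClosed_rangeD {β θ : ℝ} (h0 : 0 < β) (h1 : β < 1 / 2) (hθ0 : 0 ≤ θ) (hθ1 : θ ≤ 1) :
    IsClosed (rangeD β θ h0 : Set L2) := by
  obtain ⟨C, hC, h⟩ := exists_norm_le_of_graph h0 h1
  have := (isClosed_graph β h0).completeSpace_coe
  set g := (combine θ).comp (graph β h0).subtypeL with hg
  have hanti : AntilipschitzWith ⟨C, hC⟩ g :=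
    g.antilipschitz_of_bound fun q => h θ hθ0 hθ1 q.1 q.2
  have hcl := hanti.isClosed_range g.uniformContinuous
  have e : (rangeD β θ h0 : Set L2) = range g := by
    ext f
    simp [rangeD, hg]
  rw [e]
  exact hcl

lemma mem_orthogonal_rangeD {β θ : ℝ} {h0 : 0 < β} {h : L2} (hh : h ∈ (rangeD β θ h0)ᗮ) :
    ∀ p ∈ graph β h0, inner ℝ (θ • p.2.1 + (1 - θ) • p.2.2) h = 0 := fun _ hp =>
  (Submodule.mem_orthogonal _ _).1 hh _ (Submodule.mem_map_of_mem hp)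

/-- The two-sided derivative is not onto. -/
lemma exists_ne_zero_mem_orthogonal {β θ : ℝ} (h0 : 0 < β) (h1 : β < 1 / 2) (hθ0 : 0 ≤ θ)
    (hθ1 : θ ≤ 1) : ∃ h ∈ (rangeD β θ h0)ᗮ, h ≠ 0 := by
  by_contra hcon
  push Not at hcon
  have hbot : (rangeD β θ h0)ᗮ = ⊥ := (Submodule.eq_bot_iff _).2 hcon
  have htop : rangeD β θ h0 = ⊤ := by
    rw [← (isClosed_rangeD h0 h1 hθ0 hθ1).submodule_topologicalClosure_eq,
      ← Submodule.orthogonal_orthogonal_eq_closure, hbot, Submodule.bot_orthogonal_eq_top]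
  have hσ : 1 / 2 < 1 - β := by linarith
  -- This kernel represents evaluation of φ at 1, so it is orthogonal to every a. Were it equal to θ
  -- a + (1-θ) b, pairing with a would give θ‖a‖² + (1-θ)(a,b) = 0, forcing a = b = 0.
  set k : L2 := (memLp_kappa_sub_left hσ 1).toLp _ with hk
  obtain ⟨p, hp, hpk⟩ : k ∈ rangeD β θ h0 := htop ▸ Submodule.mem_top
  change combine θ p = k at hpk
  have hz : inner ℝ k p.2.1 = 0 := by rw [hk, ← leftI_eq_inner hσ, graph_leftI_one h1 hp]
  obtain ⟨κ, hκ, hco⟩ := exists_graph_coercive h0 h1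
  obtain ⟨ha, hb⟩ := hco p hp
  rw [← hpk, combine_apply, inner_add_left, inner_smul_left, inner_smul_left,
    real_inner_self_eq_norm_sq, conj_trivial, conj_trivial, real_inner_comm] at hz
  have ha0 : ‖p.2.1‖ ^ 2 = 0 := by
    have hmin : 0 < min 1 κ := lt_min one_pos hκ
    have : min 1 κ * ‖p.2.1‖ ^ 2 ≤ 0 := by
      have e1 : θ * (min 1 κ * ‖p.2.1‖ ^ 2) ≤ θ * ‖p.2.1‖ ^ 2 := by
        refine mul_le_mul_of_nonneg_left ?_ hθ0
        exact mul_le_of_le_one_left (sq_nonneg _) (min_le_left _ _)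
      have e2 : (1 - θ) * (min 1 κ * ‖p.2.1‖ ^ 2) ≤ (1 - θ) * inner ℝ p.2.1 p.2.2 := by
        refine mul_le_mul_of_nonneg_left (le_trans ?_ ha) (sub_nonneg.2 hθ1)
        exact mul_le_mul_of_nonneg_right (min_le_right _ _) (sq_nonneg _)
      linarith
    nlinarith [sq_nonneg ‖p.2.1‖]
  have ha1 : p.2.1 = 0 := by simpa using ha0
  have hb1 : p.2.2 = 0 := by
    rw [ha1, inner_zero_left] at hb
    have : ‖p.2.2‖ ^ 2 = 0 := by nlinarith [sq_nonneg ‖p.2.2‖]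
    simpa using this
  have hk0 : k = 0 := by rw [← hpk, combine_apply, ha1, hb1]; simp
  have hae : (fun s => kappa (1 - β) (1 - s)) =ᵐ[vol01] 0 :=
    (memLp_kappa_sub_left hσ 1).coeFn_toLp.symm.trans (by rw [← hk, hk0]; exact Lp.coeFn_zero _ _ _)
  obtain ⟨s, hs, hs'⟩ := (hae.and (ae_restrict_mem measurableSet_Ioo)).exists
  have hs1 : 0 < 1 - s := by linarith [hs'.2]
  have hz : kappa (1 - β) (1 - s) = 0 := hs
  rw [kappa_of_pos hs1] at hz
  have := Real.Gamma_pos_of_pos (by linarith : 0 < 1 - β)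
  have : 0 < (1 - s) ^ (1 - β - 1) / Real.Gamma (1 - β) := by positivity
  linarith

/-- The constant function `1` as an element of `L²(0,1)`. -/
def oneL2 : L2 := (memLp_const (1 : ℝ)).toLp _

lemma coeFn_oneL2 : oneL2 =ᵐ[vol01] fun _ => 1 := MemLp.coeFn_toLp _

lemma inner_oneL2 (h : L2) : inner ℝ oneL2 h = ∫ x, h x ∂vol01 := by
  rw [inner_eq_integral_of_ae coeFn_oneL2 (ae_eq_refl _)]
  simp

/-- Modulo constants, the two-sided derivative is onto. -/
lemma exists_graph_add_const {β θ : ℝ} (h0 : 0 < β) (h1 : β < 1 / 2) (hθ0 : 0 ≤ θ)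
    (hθ1 : θ ≤ 1) (f : L2) : ∃ p ∈ graph β h0, ∃ c : ℝ, combine θ p = f + c • oneL2 := by
  obtain ⟨h, hh, hne⟩ := exists_ne_zero_mem_orthogonal (θ := θ) h0 h1 hθ0 hθ1
  obtain ⟨C, hC⟩ := exists_const_of_annihilator h0 h1 (mem_orthogonal_rangeD hh)
  have hCh : C * ∫ x, h x ∂vol01 ≠ 0 := fun hz => hne (eq_zero_of_const_mul_integral h0 h1 hC hz)
  have hC0 : C ≠ 0 := left_ne_zero_of_mul hCh
  have hI0 : ∫ x, h x ∂vol01 ≠ 0 := right_ne_zero_of_mul hCh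
  -- The unique c for which f + c is orthogonal to h.
  set c : ℝ := -(inner ℝ f h / ∫ x, h x ∂vol01) with hc
  have hmem : f + c • oneL2 ∈ rangeD β θ h0 := by
    rw [← (isClosed_rangeD h0 h1 hθ0 hθ1).submodule_topologicalClosure_eq,
      ← Submodule.orthogonal_orthogonal_eq_closure, Submodule.mem_orthogonal]
    intro g hg
    obtain ⟨C', hC'⟩ := exists_const_of_annihilator h0 h1 (mem_orthogonal_rangeD hg)
    -- The combination C g - C' h has constant 0 and therefore vanishes; so the annihilator is the
    -- line spanned by h.
    have hd : (fun x => (1 - θ) * leftI β (C • g - C' • h : L2) x +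
        θ * rightI β (C • g - C' • h : L2) x) =ᵐ[vol01] fun _ => 0 := by
      have hmem : C • g - C' • h ∈ (rangeD β θ h0)ᗮ :=
        Submodule.sub_mem _ (Submodule.smul_mem _ _ hg) (Submodule.smul_mem _ _ hh)
      have hcoe : (C • g - C' • h : L2) =ᵐ[vol01] (C • (g : ℝ → ℝ) + (-C') • (h : ℝ → ℝ)) := by
        filter_upwards [Lp.coeFn_sub (C • g) (C' • h), Lp.coeFn_smul C g, Lp.coeFn_smul C' h]
          with x e1 e2 e3
        rw [e1, Pi.sub_apply, e2, e3]
        simp [sub_eq_add_neg]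
      -- The order β is below 1/2, so linearity at a point needs integrability of the slices, which
      -- Fubini gives for almost every x.
      have hfub : ∀ᵐ x ∂vol01, Integrable (fun s => kappa β (x - s) * g s) vol01 ∧
          Integrable (fun s => kappa β (x - s) * h s) vol01 ∧
          Integrable (fun s => kappa β (s - x) * g s) vol01 ∧
          Integrable (fun s => kappa β (s - x) * h s) vol01 := by
        have key : ∀ u : L2, (∀ᵐ x ∂vol01, Integrable (fun s => kappa β (x - s) * u s) vol01) ∧
            ∀ᵐ x ∂vol01, Integrable (fun s => kappa β (s - x) * u s) vol01 := fun u =>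
          ⟨(integrable_kappa_mul_fst h0 (integrable_coe u)).prod_left_ae,
            (integrable_kappa_mul_snd h0 (integrable_coe u)).prod_right_ae⟩
        filter_upwards [(key g).1, (key h).1, (key g).2, (key h).2] with x e1 e2 e3 e4
        exact ⟨e1, e2, e3, e4⟩
      rw [leftI_congr hcoe, rightI_congr hcoe]
      filter_upwards [hfub, hC, hC'] with x ⟨i1, i2, i3, i4⟩ hx hx'
      have eL : leftI β (C • (g : ℝ → ℝ) + (-C') • (h : ℝ → ℝ)) x =
          C * leftI β g x - C' * leftI β h x := by
        simp only [leftI]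
        rw [← integral_const_mul, ← integral_const_mul,
          ← integral_sub (i1.const_mul C) (i2.const_mul C')]
        congr 1
        ext s
        simp only [Pi.add_apply, Pi.smul_apply, smul_eq_mul]
        ring
      have eR : rightI β (C • (g : ℝ → ℝ) + (-C') • (h : ℝ → ℝ)) x =
          C * rightI β g x - C' * rightI β h x := by
        simp only [rightI]
        rw [← integral_const_mul, ← integral_const_mul,
          ← integral_sub (i3.const_mul C) (i4.const_mul C')]
        congr 1
        ext s
        simp only [Pi.add_apply, Pi.smul_apply, smul_eq_mul]
        ring
      rw [eL, eR]
      linear_combination C * hx' - C' * hx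
    have hz := eq_zero_of_const_mul_integral h0 h1 hd (zero_mul _)
    have hgh : g = (C' / C) • h := by
      rw [sub_eq_zero] at hz
      rw [div_eq_inv_mul, mul_smul, ← hz, smul_smul, inv_mul_cancel₀ hC0, one_smul]
    rw [hgh, inner_smul_left, real_inner_comm, inner_add_left, inner_smul_left, inner_oneL2, hc,
      conj_trivial, conj_trivial]
    field_simp
    ring
  obtain ⟨p, hp, hpe⟩ := hmem
  exact ⟨p, hp, c, hpe⟩

/-- Modulo constants, the two-sided derivative is one-to-one. -/
lemma graph_eq_zero_of_combine_eq_const {β θ : ℝ} (h0 : 0 < β) (h1 : β < 1 / 2) (hθ0 : 0 ≤ θ)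
    (hθ1 : θ ≤ 1) {p : L2 × L2 × L2} (hp : p ∈ graph β h0) {c : ℝ}
    (hc : combine θ p = c • oneL2) : p = 0 := by
  obtain ⟨h, hh, hne⟩ := exists_ne_zero_mem_orthogonal (θ := θ) h0 h1 hθ0 hθ1
  obtain ⟨C, hC⟩ := exists_const_of_annihilator h0 h1 (mem_orthogonal_rangeD hh)
  have hCh : C * ∫ x, h x ∂vol01 ≠ 0 := fun hz => hne (eq_zero_of_const_mul_integral h0 h1 hC hz)
  have e := mem_orthogonal_rangeD hh p hp
  rw [← combine_apply, hc, inner_smul_left, inner_oneL2, conj_trivial] at e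
  have hc0 : c = 0 := (mul_eq_zero.1 e).resolve_right (right_ne_zero_of_mul hCh)
  obtain ⟨B, hB, hn⟩ := exists_norm_le_of_graph h0 h1
  have hle := hn θ hθ0 hθ1 p hp
  rw [← combine_apply, hc, hc0, zero_smul, norm_zero, mul_zero] at hle
  exact norm_le_zero_iff.1 hle


/-! ### Weak derivatives, boundary values and the weak solutions -/

lemma IsTest.mem_H0 {μ : ℝ} {ψ : ℝ → ℝ} (h : IsTest ψ) {u : L2} (hu : u =ᵐ[vol01] ψ) :
    u ∈ H0 μ := by
  rw [mem_H0_iff]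
  intro ε hε
  have e : (fun x => u x - ψ x) =ᵐ[vol01] fun _ => 0 := by
    filter_upwards [hu] with x hx
    rw [hx, sub_self]
  refine ⟨ψ, h, ?_, ?_⟩
  · rw [eLpNorm_congr_ae e]
    simpa using hε
  · rw [seminormS_congr e, seminormS]
    simpa [fourier01] using hε

/-- Elements of `H¹_0(0,1)` are primitives of square integrable functions of mean zero. -/
lemma exists_primitive_of_mem_H0_one {g : L2} (hg : g ∈ H0 1) :
    ∃ g' : L2, g =ᵐ[vol01] leftI 1 g' ∧ ∫ x, g' x ∂vol01 = 0 := by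
  rw [mem_H0_iff] at hg
  have hε : ∀ n : ℕ, 0 < ENNReal.ofReal (1 / ((n : ℝ) + 1)) := fun n => by
    rw [ENNReal.ofReal_pos]; positivity
  choose ψ hψ hψ1 hψ2 using fun n => hg _ (hε n)
  set u : ℕ → L2 := fun n => (hψ n).memLp.toLp _ with hu
  set d : ℕ → L2 := fun n => (hψ n).isTest_deriv.memLp.toLp _ with hd
  have hun : ∀ n, ‖u n - g‖ ≤ 1 / ((n : ℝ) + 1) := by
    intro n
    rw [norm_sub_rev, Lp.norm_def]
    refine ENNReal.toReal_le_of_le_ofReal (by positivity) (le_of_lt ?_)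
    refine lt_of_eq_of_lt (eLpNorm_congr_ae ?_) (hψ1 n)
    filter_upwards [Lp.coeFn_sub g (u n), (hψ n).memLp.coeFn_toLp] with x h1 h2
    rw [h1, Pi.sub_apply, h2]
  have hulim : Filter.Tendsto u Filter.atTop (nhds g) := by
    rw [tendsto_iff_norm_sub_tendsto_zero]
    exact squeeze_zero (fun n => norm_nonneg _) hun tendsto_one_div_add_atTop_nhds_zero_nat
  -- By Plancherel the seminorm of order 1 is the L² norm of the derivative up to 2π.
  have hdc : CauchySeq d := by
    refine cauchySeq_of_le_tendsto_0 (fun N : ℕ => 2 * Real.pi * 2 * (1 / ((N : ℝ) + 1))) ?_ ?_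
    · intro n m N hn hm
      have e : (d n - d m : L2) =ᵐ[vol01] deriv (ψ n - ψ m) := by
        filter_upwards [Lp.coeFn_sub (d n) (d m), (hψ n).isTest_deriv.memLp.coeFn_toLp,
          (hψ m).isTest_deriv.memLp.coeFn_toLp] with x h1 h2 h3
        rw [h1, Pi.sub_apply, h2, h3, deriv_sub ((hψ n).differentiable x)
          ((hψ m).differentiable x)]
      have le := seminormS_sub_le (μ := 1) (hψ n).integrable.restrict (hψ m).integrable.restrict
        (integrable_coe g)
      have mono : ∀ k : ℕ, N ≤ k →
          ENNReal.ofReal (1 / ((k : ℝ) + 1)) ≤ ENNReal.ofReal (1 / ((N : ℝ) + 1)) := by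
        intro k hk
        exact ENNReal.ofReal_le_ofReal (Nat.one_div_le_one_div hk)
      have le2 := le.trans (add_le_add ((hψ2 n).le.trans (mono n hn))
        ((hψ2 m).le.trans (mono m hm)))
      rw [dist_eq_norm, Lp.norm_def, eLpNorm_congr_ae e, ((hψ n).sub (hψ m)).eLpNorm_deriv]
      refine ENNReal.toReal_le_of_le_ofReal (by positivity) ?_
      rw [mul_assoc (2 * Real.pi), ENNReal.ofReal_mul (p := 2 * Real.pi)
        (q := 2 * (1 / ((N : ℝ) + 1))) (by positivity), two_mul (1 / ((N : ℝ) + 1)),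
        ENNReal.ofReal_add (by positivity) (by positivity)]
      gcongr
      exact le2
    · simpa using tendsto_one_div_add_atTop_nhds_zero_nat.const_mul (2 * Real.pi * 2)
  obtain ⟨g', hg'⟩ := cauchySeq_tendsto_of_complete hdc
  have hdn : ∀ n, (d n : ℝ → ℝ) =ᵐ[vol01] deriv (ψ n) := fun n =>
    (hψ n).isTest_deriv.memLp.coeFn_toLp
  refine ⟨g', ?_, ?_⟩
  · have h1 : (g, g') ∈ {p : L2 × L2 | p.1 =ᵐ[vol01] leftI 1 p.2} := by
      refine (isClosed_leftI (σ := 1) (by norm_num)).mem_of_tendsto (hulim.prodMk_nhds hg')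
        (Filter.Eventually.of_forall fun n => ?_)
      rw [mem_ofPred_eq, leftI_congr (hdn n)]
      filter_upwards [(hψ n).memLp.coeFn_toLp, ae_restrict_mem measurableSet_Ioo] with x h1 h2
      rw [h1, (hψ n).leftI_deriv (Ioo_subset_Icc_self h2)]
    exact h1
  · rw [← leftI_one_one]
    have h1 : g' ∈ {u : L2 | leftI 1 u 1 = 0} := by
      refine (isClosed_leftI_eq_zero (σ := 1) (by norm_num) 1).mem_of_tendsto hg'
        (Filter.Eventually.of_forall fun n => ?_)
      rw [mem_ofPred_eq, leftI_congr (hdn n), leftI_one_one, (hψ n).integral_deriv]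
    exact h1

lemma hasWeakDeriv_of_leftI_one {w w' : L2} {c : ℝ}
    (h : w =ᵐ[vol01] fun x => c + leftI 1 w' x) : HasWeakDeriv w w' := by
  intro ψ hψ
  have hi : Integrable (leftI 1 w') vol01 :=
    (memLp_leftI_of_half_lt (by norm_num) w').integrable (by norm_num)
  rw [← hψ.integral_leftI_one_mul_deriv (Lp.memLp w'),
    integral_congr_ae (g := fun x => c * deriv ψ x + leftI 1 w' x * deriv ψ x)
      (h.mono fun x hx => by simp only [hx]; ring),
    integral_add (hψ.isTest_deriv.integrable.restrict.const_mul c)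
      (hψ.isTest_deriv.integrable_mul hi), integral_const_mul, hψ.integral_deriv]
  ring

lemma HasWeakDeriv.exists_eq_leftI_one {w w' : L2} (h : HasWeakDeriv w w') :
    ∃ c : ℝ, w =ᵐ[vol01] fun x => c + leftI 1 w' x := by
  have hi : Integrable (leftI 1 w') vol01 :=
    (memLp_leftI_of_half_lt (by norm_num) w').integrable (by norm_num)
  obtain ⟨c, hc⟩ := exists_ae_eq_const ((integrable_coe w).sub hi) fun ψ hψ => by
    simp only [Pi.sub_apply, sub_mul]
    rw [integral_sub (hψ.isTest_deriv.integrable_mul (integrable_coe w))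
      (hψ.isTest_deriv.integrable_mul hi), h ψ hψ, hψ.integral_leftI_one_mul_deriv (Lp.memLp w'),
      sub_self]
  refine ⟨c, hc.mono fun x hx => ?_⟩
  simp only [Pi.sub_apply] at hx
  linarith

lemma HasWeakDeriv.unique {w a b : L2} (ha : HasWeakDeriv w a) (hb : HasWeakDeriv w b) : a = b := by
  rw [← sub_eq_zero, Lp.eq_zero_iff_ae_eq_zero]
  refine ae_eq_zero_of_forall_isTest (integrable_coe _) fun ψ hψ => ?_
  rw [integral_congr_ae (g := fun x => a x * ψ x - b x * ψ x)
    ((Lp.coeFn_sub a b).mono fun x hx => by simp only [hx, Pi.sub_apply]; ring),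
    integral_sub (hψ.integrable_mul (integrable_coe a)) (hψ.integrable_mul (integrable_coe b))]
  have := ha ψ hψ
  have := hb ψ hψ
  linarith

lemma continuousOn_leftI_one {f : ℝ → ℝ} (hf : Integrable f vol01) :
    ContinuousOn (leftI 1 f) (Icc 0 1) := by
  have h : IntegrableOn f (uIcc 0 1) := by
    rw [uIcc_of_le zero_le_one]
    exact (integrableOn_Icc_iff_integrableOn_Ioo (by simp) (by simp)).2 hf
  have h2 := intervalIntegral.continuousOn_primitive_interval h
  rw [uIcc_of_le zero_le_one] at h2
  exact h2.congr fun x hx => leftI_one hx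

/-- Continuous representatives that agree almost everywhere agree on all of [0,1], so the primitive
itself may be evaluated at the endpoints. -/
lemma hasBoundaryValues_iff {w w' : L2} {c p q : ℝ}
    (h : w =ᵐ[vol01] fun x => c + leftI 1 w' x) :
    HasBoundaryValues w p q ↔ c = p ∧ c + ∫ x, w' x ∂vol01 = q := by
  have hcont : ContinuousOn (fun x => c + leftI 1 w' x) (Icc 0 1) :=
    continuousOn_const.add (continuousOn_leftI_one (integrable_coe w'))
  have h0 : leftI 1 w' 0 = 0 := leftI_of_nonpos _ le_rfl
  have h1 := leftI_one_one w'
  constructor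
  · rintro ⟨v, hv, hwv, hv0, hv1⟩
    have e : v =ᵐ[volume.restrict (Icc 0 1)] fun x => c + leftI 1 w' x := by
      rw [← restrict_Ioo_eq_restrict_Icc]
      exact hwv.symm.trans h
    have heq := Measure.eqOn_Icc_of_ae_eq volume zero_ne_one e hv hcont
    have e0 := heq ⟨le_rfl, zero_le_one⟩
    have e1 := heq ⟨zero_le_one, le_rfl⟩
    simp only [h0, h1] at e0 e1
    constructor <;> linarith
  · rintro ⟨hp, hq⟩
    exact ⟨_, hcont, h, by simp only [h0]; linarith, by simp only [h1]; linarith⟩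

/-- Weak solutions are the primitives of the multiples of `1/K`. -/
lemma exists_forall_isWeakSolution_iff {K : ℝ → ℝ} {Km KM : ℝ} (hKmeas : AEMeasurable K vol01)
    (hKm : 0 < Km) (hK : ∀ᵐ x ∂vol01, Km ≤ K x ∧ K x ≤ KM) :
    ∃ k : L2, ∫ x, k x ∂vol01 = 1 ∧ ∀ (p q : ℝ) (w : L2),
      IsWeakSolution K p q w ↔ w =ᵐ[vol01] fun x => p + (q - p) * leftI 1 k x := by
  have hmem : MemLp (fun x => (K x)⁻¹) 2 vol01 := by
    refine MemLp.of_bound hKmeas.inv.aestronglyMeasurable Km⁻¹ ?_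
    filter_upwards [hK] with x hx
    have : 0 < K x := hKm.trans_le hx.1
    rw [Real.norm_of_nonneg (by positivity)]
    exact inv_anti₀ hKm hx.1
  set I := ∫ x, (K x)⁻¹ ∂vol01 with hI
  have hI0 : 0 < I := by
    have hKMpos : 0 < KM := by
      obtain ⟨x, hx⟩ := hK.exists
      exact hKm.trans_le (hx.1.trans hx.2)
    have : ∫ _, KM⁻¹ ∂vol01 ≤ I := by
      refine integral_mono_ae (integrable_const _) (hmem.integrable (by norm_num)) ?_
      filter_upwards [hK] with x hx
      exact inv_anti₀ (hKm.trans_le hx.1) hx.2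
    refine lt_of_lt_of_le ?_ this
    simpa using hKMpos
  -- The flux K Dw is constant, so Dw is a multiple of 1/K; mean one makes that multiple equal to q
  -- - p.
  set k : L2 := (I⁻¹ : ℝ) • hmem.toLp _ with hk
  have hkae : k =ᵐ[vol01] fun x => I⁻¹ * (K x)⁻¹ := by
    filter_upwards [Lp.coeFn_smul (I⁻¹) (hmem.toLp _), hmem.coeFn_toLp] with x h1 h2
    rw [hk, h1, Pi.smul_apply, h2, smul_eq_mul]
  have hk1 : ∫ x, k x ∂vol01 = 1 := by
    rw [integral_congr_ae hkae, integral_const_mul, ← hI, inv_mul_cancel₀ hI0.ne']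
  have hsm : ∀ c : ℝ, ∀ x, leftI 1 (c • k : L2) x = c * leftI 1 k x := fun c x =>
    leftI_smul (by norm_num) c k x
  have hint : ∀ c : ℝ, ∫ x, (c • k : L2) x ∂vol01 = c := fun c => by
    rw [← leftI_one_one, hsm, leftI_one_one, hk1, mul_one]
  refine ⟨k, hk1, fun p q w => ⟨?_, fun hw => ?_⟩⟩
  · rintro ⟨w', hww', hbv, horth⟩
    have hKw : Integrable (fun x => K x * w' x) vol01 := by
      refine (integrable_coe w').bdd_mul (c := KM) hKmeas.aestronglyMeasurable ?_
      filter_upwards [hK] with x hx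
      rw [Real.norm_of_nonneg (hKm.le.trans hx.1)]
      exact hx.2
    obtain ⟨c, hc⟩ := exists_ae_eq_const hKw fun ψ hψ => by
      have hv : hψ.memLp.toLp _ ∈ H0 1 := hψ.mem_H0 hψ.memLp.coeFn_toLp
      have hd := hψ.isTest_deriv.memLp
      have hwd : HasWeakDeriv (hψ.memLp.toLp _) (hd.toLp _) := by
        refine hasWeakDeriv_of_leftI_one (c := 0) ?_
        rw [leftI_congr hd.coeFn_toLp]
        filter_upwards [hψ.memLp.coeFn_toLp, ae_restrict_mem measurableSet_Ioo] with x h1 h2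
        rw [h1, hψ.leftI_deriv (Ioo_subset_Icc_self h2), zero_add]
      rw [← horth _ hv _ hwd]
      refine integral_congr_ae (hd.coeFn_toLp.mono fun x hx => ?_)
      simp only [hx]
    have hw'k : w' = (c * I) • k := by
      refine Lp.ext ?_
      filter_upwards [hc, hkae, Lp.coeFn_smul (c * I) k, hK] with x h1 h2 h3 h4
      have : 0 < K x := hKm.trans_le h4.1
      rw [h3, Pi.smul_apply, h2, smul_eq_mul, ← h1]
      field_simp
    obtain ⟨c₀, hc₀⟩ := hww'.exists_eq_leftI_one
    obtain ⟨e1, e2⟩ := (hasBoundaryValues_iff hc₀).1 hbv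
    rw [hw'k] at hc₀ e2
    rw [hint] at e2
    filter_upwards [hc₀] with x hx
    rw [hx, hsm, e1, ← e2, e1]
    ring
  · have hw' : w =ᵐ[vol01] fun x => p + leftI 1 ((q - p) • k : L2) x := by
      simp_rw [hsm]
      exact hw
    refine ⟨(q - p) • k, hasWeakDeriv_of_leftI_one hw', (hasBoundaryValues_iff hw').2 ⟨rfl, ?_⟩,
      fun v hv v' hvv' => ?_⟩
    · rw [hint]; ring
    · obtain ⟨g', hg', hg0⟩ := exists_primitive_of_mem_H0_one hv
      have hv' : v' = g' := hvv'.unique (hasWeakDeriv_of_leftI_one (c := 0) (by simpa using hg'))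
      rw [hv', integral_congr_ae (g := fun x => (q - p) * I⁻¹ * g' x), integral_const_mul, hg0,
        mul_zero]
      filter_upwards [hkae, Lp.coeFn_smul (q - p) k, hK] with x h2 h3 h4
      have : 0 < K x := hKm.trans_le h4.1
      rw [h3, Pi.smul_apply, h2, smul_eq_mul]
      field_simp

lemma existsUnique_of_iff_ae {P : L2 → Prop} {f : ℝ → ℝ} (hf : MemLp f 2 vol01)
    (h : ∀ w, P w ↔ w =ᵐ[vol01] f) : ∃! w, P w :=
  ⟨hf.toLp _, (h _).2 hf.coeFn_toLp, fun w hw =>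
    Lp.ext (((h w).1 hw).trans hf.coeFn_toLp.symm)⟩

lemma leftI_one_oneL2 {x : ℝ} (hx : x ∈ Icc (0 : ℝ) 1) : leftI 1 oneL2 x = x := by
  rw [leftI_congr coeFn_oneL2, leftI_one hx]
  simp

/-! ### The corrected equations as equations for the two-sided derivative -/

/-- The boundary corrected fractional integral, in terms of the two-sided derivative. -/
lemma boundaryCorrected_of_graph {β θ : ℝ} {h0 : 0 < β} (h1 : β < 1 / 2) {P : L2 × L2 × L2}
    (hP : P ∈ graph β h0) :
    leftI 1 (combine θ P) 1 = θ * leftInt 0 β P.1 1 - (1 - θ) * rightInt 1 β P.1 0 ∧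
    ∀ (p q : ℝ → ℝ) (x : ℝ), x ∈ Icc (0 : ℝ) 1 → boundaryCorrected β θ p q P.1 x =
      leftI 1 (combine θ P) x + (1 - θ) * rightInt 1 β P.1 0 * (1 - p x) -
        θ * leftInt 0 β P.1 1 * q x := by
  have m0 : (0 : ℝ) ∈ Icc (0 : ℝ) 1 := ⟨le_rfl, zero_le_one⟩
  have m1 : (1 : ℝ) ∈ Icc (0 : ℝ) 1 := ⟨zero_le_one, le_rfl⟩
  have hL : leftInt 0 β P.1 1 = ∫ x, P.2.1 x ∂vol01 := by
    rw [leftInt_eq_leftI _ _ m1, graph_leftI h1 hP m1, leftI_one_one]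
  -- The minus sign comes from integrating towards the right endpoint. With this value R at 0, the
  -- right integral at x is R plus the left primitive of b, which produces the factor 1 - p.
  have hR : rightInt 1 β P.1 0 = -∫ x, P.2.2 x ∂vol01 := by
    rw [rightInt_eq_rightI _ _ m0, graph_rightI h1 hP m0, rightI_one_zero]
  have hT : ∀ x, leftI 1 (combine θ P) x =
      θ * leftI 1 P.2.1 x + (1 - θ) * leftI 1 P.2.2 x := by
    intro x
    have hh : (1 / 2 : ℝ) < 1 := by norm_num
    rw [combine_apply, leftI_add hh, leftI_smul hh, leftI_smul hh]
  refine ⟨?_, fun p q x hx => ?_⟩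
  · rw [hT, hL, hR, leftI_one_one, leftI_one_one]
    ring
  · rw [boundaryCorrected, twoSidedInt, leftInt_eq_leftI _ _ hx, rightInt_eq_rightI _ _ hx,
      graph_leftI h1 hP hx, graph_rightI h1 hP hx, hT, hR,
      ← leftI_one_add_rightI_one (integrable_coe P.2.2) hx]
    ring

/-- The constant coefficient problem, in terms of the two-sided derivative. -/
lemma boundaryCorrected_eq_iff {β θ : ℝ} {h0 : 0 < β} (h1 : β < 1 / 2) {P : L2 × L2 × L2}
    (hP : P ∈ graph β h0) {g' : L2} :
    boundaryCorrected β θ (fun x => 1 - x) (fun x => x) P.1 =ᵐ[vol01] leftI 1 g' ↔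
      combine θ P = g' + leftI 1 (combine θ P) 1 • oneL2 := by
  obtain ⟨e1, e2⟩ := boundaryCorrected_of_graph (θ := θ) h1 hP
  set τ := leftI 1 (combine θ P) 1 with hτ
  have hh : (1 / 2 : ℝ) < 1 := by norm_num
  have key : ∀ x ∈ Icc (0 : ℝ) 1,
      boundaryCorrected β θ (fun x => 1 - x) (fun x => x) P.1 x =
        leftI 1 (combine θ P) x - τ * x := by
    intro x hx
    rw [e2 _ _ x hx, e1]
    ring
  constructor
  · intro h
    have hz : leftI 1 (combine θ P + (-1 : ℝ) • g' + (-τ) • oneL2 : L2) =ᵐ[vol01] fun _ => 0 := by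
      filter_upwards [h, ae_restrict_mem measurableSet_Ioo] with x hx hx'
      have hx'' := Ioo_subset_Icc_self hx'
      rw [leftI_add hh, leftI_add hh, leftI_smul hh, leftI_smul hh, leftI_one_oneL2 hx'', ← hx,
        key x hx'']
      ring
    have := ae_eq_zero_of_leftI_one (Lp.memLp _) hz
    rw [← Lp.eq_zero_iff_ae_eq_zero] at this
    rw [← sub_eq_zero, ← this]
    module
  · intro h
    filter_upwards [ae_restrict_mem measurableSet_Ioo] with x hx'
    have hx'' := Ioo_subset_Icc_self hx'
    rw [key x hx'', h, leftI_add hh, leftI_smul hh, leftI_one_oneL2 hx'']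
    ring

/-- Taking means identifies the free constant in the solvability result with τ, so the nonlocal
boundary terms come out right automatically. -/
lemma leftI_one_of_combine_eq {f : L2} {g' : L2} (hg' : ∫ x, g' x ∂vol01 = 0) {c : ℝ}
    (h : f = g' + c • oneL2) : leftI 1 f 1 = c := by
  have hh : (1 / 2 : ℝ) < 1 := by norm_num
  rw [h, leftI_add hh, leftI_smul hh, leftI_one_oneL2 ⟨zero_le_one, le_rfl⟩, leftI_one_one, hg']
  ring

/-- Well-posedness of the constant coefficient problem. -/
lemma existsUnique_isCorrector {β θ : ℝ} (h0 : 0 < β) (h1 : β < 1 / 2) (hθ0 : 0 ≤ θ)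
    (hθ1 : θ ≤ 1) {w : L2} {wc : ℝ → ℝ} {g' : L2} (hg' : ∫ x, g' x ∂vol01 = 0)
    (hw : (fun x => w x - wc x) =ᵐ[vol01] leftI 1 g') : ∃! u, IsCorrector β θ w wc u := by
  obtain ⟨P, hP, c, hc⟩ := exists_graph_add_const h0 h1 hθ0 hθ1 g'
  refine ⟨P.1, ⟨mem_H0_of_mem_graph h1 hP, ?_⟩, fun u hu => ?_⟩
  · refine Filter.EventuallyEq.trans ?_ hw.symm
    rw [boundaryCorrected_eq_iff h1 hP, leftI_one_of_combine_eq hg' hc]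
    exact hc
  · obtain ⟨a, b, hab⟩ := exists_mem_graph_of_mem_H0 h0 h1 hu.1
    have e := (boundaryCorrected_eq_iff h1 hab).1 (hu.2.trans hw)
    have hz : (u, a, b) - P = 0 := by
      refine graph_eq_zero_of_combine_eq_const h0 h1 hθ0 hθ1
        (Submodule.sub_mem _ hab hP) (c := leftI 1 (combine θ (u, a, b)) 1 - c) ?_
      conv_lhs => rw [map_sub, e, hc]
      module
    have := congrArg Prod.fst (sub_eq_zero.1 hz)
    exact this

end TwoSidedFDE
end

/-! ### Equivalence of the two conditions and solvability for every datum -/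

theorem theorem6p2 (β θ : ℝ) (hβ0 : 0 < β) (hβ1 : β < 1 / 2) (hθ0 : 0 ≤ θ) (hθ1 : θ ≤ 1)
    (K : ℝ → ℝ) (Km KM : ℝ) (hKmeas : AEMeasurable K TwoSidedFDE.vol01) (hKm : 0 < Km)
    (hK : ∀ᵐ x ∂TwoSidedFDE.vol01, Km ≤ K x ∧ K x ≤ KM) :
    -- the functions `w_l` and `w_r` are well defined
    (∃! wl : TwoSidedFDE.L2, TwoSidedFDE.IsWeakSolution K 1 0 wl) ∧
    (∃! wr : TwoSidedFDE.L2, TwoSidedFDE.IsWeakSolution K 0 1 wr) ∧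
    ∀ wl wr : TwoSidedFDE.L2,
      TwoSidedFDE.IsWeakSolution K 1 0 wl → TwoSidedFDE.IsWeakSolution K 0 1 wr →
      -- the functions `u_l` and `u_r` are well defined
      (∃! ul : TwoSidedFDE.L2, TwoSidedFDE.IsCorrector β θ wl (fun x => 1 - x) ul) ∧
      (∃! ur : TwoSidedFDE.L2, TwoSidedFDE.IsCorrector β θ wr (fun x => x) ur) ∧
      ∀ ul ur : TwoSidedFDE.L2,
        TwoSidedFDE.IsCorrector β θ wl (fun x => 1 - x) ul →
        TwoSidedFDE.IsCorrector β θ wr (fun x => x) ur →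
        (1 + θ * TwoSidedFDE.leftInt 0 β ul 1 - (1 - θ) * TwoSidedFDE.rightInt 1 β ul 0 ≠ 0 ↔
          1 - θ * TwoSidedFDE.leftInt 0 β ur 1 + (1 - θ) * TwoSidedFDE.rightInt 1 β ur 0 ≠ 0) ∧
        (1 + θ * TwoSidedFDE.leftInt 0 β ul 1 - (1 - θ) * TwoSidedFDE.rightInt 1 β ul 0 ≠ 0 →
          TwoSidedFDE.spaceV β θ wl wr = TwoSidedFDE.H0 1) := by
  open TwoSidedFDE in
  obtain ⟨k, hk1, hk⟩ := exists_forall_isWeakSolution_iff hKmeas hKm hK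
  have hh : (1 / 2 : ℝ) < 1 := by norm_num
  have hmem : ∀ p q : ℝ, MemLp (fun x => p + (q - p) * leftI 1 k x) 2 vol01 := fun p q =>
    (memLp_const p).add ((memLp_leftI_of_half_lt hh k).const_mul _)
  refine ⟨existsUnique_of_iff_ae (hmem 1 0) fun w => hk 1 0 w,
    existsUnique_of_iff_ae (hmem 0 1) fun w => hk 0 1 w, fun wl wr hwl hwr => ?_⟩
  rw [hk] at hwl hwr
  -- The derivative of w_l - w_l^c; that of w_r - w_r^c is its negative.
  set g' : L2 := oneL2 + (-1 : ℝ) • k with hg'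
  have hI : ∀ x ∈ Icc (0 : ℝ) 1, leftI 1 g' x = x - leftI 1 k x := fun x hx => by
    rw [hg', leftI_add hh, leftI_smul hh, leftI_one_oneL2 hx]; ring
  have hg'0 : ∫ x, g' x ∂vol01 = 0 := by
    rw [← leftI_one_one, hI 1 ⟨zero_le_one, le_rfl⟩, leftI_one_one, hk1, sub_self]
  have hng'0 : ∫ x, ((-1 : ℝ) • g' : L2) x ∂vol01 = 0 := by
    rw [← leftI_one_one, leftI_smul hh, leftI_one_one, hg'0, mul_zero]
  have hl : (fun x => wl x - (1 - x)) =ᵐ[vol01] leftI 1 g' := by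
    filter_upwards [hwl, ae_restrict_mem measurableSet_Ioo] with x hx hx'
    rw [hx, hI x (Ioo_subset_Icc_self hx')]; ring
  have hr : (fun x => wr x - x) =ᵐ[vol01] leftI 1 ((-1 : ℝ) • g' : L2) := by
    filter_upwards [hwr, ae_restrict_mem measurableSet_Ioo] with x hx hx'
    rw [hx, leftI_smul hh, hI x (Ioo_subset_Icc_self hx')]; ring
  refine ⟨existsUnique_isCorrector hβ0 hβ1 hθ0 hθ1 hg'0 hl,
    existsUnique_isCorrector hβ0 hβ1 hθ0 hθ1 hng'0 hr, fun ul ur hul hur => ?_⟩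
  obtain ⟨al, bl, hPl⟩ := exists_mem_graph_of_mem_H0 hβ0 hβ1 hul.1
  obtain ⟨ar, br, hPr⟩ := exists_mem_graph_of_mem_H0 hβ0 hβ1 hur.1
  have el := (boundaryCorrected_eq_iff hβ1 hPl).1 (hul.2.trans hl)
  have er := (boundaryCorrected_eq_iff hβ1 hPr).1 (hur.2.trans hr)
  obtain ⟨τl, -⟩ := boundaryCorrected_of_graph (θ := θ) hβ1 hPl
  obtain ⟨τr, -⟩ := boundaryCorrected_of_graph (θ := θ) hβ1 hPr
  -- The data cancel, so the two-sided derivative of the sum is constant and injectivity modulo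
  -- constants applies.
  have hsum : ((ul, al, bl) : L2 × L2 × L2) + (ur, ar, br) = 0 := by
    refine graph_eq_zero_of_combine_eq_const hβ0 hβ1 hθ0 hθ1 (Submodule.add_mem _ hPl hPr)
      (c := leftI 1 (combine θ (ul, al, bl)) 1 + leftI 1 (combine θ (ur, ar, br)) 1) ?_
    rw [map_add]
    conv_lhs => rw [el, er]
    module
  have hτ : leftI 1 (combine θ (ul, al, bl)) 1 + leftI 1 (combine θ (ur, ar, br)) 1 = 0 := by
    rw [← leftI_add hh, ← map_add, hsum, map_zero,
      leftI_congr (Lp.coeFn_zero ℝ 2 vol01), leftI_one_one]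
    simp
  set τ := leftI 1 (combine θ (ul, al, bl)) 1 with hτdef
  simp only at τl τr
  constructor
  · rw [show 1 + θ * leftInt 0 β ul 1 - (1 - θ) * rightInt 1 β ul 0 =
      1 - θ * leftInt 0 β ur 1 + (1 - θ) * rightInt 1 β ur 0 by linarith]
  · intro hne
    have hne' : 1 + τ ≠ 0 := by
      intro h
      apply hne
      linarith
    ext g
    refine ⟨fun hg => hg.1, fun hg => ⟨hg, ?_⟩⟩
    obtain ⟨γ, hγ, hγ0⟩ := exists_primitive_of_mem_H0_one hg
    obtain ⟨P, hP, c, hc⟩ := exists_graph_add_const hβ0 hβ1 hθ0 hθ1 γ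
    -- Chosen so that c + sτ = -s: the constants in the two-sided derivative of Q then cancel,
    -- leaving γ - s k, whose mean -s is the coefficient required in front of k.
    set s : ℝ := -c / (1 + τ) with hs
    set Q : L2 × L2 × L2 := P + s • (ul, al, bl) with hQ
    have hQg : Q ∈ graph β hβ0 := Submodule.add_mem _ hP (Submodule.smul_mem _ _ hPl)
    obtain ⟨e1, e2⟩ := boundaryCorrected_of_graph (θ := θ) hβ1 hQg
    have hTQ : combine θ Q = γ + s • g' + (c + s * τ) • oneL2 := by
      rw [hQ, map_add, map_smul, el, hc]
      module
    have hT : ∀ x ∈ Icc (0 : ℝ) 1, leftI 1 (combine θ Q) x =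
        leftI 1 γ x + s * (x - leftI 1 k x) + (c + s * τ) * x := fun x hx => by
      rw [hTQ, leftI_add hh, leftI_add hh, leftI_smul hh, leftI_smul hh, leftI_one_oneL2 hx, hI x hx]
    have hsτ : c + s * τ = -s := by
      rw [hs]; field_simp; ring
    rw [hT 1 ⟨zero_le_one, le_rfl⟩, leftI_one_one, leftI_one_one, hγ0, hk1, hsτ] at e1
    refine ⟨Q.1, mem_H0_of_mem_graph hβ1 hQg, ?_⟩
    filter_upwards [hγ, hwl, hwr, ae_restrict_mem measurableSet_Ioo] with x hx hxl hxr hx'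
    have hx'' := Ioo_subset_Icc_self hx'
    rw [e2 _ _ x hx'', hT x hx'', hx, hxl, hxr, hsτ]
    linear_combination (leftI 1 k x) * e1
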